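/- For $-\frac12\le\mu<-\frac38$ let $\bar U^{\mu}=(\bar U^\mu_\theta,0)$ with $\bar U^{\mu}_\theta(x)=(1+\sqrt{1+2\mu})(1-x)$ (this is the no-swirl solution $U^{\mu,-1-\sqrt{1+2\mu}}$), let $b_\mu(x)=\int_0^x\frac{\bar U^\mu_\theta(s)}{1-s^2}\,ds$ and $V^2_\mu=\big(0,\int_x^1e^{-b_\mu(t)}\,dt\big)$. For a function $U_\phi$ on $(-1,1]$ put $$\psi[U_\phi](x)=\int_x^1\int_l^1\int_t^1\frac{2U_\phi(s)U_\phi'(s)}{1-s^2}\,ds\,dt\,dl .$$ A pair $U=(U_\theta,U_\phi)$, with $U_\theta\in C^1(-1,1)$, $U_\phi\in C^2(-1,1)$ and $\frac{U_\phi U_\phi'}{1-s^2}$ integrable on $(t,1)$ for each $t\in(-1,1)$, is said to satisfy $(\ast)$ with the constant $\hat\mu\in\mathbb R$ if on $(-1,1)$ $$(1-x^2)U_\theta'+2xU_\theta+\tfrac12U_\theta^2-\psi[U_\phi](x)=\hat\mu(1-x)^2,\qquad (1-x^2)U_\phi''+U_\theta U_\phi'=0 .$$ Let $K$ be a compact subset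 of $(-\frac12,-\frac38)$ or $K=\{-\frac12\}$, and let $0<\epsilon<\frac12$ satisfy $\sqrt{1+2\mu}<\epsilon$ for all $\mu\in K$. Let $\mathbf M_1$ be the space of $f\in C([-1,1])\cap C^1((-1,1])\cap C^2((0,1))$ with $f(\pm1)=0$ and finite norm $$\|f\|_{\mathbf M_1}=\|(1+x)^{-1+2\epsilon}f\|_{L^\infty(-1,1)}+\|(1+x)^{2\epsilon}f'\|_{L^\infty(-1,1)}+\|f''\|_{L^\infty(0,1)},$$ and $\mathbf M_2$ the space of $f\in C^1((-1,1])\cap C^2((-1,1))$ with $f(1)=0$ and finite norm $$\|f\|_{\mathbf M_2}=\|(1+x)^{\epsilon}f\|_{L^\infty(-1,1)}+\|(1+x)^{1+\epsilon}f'\|_{L^\infty(-1,1)}+\|(1+x)^{2+\epsilon}f''\|_{L^\infty(-1,1)}.$$ Let $\mathbf X=\mathbf M_1\times\mathbf M_2$ with $\|(U_\theta,U_\phi)\|_{\mathbf X}=\|U_\theta\|_{\mathbf M_1}+\|U_\phi\|_{\mathbf M_2}$, and $\mathbf X_1=\{V\in\mathbf X: V_\phi(0)=0\}$. Then there exist $\delta>0$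 and $V\in C^\infty(K\times(-\delta,\delta),\mathbf X_1)$ (that is, $V$ extends to a $C^\infty$ map $O\times(-\delta,\delta)\to\mathbf X_1$ for some open set $O\supseteq K$) such that, for all $\mu\in K$, $V(\mu,0)=0$, $\frac{\partial V}{\partial\beta}(\mu,0)=0$, and for all $|\beta|<\delta$ $$U=\bar U^{\mu}+\beta V^2_{\mu}+V(\mu,\beta)\tag{1}$$ satisfies $(\ast)$ with $\hat\mu=\mu-\frac14\psi[U_\phi](-1)$, where the integral $\psi[U_\phi](-1)$ converges; moreover the swirl $U_\phi$ is not identically zero on $(-1,1)$ if $\beta\neq0$. Furthermore there exists $\delta'>0$ such that if $\mu\in K$, $U-\bar U^{\mu}\in\mathbf X$, $\|U-\bar U^{\mu}\|_{\mathbf X}<\delta'$, and $U$ satisfies $(\ast)$ with some constant $\hat\mu$, then $(1)$ holds for some $|\beta|<\delta$. -/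

import Mathlib

open Set MeasureTheory
open scoped ContDiff

namespace ConicalNS

/-! ### Weighted sup norms -/

/-- The weighted norm `‖w f‖_{L^∞(s)}`. It is only used for functions that are continuous on the
open interval `s`, where the essential supremum is the supremum. -/
noncomputable def wSup (s : Set ℝ) (w f : ℝ → ℝ) : ℝ := ⨆ x : s, |w x * f x|

/-- Finiteness of the weighted norm `‖w f‖_{L^∞(s)}`. -/
def WBdd (s : Set ℝ) (w f : ℝ → ℝ) : Prop := BddAbove (range fun x : s => |w x * f x|)

section WeightedSup

variable {s : Set ℝ} {w f g h : ℝ → ℝ}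

theorem wSup_nonneg : 0 ≤ wSup s w f := Real.iSup_nonneg fun _ => abs_nonneg _

theorem le_wSup (hf : WBdd s w f) {x : ℝ} (hx : x ∈ s) : |w x * f x| ≤ wSup s w f :=
  le_ciSup hf (⟨x, hx⟩ : s)

theorem wbdd_of_le {C : ℝ} (hC : ∀ x ∈ s, |w x * f x| ≤ C) : WBdd s w f :=
  ⟨C, by rintro _ ⟨x, rfl⟩; exact hC x x.2⟩

theorem wSup_le {C : ℝ} (h0 : 0 ≤ C) (hC : ∀ x ∈ s, |w x * f x| ≤ C) : wSup s w f ≤ C :=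
  Real.iSup_le (fun x => hC x x.2) h0

theorem abs_add_le_wSup (hf : WBdd s w f) (hg : WBdd s w g) (hh : ∀ x ∈ s, h x = f x + g x) :
    ∀ x ∈ s, |w x * h x| ≤ wSup s w f + wSup s w g := fun x hx => by
  rw [hh x hx, mul_add]
  exact (abs_add_le _ _).trans (add_le_add (le_wSup hf hx) (le_wSup hg hx))

theorem abs_smul_le_wSup (c : ℝ) (hf : WBdd s w f) (hh : ∀ x ∈ s, h x = c * f x) :
    ∀ x ∈ s, |w x * h x| ≤ |c| * wSup s w f := fun x hx => by
  rw [hh x hx, mul_left_comm, abs_mul]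
  exact mul_le_mul_of_nonneg_left (le_wSup hf hx) (abs_nonneg _)

theorem WBdd.add (hf : WBdd s w f) (hg : WBdd s w g) (hh : ∀ x ∈ s, h x = f x + g x) :
    WBdd s w h := wbdd_of_le (abs_add_le_wSup hf hg hh)

theorem WBdd.smul (c : ℝ) (hf : WBdd s w f) (hh : ∀ x ∈ s, h x = c * f x) :
    WBdd s w h := wbdd_of_le (abs_smul_le_wSup c hf hh)

theorem wSup_add (hf : WBdd s w f) (hg : WBdd s w g) (hh : ∀ x ∈ s, h x = f x + g x) :
    wSup s w h ≤ wSup s w f + wSup s w g :=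
  wSup_le (add_nonneg wSup_nonneg wSup_nonneg) (abs_add_le_wSup hf hg hh)

theorem wSup_smul (c : ℝ) (hf : WBdd s w f) (hh : ∀ x ∈ s, h x = c * f x) :
    wSup s w h ≤ |c| * wSup s w f :=
  wSup_le (mul_nonneg (abs_nonneg _) wSup_nonneg) (abs_smul_le_wSup c hf hh)

theorem wbdd_zero (hh : ∀ x ∈ s, h x = 0) : WBdd s w h :=
  wbdd_of_le (C := 0) fun x hx => by simp [hh x hx]

theorem wSup_zero (hh : ∀ x ∈ s, h x = 0) : wSup s w h = 0 :=
  le_antisymm (wSup_le le_rfl fun x hx => by simp [hh x hx]) wSup_nonneg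

theorem eq_zero_of_wSup (hf : WBdd s w f) (hw : ∀ x ∈ s, 0 < w x) (h0 : wSup s w f ≤ 0) :
    ∀ x ∈ s, f x = 0 := fun x hx => by
  have h1 : |w x * f x| ≤ 0 := (le_wSup hf hx).trans h0
  rcases mul_eq_zero.1 (abs_nonpos_iff.1 h1) with h2 | h2
  · exact absurd h2 (hw x hx).ne'
  · exact h2

theorem deriv_add_on (hs : IsOpen s) (hf : DifferentiableOn ℝ f s)
    (hg : DifferentiableOn ℝ g s) : ∀ x ∈ s, deriv (f + g) x = deriv f x + deriv g x :=
  fun _ hx => deriv_add (hf.differentiableAt (hs.mem_nhds hx)) (hg.differentiableAt (hs.mem_nhds hx))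

theorem deriv_smul_on (c : ℝ) : ∀ x ∈ s, deriv (c • f) x = c * deriv f x := fun _ _ => by
  simp [deriv_const_smul_field]

theorem deriv2_add_on (hs : IsOpen s) (hf : ContDiffOn ℝ 2 f s) (hg : ContDiffOn ℝ 2 g s) :
    ∀ x ∈ s, deriv (deriv (f + g)) x = deriv (deriv f) x + deriv (deriv g) x := fun x hx => by
  have h1 : deriv (f + g) =ᶠ[nhds x] deriv f + deriv g := by
    filter_upwards [hs.mem_nhds hx] with y hy
    exact deriv_add_on hs (hf.differentiableOn (by norm_num)) (hg.differentiableOn (by norm_num)) y hy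
  have hd : ∀ {k : ℝ → ℝ}, ContDiffOn ℝ 2 k s → DifferentiableOn ℝ (deriv k) s := fun hk =>
    (((contDiffOn_succ_iff_deriv_of_isOpen (n := 1) hs).1
      (by simpa [one_add_one_eq_two] using hk)).2.2).differentiableOn (by norm_num)
  rw [h1.deriv_eq]
  exact deriv_add_on hs (hd hf) (hd hg) x hx

theorem deriv2_smul_on (c : ℝ) :
    ∀ x ∈ s, deriv (deriv (c • f)) x = c * deriv (deriv f) x := fun x _ => by
  have : deriv (c • f) = c • deriv f := by ext y; simp [deriv_const_smul_field]
  rw [this]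
  simp [deriv_const_smul_field]

end WeightedSup

/-! ### The spaces `M₁(ε)`, `M₂(ε)`, `X(ε)` and `X₁(ε)`

All functions in `M₁` and `M₂` vanish at `x = 1` (and those in `M₁` also at `x = -1`), so they are
represented by functions on `ℝ` that vanish off `(-1, 1)`. Only their values on `[-1, 1]`,
respectively `(-1, 1]`, matter; regularity is required there, one-sided at the end points. -/

/-- The vector space underlying `M₁(ε)`. -/
noncomputable def M1Sub (ε : ℝ) : Submodule ℝ (ℝ → ℝ) where
  carrier := {f | (∀ x ∉ Ioo (-1 : ℝ) 1, f x = 0) ∧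
    ContinuousOn f (Icc (-1) 1) ∧ ContDiffOn ℝ 1 f (Ioc (-1) 1) ∧ ContDiffOn ℝ 2 f (Ioo 0 1) ∧
    WBdd (Ioo (-1) 1) (fun x => (1 + x) ^ (-1 + 2 * ε)) f ∧
    WBdd (Ioo (-1) 1) (fun x => (1 + x) ^ (2 * ε)) (deriv f) ∧
    WBdd (Ioo 0 1) (fun _ => 1) (deriv (deriv f))}
  zero_mem' := ⟨fun _ _ => rfl, continuousOn_const, contDiffOn_const, contDiffOn_const,
    wbdd_zero fun _ _ => rfl, wbdd_zero fun _ _ => by simp, wbdd_zero fun _ _ => by simp⟩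
  add_mem' := by
    rintro f g ⟨f0, f1, f2, f3, f4, f5, f6⟩ ⟨g0, g1, g2, g3, g4, g5, g6⟩
    refine ⟨fun x hx => by simp [f0 x hx, g0 x hx], f1.add g1, f2.add g2, f3.add g3,
      f4.add g4 fun _ _ => rfl, f5.add g5 (deriv_add_on isOpen_Ioo ?_ ?_),
      f6.add g6 (deriv2_add_on isOpen_Ioo f3 g3)⟩
    · exact (f2.differentiableOn (by norm_num)).mono Ioo_subset_Ioc_self
    · exact (g2.differentiableOn (by norm_num)).mono Ioo_subset_Ioc_self
  smul_mem' := by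
    rintro c f ⟨f0, f1, f2, f3, f4, f5, f6⟩
    exact ⟨fun x hx => by simp [f0 x hx], f1.const_smul c, f2.const_smul c, f3.const_smul c,
      f4.smul c fun _ _ => rfl, f5.smul c (deriv_smul_on c), f6.smul c (deriv2_smul_on c)⟩

/-- The vector space underlying `M₂(ε)`. -/
noncomputable def M2Sub (ε : ℝ) : Submodule ℝ (ℝ → ℝ) where
  carrier := {f | (∀ x ∉ Ioo (-1 : ℝ) 1, f x = 0) ∧
    ContDiffOn ℝ 1 f (Ioc (-1) 1) ∧ ContDiffOn ℝ 2 f (Ioo (-1) 1) ∧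
    WBdd (Ioo (-1) 1) (fun x => (1 + x) ^ ε) f ∧
    WBdd (Ioo (-1) 1) (fun x => (1 + x) ^ (1 + ε)) (deriv f) ∧
    WBdd (Ioo (-1) 1) (fun x => (1 + x) ^ (2 + ε)) (deriv (deriv f))}
  zero_mem' := ⟨fun _ _ => rfl, contDiffOn_const, contDiffOn_const,
    wbdd_zero fun _ _ => rfl, wbdd_zero fun _ _ => by simp, wbdd_zero fun _ _ => by simp⟩
  add_mem' := by
    rintro f g ⟨f0, f2, f3, f4, f5, f6⟩ ⟨g0, g2, g3, g4, g5, g6⟩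
    refine ⟨fun x hx => by simp [f0 x hx, g0 x hx], f2.add g2, f3.add g3,
      f4.add g4 fun _ _ => rfl, f5.add g5 (deriv_add_on isOpen_Ioo ?_ ?_),
      f6.add g6 (deriv2_add_on isOpen_Ioo f3 g3)⟩
    · exact f3.differentiableOn (by norm_num)
    · exact g3.differentiableOn (by norm_num)
  smul_mem' := by
    rintro c f ⟨f0, f2, f3, f4, f5, f6⟩
    exact ⟨fun x hx => by simp [f0 x hx], f2.const_smul c, f3.const_smul c,
      f4.smul c fun _ _ => rfl, f5.smul c (deriv_smul_on c), f6.smul c (deriv2_smul_on c)⟩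

/-- The space `M₁(ε)`. It is a type of its own, so that its topology is the one of the norm below
and not that of pointwise convergence. -/
def M1 (ε : ℝ) : Type := ↥(M1Sub ε)

/-- The space `M₂(ε)`. -/
def M2 (ε : ℝ) : Type := ↥(M2Sub ε)

section Instances

variable {ε : ℝ}

noncomputable instance : AddCommGroup (M1 ε) := inferInstanceAs (AddCommGroup (M1Sub ε))

noncomputable instance : Module ℝ (M1 ε) := inferInstanceAs (Module ℝ (M1Sub ε))

noncomputable instance : AddCommGroup (M2 ε) := inferInstanceAs (AddCommGroup (M2Sub ε))

noncomputable instance : Module ℝ (M2 ε) := inferInstanceAs (Module ℝ (M2Sub ε))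

instance : CoeFun (M1 ε) (fun _ => ℝ → ℝ) := ⟨fun f => f.1⟩

instance : CoeFun (M2 ε) (fun _ => ℝ → ℝ) := ⟨fun f => f.1⟩

/-- `‖f‖_{M₁} = ‖(1+x)^{-1+2ε} f‖_{L^∞(-1,1)} + ‖(1+x)^{2ε} f'‖_{L^∞(-1,1)} + ‖f''‖_{L^∞(0,1)}`. -/
noncomputable def normM1 (ε : ℝ) (f : ℝ → ℝ) : ℝ :=
  wSup (Ioo (-1) 1) (fun x => (1 + x) ^ (-1 + 2 * ε)) f +
  wSup (Ioo (-1) 1) (fun x => (1 + x) ^ (2 * ε)) (deriv f) +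
  wSup (Ioo 0 1) (fun _ => 1) (deriv (deriv f))

/-- `‖f‖_{M₂} = ‖(1+x)^ε f‖ + ‖(1+x)^{1+ε} f'‖ + ‖(1+x)^{2+ε} f''‖`, all in `L^∞(-1,1)`. -/
noncomputable def normM2 (ε : ℝ) (f : ℝ → ℝ) : ℝ :=
  wSup (Ioo (-1) 1) (fun x => (1 + x) ^ ε) f +
  wSup (Ioo (-1) 1) (fun x => (1 + x) ^ (1 + ε)) (deriv f) +
  wSup (Ioo (-1) 1) (fun x => (1 + x) ^ (2 + ε)) (deriv (deriv f))

theorem weight_pos (a : ℝ) : ∀ x ∈ Ioo (-1 : ℝ) 1, 0 < (1 + x) ^ a := fun x hx =>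
  Real.rpow_pos_of_pos (by linarith [hx.1]) a

theorem normM1_smul_le (c : ℝ) (f : M1 ε) : normM1 ε (c • f.1) ≤ |c| * normM1 ε f.1 := by
  obtain ⟨f, f0, f1, f2, f3, f4, f5, f6⟩ := f
  have h4 := wSup_smul c f4 (h := c • f) fun _ _ => rfl
  have h5 := wSup_smul c f5 (h := deriv (c • f)) (deriv_smul_on c)
  have h6 := wSup_smul c f6 (h := deriv (deriv (c • f))) (deriv2_smul_on c)
  simp only [normM1]
  linarith

theorem normM2_smul_le (c : ℝ) (f : M2 ε) : normM2 ε (c • f.1) ≤ |c| * normM2 ε f.1 := by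
  obtain ⟨f, f0, f2, f3, f4, f5, f6⟩ := f
  have h4 := wSup_smul c f4 (h := c • f) fun _ _ => rfl
  have h5 := wSup_smul c f5 (h := deriv (c • f)) (deriv_smul_on c)
  have h6 := wSup_smul c f6 (h := deriv (deriv (c • f))) (deriv2_smul_on c)
  simp only [normM2]
  linarith

noncomputable instance : NormedAddCommGroup (M1 ε) := AddGroupNorm.toNormedAddCommGroup
  { toFun := fun f => normM1 ε f.1
    map_zero' := by
      change normM1 ε (0 : ℝ → ℝ) = 0
      have d : deriv (0 : ℝ → ℝ) = 0 := by ext; simp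
      have z : ∀ (s : Set ℝ) (w : ℝ → ℝ), wSup s w 0 = 0 := fun _ _ => wSup_zero fun _ _ => rfl
      simp only [normM1, d, z, add_zero]
    add_le' := by
      rintro ⟨f, f0, f1, f2, f3, f4, f5, f6⟩ ⟨g, g0, g1, g2, g3, g4, g5, g6⟩
      change normM1 ε (f + g) ≤ normM1 ε f + normM1 ε g
      have h4 := wSup_add f4 g4 (h := f + g) fun _ _ => rfl
      have h5 := wSup_add f5 g5 (h := deriv (f + g)) (deriv_add_on isOpen_Ioo
        ((f2.differentiableOn (by norm_num)).mono Ioo_subset_Ioc_self)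
        ((g2.differentiableOn (by norm_num)).mono Ioo_subset_Ioc_self))
      have h6 := wSup_add f6 g6 (h := deriv (deriv (f + g))) (deriv2_add_on isOpen_Ioo f3 g3)
      simp only [normM1]
      linarith
    neg' := fun f => by
      have h1 := normM1_smul_le (-1) f
      have h2 := normM1_smul_le (-1) (-f)
      have e1 : (-1 : ℝ) • f.1 = (-f).1 := by rw [neg_one_smul]; rfl
      have e2 : (-1 : ℝ) • (-f).1 = f.1 := by rw [← e1, smul_smul]; simp
      rw [e1] at h1
      rw [e2] at h2
      simp only [abs_neg, abs_one, one_mul] at h1 h2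
      exact le_antisymm h1 h2
    eq_zero_of_map_eq_zero' := by
      rintro ⟨f, f0, f1, f2, f3, f4, f5, f6⟩ h
      have h' : normM1 ε f = 0 := h
      have h1 : wSup (Ioo (-1) 1) (fun x => (1 + x) ^ (-1 + 2 * ε)) f ≤ 0 := by
        have h5 : 0 ≤ wSup (Ioo (-1) 1) (fun x => (1 + x) ^ (2 * ε)) (deriv f) := wSup_nonneg
        have h6 : 0 ≤ wSup (Ioo 0 1) (fun _ => 1) (deriv (deriv f)) := wSup_nonneg
        simp only [normM1] at h'
        linarith
      apply Subtype.ext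
      funext x
      by_cases hx : x ∈ Ioo (-1 : ℝ) 1
      · exact eq_zero_of_wSup f4 (weight_pos _) h1 x hx
      · exact f0 x hx }

noncomputable instance : NormedAddCommGroup (M2 ε) := AddGroupNorm.toNormedAddCommGroup
  { toFun := fun f => normM2 ε f.1
    map_zero' := by
      change normM2 ε (0 : ℝ → ℝ) = 0
      have d : deriv (0 : ℝ → ℝ) = 0 := by ext; simp
      have z : ∀ (s : Set ℝ) (w : ℝ → ℝ), wSup s w 0 = 0 := fun _ _ => wSup_zero fun _ _ => rfl
      simp only [normM2, d, z, add_zero]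
    add_le' := by
      rintro ⟨f, f0, f2, f3, f4, f5, f6⟩ ⟨g, g0, g2, g3, g4, g5, g6⟩
      change normM2 ε (f + g) ≤ normM2 ε f + normM2 ε g
      have h4 := wSup_add f4 g4 (h := f + g) fun _ _ => rfl
      have h5 := wSup_add f5 g5 (h := deriv (f + g)) (deriv_add_on isOpen_Ioo
        (f3.differentiableOn (by norm_num)) (g3.differentiableOn (by norm_num)))
      have h6 := wSup_add f6 g6 (h := deriv (deriv (f + g))) (deriv2_add_on isOpen_Ioo f3 g3)
      simp only [normM2]
      linarith
    neg' := fun f => by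
      have h1 := normM2_smul_le (-1) f
      have h2 := normM2_smul_le (-1) (-f)
      have e1 : (-1 : ℝ) • f.1 = (-f).1 := by rw [neg_one_smul]; rfl
      have e2 : (-1 : ℝ) • (-f).1 = f.1 := by rw [← e1, smul_smul]; simp
      rw [e1] at h1
      rw [e2] at h2
      simp only [abs_neg, abs_one, one_mul] at h1 h2
      exact le_antisymm h1 h2
    eq_zero_of_map_eq_zero' := by
      rintro ⟨f, f0, f2, f3, f4, f5, f6⟩ h
      have h' : normM2 ε f = 0 := h
      have h1 : wSup (Ioo (-1) 1) (fun x => (1 + x) ^ ε) f ≤ 0 := by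
        have h5 : 0 ≤ wSup (Ioo (-1) 1) (fun x => (1 + x) ^ (1 + ε)) (deriv f) := wSup_nonneg
        have h6 : 0 ≤ wSup (Ioo (-1) 1) (fun x => (1 + x) ^ (2 + ε)) (deriv (deriv f)) :=
          wSup_nonneg
        simp only [normM2] at h'
        linarith
      apply Subtype.ext
      funext x
      by_cases hx : x ∈ Ioo (-1 : ℝ) 1
      · exact eq_zero_of_wSup f4 (weight_pos _) h1 x hx
      · exact f0 x hx }

noncomputable instance : NormedSpace ℝ (M1 ε) where
  norm_smul_le c f := normM1_smul_le c f

noncomputable instance : NormedSpace ℝ (M2 ε) where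
  norm_smul_le c f := normM2_smul_le c f

end Instances

/-- `X(ε) = M₁(ε) × M₂(ε)` with the norm `‖U‖_X = ‖U_θ‖_{M₁} + ‖U_φ‖_{M₂}`; the components
`U_θ` and `U_φ` are `U.fst` and `U.snd`. -/
abbrev X (ε : ℝ) : Type := WithLp 1 (M1 ε × M2 ε)

theorem norm_X (ε : ℝ) (U : X ε) : ‖U‖ = normM1 ε U.fst + normM2 ε U.snd := by
  have h : ‖U‖ = ‖U.fst‖ + ‖U.snd‖ := by simpa using WithLp.prod_norm_eq_of_nat 1 (by norm_num) U
  exact h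

/-- The linear functional `l₂(V) = V_φ(0)`. -/
noncomputable def l2 (ε : ℝ) : X ε →ₗ[ℝ] ℝ where
  toFun V := V.snd 0
  map_add' _ _ := rfl
  map_smul' _ _ := rfl

/-- `X₁(ε) = ker l₂`. -/
noncomputable abbrev X1 (ε : ℝ) : Submodule ℝ (X ε) := LinearMap.ker (l2 ε)

/-! ### The equations -/

/-- The integrand `2 U_φ U_φ' / (1 - s²)`. -/
noncomputable def swirlDensity (Uφ : ℝ → ℝ) (s : ℝ) : ℝ := 2 * Uφ s * deriv Uφ s / (1 - s ^ 2)

/-- `∫_l^1 ∫_t^1 2 U_φ U_φ' / (1 - s²) ds dt`. -/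
noncomputable def psiInner (Uφ : ℝ → ℝ) (l : ℝ) : ℝ :=
  ∫ t in l..1, ∫ s in t..1, swirlDensity Uφ s

/-- `ψ[U_φ](x) = ∫_x^1 ∫_l^1 ∫_t^1 2 U_φ U_φ' / (1 - s²) ds dt dl`. -/
noncomputable def psi (Uφ : ℝ → ℝ) (x : ℝ) : ℝ := ∫ l in x..1, psiInner Uφ l

/-- `U = (U_θ, U_φ)` solves on `(-1, 1)`, with the constant `κ`, the system
`(1-x²) U_θ' + 2x U_θ + U_θ²/2 - ψ[U_φ] = κ (1-x)²`, `(1-x²) U_φ'' + U_θ U_φ' = 0`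
satisfied by axisymmetric `(-1)`-homogeneous Navier-Stokes solutions that are smooth on the
sphere minus the south pole. -/
structure IsSolution (Uθ Uφ : ℝ → ℝ) (κ : ℝ) : Prop where
  contDiffOn_theta : ContDiffOn ℝ 1 Uθ (Ioo (-1) 1)
  contDiffOn_phi : ContDiffOn ℝ 2 Uφ (Ioo (-1) 1)
  integrable : ∀ t ∈ Ioo (-1 : ℝ) 1, IntervalIntegrable (swirlDensity Uφ) volume t 1
  eq_theta : ∀ x ∈ Ioo (-1 : ℝ) 1,
    (1 - x ^ 2) * deriv Uθ x + 2 * x * Uθ x + 1 / 2 * Uθ x ^ 2 - psi Uφ x = κ * (1 - x) ^ 2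
  eq_phi : ∀ x ∈ Ioo (-1 : ℝ) 1,
    (1 - x ^ 2) * deriv (deriv Uφ) x + Uθ x * deriv Uφ x = 0

/-- The `θ`-component of the no-swirl solution `U^{μ,γ}`, `γ = -1 - √(1+2μ)`;
its `φ`-component is zero. -/
noncomputable def Ubar (μ x : ℝ) : ℝ := (1 + √(1 + 2 * μ)) * (1 - x)

/-- `b_μ(x) = ∫_0^x Ū_θ / (1 - s²) ds`. -/
noncomputable def bFun (μ x : ℝ) : ℝ := ∫ s in (0 : ℝ)..x, Ubar μ s / (1 - s ^ 2)

/-- The `φ`-component `∫_x^1 e^{-b_μ(t)} dt` of the kernel element `V²_{μ,γ}`,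
`γ = -1 - √(1+2μ)`; its `θ`-component is zero. -/
noncomputable def V2phi (μ x : ℝ) : ℝ := ∫ t in x..1, Real.exp (-bFun μ t)

/-- The `θ`-component of `U^{μ,γ} + β V²_{μ,γ} + V`. -/
noncomputable def familyTheta {ε : ℝ} (μ : ℝ) (V : X ε) (x : ℝ) : ℝ := Ubar μ x + V.fst x

/-- The `φ`-component of `U^{μ,γ} + β V²_{μ,γ} + V`. -/
noncomputable def familyPhi {ε : ℝ} (μ β : ℝ) (V : X ε) (x : ℝ) : ℝ := β * V2phi μ x + V.snd x

end ConicalNS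

open ConicalNS

namespace ConicalNS

open Filter Topology

/-!
Write `U = Ū^μ + (w, u)` with `w = (1 - x) y`, and `a = √(1 + 2μ)`. Dividing the first equation of
`(∗)` by `(1 - x)²` and differentiating removes the unknown constant `μ̂`; with `z = y'` and
`h = u'` the system becomes

  `(1 + x) z' + (1 + a) z = (ψ[u] / (1 - x)²)' - y z`,  `(1 + x) h' + (1 + a) h = -y h`.

The nonlinear terms are quadratic, and the linear part is an Euler operator, inverted by an explicit
integral operator: with the weights of `M₁` the solution is unique, and with those of `M₂` it is
unique once `u(0) = 0` is imposed, the kernel being spanned by `(1 + x)^(-1 - a)`, the derivative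
of `-V²`. In terms of the weighted representatives of `z` and `h` this is an analytic equation in
the Banach algebra of bounded continuous functions on `(-1, 1)`, and the implicit function theorem
gives the solution and its uniqueness near each `μ ∈ K`; by uniqueness and compactness of `K` these
local solutions glue to a single map.
-/

/-! ### Calculus on an open interval -/

section Interval

variable {a b : ℝ} {φ χ : ℝ → ℝ}

theorem intervalIntegrable_of_abs_le (hab : a ≤ b) (hφ : ContinuousOn φ (Ioo a b))
    (hχ : IntervalIntegrable χ volume a b) (hle : ∀ x ∈ Ioo a b, |φ x| ≤ χ x) :
    IntervalIntegrable φ volume a b := by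
  rw [intervalIntegrable_iff_integrableOn_Ioo_of_le hab] at hχ ⊢
  exact hχ.mono' (hφ.aestronglyMeasurable measurableSet_Ioo)
    (ae_restrict_of_forall_mem measurableSet_Ioo hle)

theorem abs_intervalIntegral_le (hab : a ≤ b) (hχ : IntervalIntegrable χ volume a b)
    (hle : ∀ x ∈ Ioo a b, |φ x| ≤ χ x) : |∫ s in a..b, φ s| ≤ ∫ s in a..b, χ s := by
  rw [← Real.norm_eq_abs]
  refine intervalIntegral.norm_integral_le_of_norm_le hab ?_ hχ
  filter_upwards [compl_mem_ae_iff.2 (measure_singleton b)] with s hs hsx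
  exact hle s ⟨hsx.1, lt_of_le_of_ne hsx.2 hs⟩

theorem eqOn_Ioc_of_hasDerivAt {f g d : ℝ → ℝ} (hf : ContinuousOn f (Ioc a b))
    (hg : ContinuousOn g (Ioc a b)) (hfd : ∀ x ∈ Ioo a b, HasDerivAt f (d x) x)
    (hgd : ∀ x ∈ Ioo a b, HasDerivAt g (d x) x) (hb : f b = g b) : EqOn f g (Ioc a b) := by
  intro x hx
  have hsub : Icc x b ⊆ Ioc a b := Icc_subset_Ioc hx.1 le_rfl
  have hconst := constant_of_has_deriv_right_zero (f := f - g) ((hf.sub hg).mono hsub)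
    (fun s hs => by
      have hs' : s ∈ Ioo a b := ⟨hx.1.trans_le hs.1, hs.2⟩
      simpa using ((hfd s hs').sub (hgd s hs')).hasDerivWithinAt) b ⟨hx.2, le_rfl⟩
  simp only [Pi.sub_apply, hb, sub_self] at hconst
  exact sub_eq_zero.1 hconst.symm

/-- One-sided differentiability at `b` comes from the limit of the derivative. -/
theorem hasDerivWithinAt_Ioc {f d : ℝ → ℝ} (hf : ContinuousOn f (Ioc a b))
    (hfd : ∀ x ∈ Ioo a b, HasDerivAt f (d x) x) (hd : ContinuousOn d (Ioc a b)) {x : ℝ}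
    (hx : x ∈ Ioc a b) : HasDerivWithinAt f (d x) (Ioc a b) x := by
  rcases hx.2.lt_or_eq with hxb | rfl
  · exact (hfd x ⟨hx.1, hxb⟩).hasDerivWithinAt
  have hlim : Tendsto (deriv f) (𝓝[<] x) (𝓝 (d x)) := by
    refine ((hd x hx).mono_of_mem_nhdsWithin (Ioc_mem_nhdsLT hx.1)).tendsto.congr' ?_
    filter_upwards [Ioo_mem_nhdsLT hx.1] with y hy
    exact (hfd y hy).deriv.symm
  exact (hasDerivWithinAt_Iic_of_tendsto_deriv (s := Ioo a x)
    (fun y hy => (hfd y hy).differentiableAt.differentiableWithinAt)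
    ((hf x hx).mono Ioo_subset_Ioc_self) (Ioo_mem_nhdsLT hx.1) hlim).mono fun y hy => hy.2

theorem contDiffOn_one_Ioc {f d : ℝ → ℝ} (hf : ContinuousOn f (Ioc a b))
    (hfd : ∀ x ∈ Ioo a b, HasDerivAt f (d x) x) (hd : ContinuousOn d (Ioc a b)) :
    ContDiffOn ℝ 1 f (Ioc a b) := by
  have hun : UniqueDiffOn ℝ (Ioc a b) := uniqueDiffOn_Ioc _ _
  refine (contDiffOn_one_iff_derivWithin hun).2
    ⟨fun x hx => (hasDerivWithinAt_Ioc hf hfd hd hx).differentiableWithinAt,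
      hd.congr fun x hx => ?_⟩
  exact (hasDerivWithinAt_Ioc hf hfd hd hx).derivWithin (hun x hx)

theorem contDiffOn_two_of_hasDerivAt {s : Set ℝ} (hs : IsOpen s) {f d d' : ℝ → ℝ}
    (hf : ∀ x ∈ s, HasDerivAt f (d x) x) (hd : ∀ x ∈ s, HasDerivAt d (d' x) x)
    (hd' : ContinuousOn d' s) : ContDiffOn ℝ 2 f s := by
  have hd1 : ContDiffOn ℝ 1 d s := (contDiffOn_one_iff_derivWithin hs.uniqueDiffOn).2
    ⟨fun x hx => (hd x hx).differentiableAt.differentiableWithinAt,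
      hd'.congr fun x hx => (derivWithin_of_isOpen hs hx).trans (hd x hx).deriv⟩
  rw [← one_add_one_eq_two, contDiffOn_succ_iff_deriv_of_isOpen hs]
  exact ⟨fun x hx => (hf x hx).differentiableAt.differentiableWithinAt, by simp,
    hd1.congr fun x hx => (hf x hx).deriv⟩

end Interval

/-! ### Primitives on `(-1, 1)` -/

/-- The interval `(-1, 1)` on which the equations live. -/
abbrev Dom : Set ℝ := Ioo (-1) 1

section Dom

variable {x : ℝ}

theorem Dom.one_add_pos (hx : x ∈ Dom) : 0 < 1 + x := by linarith [hx.1]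

theorem Dom.one_sub_pos (hx : x ∈ Dom) : 0 < 1 - x := by linarith [hx.2]

theorem Dom.mem_nhds (hx : x ∈ Dom) : Dom ∈ 𝓝 x := isOpen_Ioo.mem_nhds hx

theorem Dom.zero_mem : (0 : ℝ) ∈ Dom := ⟨by norm_num, by norm_num⟩

theorem Dom.Ioo_subset (hx : x ∈ Dom) : Ioo x 1 ⊆ Dom := Ioo_subset_Ioo_left hx.1.le

theorem Dom.stronglyMeasurableAtFilter {φ : ℝ → ℝ} (h : ContinuousOn φ Dom) (hx : x ∈ Dom) :
    StronglyMeasurableAtFilter φ (𝓝 x) volume :=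
  ⟨Dom, Dom.mem_nhds hx, h.aestronglyMeasurable measurableSet_Ioo⟩

end Dom

/-- The primitive `x ↦ ∫_x^1 φ`. -/
noncomputable def tailInt (φ : ℝ → ℝ) (x : ℝ) : ℝ := ∫ s in x..1, φ s

/-- The functions whose primitive `tailInt` is meaningful: continuous on `(-1, 1)` and integrable
up to `1`. -/
structure TailIntegrable (φ : ℝ → ℝ) : Prop where
  continuousOn : ContinuousOn φ Dom
  intervalIntegrable : ∀ t ∈ Dom, IntervalIntegrable φ volume t 1

section Tail

variable {φ χ : ℝ → ℝ}

@[simp] theorem tailInt_one (φ : ℝ → ℝ) : tailInt φ 1 = 0 := intervalIntegral.integral_same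

theorem tailInt_congr (h : EqOn φ χ Dom) {x : ℝ} (hx : x ∈ Icc (-1 : ℝ) 1) :
    tailInt φ x = tailInt χ x :=
  intervalIntegral.integral_congr_Ioo_of_le hx.2 (h.mono (Ioo_subset_Ioo_left hx.1))

theorem tailInt_const_mul (c : ℝ) (φ : ℝ → ℝ) (x : ℝ) :
    tailInt (fun s => c * φ s) x = c * tailInt φ x :=
  intervalIntegral.integral_const_mul c φ

namespace TailIntegrable

theorem of_continuousOn_Ioc (h : ContinuousOn φ (Ioc (-1) 1)) : TailIntegrable φ where
  continuousOn := h.mono Ioo_subset_Ioc_self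
  intervalIntegrable t ht := by
    refine ContinuousOn.intervalIntegrable (h.mono ?_)
    rw [uIcc_of_le ht.2.le]
    exact Icc_subset_Ioc ht.1 le_rfl

theorem congr (h : TailIntegrable φ) (he : EqOn χ φ Dom) : TailIntegrable χ where
  continuousOn := h.continuousOn.congr he
  intervalIntegrable t ht := (h.intervalIntegrable t ht).congr_uIoo <| by
    rw [uIoo_of_le ht.2.le]
    exact (he.mono (Dom.Ioo_subset ht)).symm

theorem const_mul (h : TailIntegrable φ) (c : ℝ) : TailIntegrable (fun x => c * φ x) :=
  ⟨continuousOn_const.mul h.continuousOn, fun t ht => (h.intervalIntegrable t ht).const_mul c⟩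

theorem mul_of_bdd {k : ℝ → ℝ} {C : ℝ} (h : TailIntegrable φ) (hk : ContinuousOn k Dom)
    (hC : ∀ x ∈ Dom, |k x| ≤ C) : TailIntegrable (fun x => k x * φ x) where
  continuousOn := hk.mul h.continuousOn
  intervalIntegrable t ht := by
    have hsub := Dom.Ioo_subset ht
    refine intervalIntegrable_of_abs_le ht.2.le ((hk.mul h.continuousOn).mono hsub)
      ((h.intervalIntegrable t ht).abs.const_mul C) fun x hx => ?_
    rw [abs_mul]
    exact mul_le_mul_of_nonneg_right (hC x (hsub hx)) (abs_nonneg _)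

theorem tailInt_add (hφ : TailIntegrable φ) (hχ : TailIntegrable χ) {x : ℝ} (hx : x ∈ Dom) :
    tailInt (fun s => φ s + χ s) x = tailInt φ x + tailInt χ x :=
  intervalIntegral.integral_add (hφ.intervalIntegrable x hx) (hχ.intervalIntegrable x hx)

theorem hasDerivAt_tailInt (h : TailIntegrable φ) {x : ℝ} (hx : x ∈ Dom) :
    HasDerivAt (tailInt φ) (-φ x) x :=
  intervalIntegral.integral_hasDerivAt_left (h.intervalIntegrable x hx)
    (Dom.stronglyMeasurableAtFilter h.continuousOn hx)
    (h.continuousOn.continuousAt (Dom.mem_nhds hx))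

theorem continuousOn_tailInt (h : TailIntegrable φ) : ContinuousOn (tailInt φ) (Ioc (-1) 1) := by
  intro x hx
  obtain ⟨t, ht, htx⟩ := exists_between hx.1
  have ht1 : t < 1 := htx.trans_le hx.2
  have hprim := intervalIntegral.continuousOn_primitive_interval_left (f := φ) (a := t) (b := 1)
    (by rw [uIcc_of_le ht1.le]
        exact (intervalIntegrable_iff_integrableOn_Icc_of_le ht1.le).1
          (h.intervalIntegrable t ⟨ht, ht1⟩))
  rw [uIcc_of_le ht1.le] at hprim
  refine (hprim x ⟨htx.le, hx.2⟩).mono_of_mem_nhdsWithin ?_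
  filter_upwards [mem_nhdsWithin_of_mem_nhds (Ioi_mem_nhds htx), self_mem_nhdsWithin]
    with y hy hy'
  exact ⟨le_of_lt hy, hy'.2⟩

theorem tail (h : TailIntegrable φ) : TailIntegrable (tailInt φ) :=
  .of_continuousOn_Ioc h.continuousOn_tailInt

theorem eqOn_tailInt {f : ℝ → ℝ} (h : TailIntegrable φ) (hf : ContinuousOn f (Ioc (-1) 1))
    (hfd : ∀ x ∈ Dom, HasDerivAt f (-φ x) x) (h1 : f 1 = 0) : EqOn f (tailInt φ) (Ioc (-1) 1) :=
  eqOn_Ioc_of_hasDerivAt hf h.continuousOn_tailInt hfd (fun _ hx => h.hasDerivAt_tailInt hx)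
    (by simp [h1])

end TailIntegrable

end Tail

/-- The primitive `x ↦ ∫_{-1}^x φ`. -/
noncomputable def headInt (φ : ℝ → ℝ) (x : ℝ) : ℝ := ∫ s in (-1)..x, φ s

section Head

variable {φ : ℝ → ℝ}

@[simp] theorem headInt_neg_one : headInt φ (-1) = 0 := intervalIntegral.integral_same

theorem headInt_const_mul (c : ℝ) (φ : ℝ → ℝ) (x : ℝ) :
    headInt (fun s => c * φ s) x = c * headInt φ x :=
  intervalIntegral.integral_const_mul c φ

theorem intervalIntegrable_neg_one_left (h : IntervalIntegrable φ volume (-1) 1) {x : ℝ}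
    (hx : x ∈ Dom) : IntervalIntegrable φ volume (-1) x :=
  h.mono_set <| by
    rw [uIcc_of_le hx.1.le, uIcc_of_le (by norm_num)]
    exact Icc_subset_Icc_right hx.2.le

theorem headInt_add {χ : ℝ → ℝ} (hφ : IntervalIntegrable φ volume (-1) 1)
    (hχ : IntervalIntegrable χ volume (-1) 1) {x : ℝ} (hx : x ∈ Dom) :
    headInt (fun s => φ s + χ s) x = headInt φ x + headInt χ x :=
  intervalIntegral.integral_add (intervalIntegrable_neg_one_left hφ hx)
    (intervalIntegrable_neg_one_left hχ hx)

theorem hasDerivAt_headInt (hφ : ContinuousOn φ Dom) (h : IntervalIntegrable φ volume (-1) 1)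
    {x : ℝ} (hx : x ∈ Dom) : HasDerivAt (headInt φ) (φ x) x :=
  intervalIntegral.integral_hasDerivAt_right (intervalIntegrable_neg_one_left h hx)
    (Dom.stronglyMeasurableAtFilter hφ hx) (hφ.continuousAt (Dom.mem_nhds hx))

theorem continuousOn_headInt (h : IntervalIntegrable φ volume (-1) 1) :
    ContinuousOn (headInt φ) (Icc (-1) 1) := by
  have := intervalIntegral.continuousOn_primitive_interval' h left_mem_uIcc
  rwa [uIcc_of_le (by norm_num)] at this

theorem tendsto_headInt (h : IntervalIntegrable φ volume (-1) 1) :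
    Tendsto (headInt φ) (𝓝[>] (-1)) (𝓝 0) := by
  have := (continuousOn_headInt h (-1) ⟨le_rfl, by norm_num⟩).mono Ioc_subset_Icc_self
  rwa [ContinuousWithinAt, headInt_neg_one, nhdsWithin_Ioc_eq_nhdsGT (by norm_num)] at this

theorem eqOn_headInt {f : ℝ → ℝ} (hf : Tendsto f (𝓝[>] (-1)) (𝓝 0))
    (hfd : ∀ x ∈ Dom, HasDerivAt f (φ x) x) (hφ : ContinuousOn φ Dom)
    (h : IntervalIntegrable φ volume (-1) 1) : EqOn f (headInt φ) Dom := by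
  have hhd : ∀ x ∈ Dom, HasDerivAt (headInt φ) (φ x) x := fun _ => hasDerivAt_headInt hφ h
  obtain ⟨c, hc⟩ := isOpen_Ioo.exists_eq_add_of_deriv_eq isPreconnected_Ioo
    (fun x hx => (hfd x hx).differentiableAt.differentiableWithinAt)
    (fun x hx => (hhd x hx).differentiableAt.differentiableWithinAt)
    fun x hx => (hfd x hx).deriv.trans (hhd x hx).deriv.symm
  have hlim : Tendsto f (𝓝[>] (-1)) (𝓝 (0 + c)) := by
    refine ((tendsto_headInt h).add_const c).congr' ?_
    filter_upwards [Ioo_mem_nhdsGT (show (-1 : ℝ) < 1 by norm_num)] with x hx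
    exact (hc hx).symm
  have hc0 : c = 0 := by simpa using tendsto_nhds_unique hlim hf
  exact hc.trans fun _ _ => by simp [hc0]

end Head

/-! ### Power weights -/

section Weight

theorem continuousOn_one_add_rpow (p : ℝ) :
    ContinuousOn (fun s : ℝ => (1 + s) ^ p) (Ioc (-1) 1) :=
  (continuousOn_const.add continuousOn_id).rpow_const fun _ hx =>
    .inl (neg_lt_iff_pos_add'.1 hx.1).ne'

theorem hasDerivAt_one_add_rpow (p : ℝ) {x : ℝ} (hx : x ∈ Dom) :
    HasDerivAt (fun s : ℝ => (1 + s) ^ p) (p * (1 + x) ^ (p - 1)) x := by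
  simpa using ((hasDerivAt_id x).const_add 1).rpow_const (p := p) (.inl (Dom.one_add_pos hx).ne')

theorem intervalIntegrable_one_add_rpow {p : ℝ} (hp : -1 < p) (a b : ℝ) :
    IntervalIntegrable (fun s : ℝ => (1 + s) ^ p) volume a b := by
  simpa using
    (intervalIntegral.intervalIntegrable_rpow' hp (a := 1 + a) (b := 1 + b)).comp_add_left 1

theorem headInt_one_add_rpow {p : ℝ} (hp : -1 < p) (x : ℝ) :
    headInt (fun s => (1 + s) ^ p) x = (1 + x) ^ (p + 1) / (p + 1) := by
  have hp1 : p + 1 ≠ 0 := by linarith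
  rw [headInt, intervalIntegral.integral_comp_add_left (fun s : ℝ => s ^ p) 1,
    integral_rpow (.inl hp)]
  simp [Real.zero_rpow hp1]

theorem intervalIntegrable_of_abs_le_rpow {φ : ℝ → ℝ} {C p : ℝ} (hφ : ContinuousOn φ Dom)
    (hp : -1 < p) (hle : ∀ x ∈ Dom, |φ x| ≤ C * (1 + x) ^ p) :
    IntervalIntegrable φ volume (-1) 1 :=
  intervalIntegrable_of_abs_le (by norm_num) hφ
    ((intervalIntegrable_one_add_rpow hp _ _).const_mul C) hle

theorem abs_headInt_le {φ : ℝ → ℝ} {C p : ℝ} (hp : -1 < p)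
    (hle : ∀ x ∈ Dom, |φ x| ≤ C * (1 + x) ^ p) {x : ℝ} (hx : x ∈ Icc (-1 : ℝ) 1) :
    |headInt φ x| ≤ C * ((1 + x) ^ (p + 1) / (p + 1)) := by
  rw [← headInt_one_add_rpow hp]
  exact (abs_intervalIntegral_le hx.1
    ((intervalIntegrable_one_add_rpow hp (-1) x).const_mul C)
    fun s hs => hle s (Ioo_subset_Ioo_right hx.2 hs)).trans_eq
      (intervalIntegral.integral_const_mul C _)

theorem TailIntegrable.one_sub_pow_mul_rpow (n : ℕ) (p : ℝ) :
    TailIntegrable (fun s : ℝ => (1 - s) ^ n * (1 + s) ^ p) :=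
  .of_continuousOn_Ioc (((continuousOn_const.sub continuousOn_id).pow n).mul
    (continuousOn_one_add_rpow p))

theorem tailInt_one_add_rpow {q : ℝ} (hq : 0 < q) {x : ℝ} (hx : x ∈ Dom) :
    tailInt (fun s => (1 + s) ^ (-1 - q)) x = ((1 + x) ^ (-q) - 2 ^ (-q)) / q := by
  have hexp : -1 - q + 1 = -q := by ring
  have h0 : (0 : ℝ) ∉ uIcc (1 + x) (1 + 1) := by
    rw [uIcc_of_le (by linarith [hx.2])]
    exact fun h => h.1.not_gt (Dom.one_add_pos hx)
  rw [tailInt, intervalIntegral.integral_comp_add_left (fun s : ℝ => s ^ (-1 - q)) 1,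
    integral_rpow (.inr ⟨by linarith, h0⟩), hexp, one_add_one_eq_two, div_neg, ← neg_div, neg_sub]

theorem tailInt_one_add_rpow_le_of_nonneg {q : ℝ} (hq : 0 < q) {x : ℝ} (h0 : 0 ≤ x)
    (h1 : x < 1) : tailInt (fun s => (1 + s) ^ (-1 - q)) x ≤ (1 - x) * (1 + x) ^ (-q) := by
  have hx : 0 < 1 + x := by linarith
  have hmono : tailInt (fun s => (1 + s) ^ (-1 - q)) x ≤ ∫ _ in x..1, (1 + x) ^ (-q) := by
    refine intervalIntegral.integral_mono_on h1.le ?_ (by simp) fun s hs => ?_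
    · exact (TailIntegrable.of_continuousOn_Ioc (continuousOn_one_add_rpow _)).intervalIntegrable x
        ⟨by linarith, h1⟩
    · calc (1 + s) ^ (-1 - q) ≤ (1 + s) ^ (-q) :=
            Real.rpow_le_rpow_of_exponent_le (by linarith [hs.1]) (by linarith)
        _ ≤ (1 + x) ^ (-q) := Real.rpow_le_rpow_of_nonpos hx (by linarith [hs.1]) (by linarith)
  rwa [intervalIntegral.integral_const, smul_eq_mul] at hmono

theorem tailInt_one_add_rpow_le {q : ℝ} (hq : 0 < q) {x : ℝ} (hx : x ∈ Dom) :
    tailInt (fun s => (1 + s) ^ (-1 - q)) x ≤ (1 + 1 / q) * ((1 - x) * (1 + x) ^ (-q)) := by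
  have hw : 0 < (1 + x) ^ (-q) := Real.rpow_pos_of_pos (Dom.one_add_pos hx) _
  have hx1 := Dom.one_sub_pos hx
  rcases le_total x 0 with h0 | h0
  · have htwo : (0 : ℝ) < 2 ^ (-q) := Real.rpow_pos_of_pos two_pos _
    calc tailInt (fun s => (1 + s) ^ (-1 - q)) x = ((1 + x) ^ (-q) - 2 ^ (-q)) / q :=
          tailInt_one_add_rpow hq hx
      _ ≤ (1 + x) ^ (-q) / q := by gcongr; linarith
      _ = 1 / q * (1 * (1 + x) ^ (-q)) := by ring
      _ ≤ (1 + 1 / q) * ((1 - x) * (1 + x) ^ (-q)) := by gcongr <;> linarith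
  · refine (tailInt_one_add_rpow_le_of_nonneg hq h0 hx.2).trans ?_
    exact le_mul_of_one_le_left (by positivity) (le_add_of_nonneg_right (by positivity))

theorem abs_tailInt_le {φ : ℝ → ℝ} {C q : ℝ} (n : ℕ) (hq : 0 < q) (hC : 0 ≤ C)
    (hle : ∀ x ∈ Dom, |φ x| ≤ C * ((1 - x) ^ n * (1 + x) ^ (-1 - q))) {x : ℝ} (hx : x ∈ Dom) :
    |tailInt φ x| ≤ C * (1 + 1 / q) * ((1 - x) ^ (n + 1) * (1 + x) ^ (-q)) := by
  have hx1 := (Dom.one_sub_pos hx).le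
  have hle' : ∀ s ∈ Ioo x 1, |φ s| ≤ C * (1 - x) ^ n * (1 + s) ^ (-1 - q) := fun s hs => by
    have hs' : s ∈ Dom := Dom.Ioo_subset hx hs
    have hw := Real.rpow_nonneg (Dom.one_add_pos hs').le (-1 - q)
    have hs1 := (Dom.one_sub_pos hs').le
    refine (hle s hs').trans ?_
    rw [← mul_assoc]
    gcongr
    exact hs.1.le
  have hint : IntervalIntegrable (fun s : ℝ => (1 + s) ^ (-1 - q)) volume x 1 :=
    (TailIntegrable.of_continuousOn_Ioc (continuousOn_one_add_rpow _)).intervalIntegrable x hx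
  calc |tailInt φ x| ≤ ∫ s in x..1, C * (1 - x) ^ n * (1 + s) ^ (-1 - q) :=
        abs_intervalIntegral_le hx.2.le (hint.const_mul _) hle'
    _ = C * (1 - x) ^ n * tailInt (fun s => (1 + s) ^ (-1 - q)) x :=
        intervalIntegral.integral_const_mul _ _
    _ ≤ C * (1 - x) ^ n * ((1 + 1 / q) * ((1 - x) * (1 + x) ^ (-q))) := by
        gcongr
        exact tailInt_one_add_rpow_le hq hx
    _ = C * (1 + 1 / q) * ((1 - x) ^ (n + 1) * (1 + x) ^ (-q)) := by ring

theorem exists_eq_const_mul_rpow {f f' : ℝ → ℝ} {b : ℝ} (hf : ∀ x ∈ Dom, HasDerivAt f (f' x) x)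
    (h : ∀ x ∈ Dom, (1 + x) * f' x + b * f x = 0) :
    ∃ c, ∀ x ∈ Dom, f x = c * (1 + x) ^ (-b) := by
  have hd : ∀ x ∈ Dom, HasDerivAt (fun x => (1 + x) ^ b * f x) 0 x := fun x hx => by
    refine ((hasDerivAt_one_add_rpow b hx).mul (hf x hx)).congr_deriv ?_
    have hpow : (1 + x) ^ b = (1 + x) ^ (b - 1) * (1 + x) := by
      rw [← Real.rpow_add_one (Dom.one_add_pos hx).ne', sub_add_cancel]
    rw [hpow]
    linear_combination (1 + x) ^ (b - 1) * h x hx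
  obtain ⟨c, hc⟩ := isOpen_Ioo.exists_is_const_of_deriv_eq_zero isPreconnected_Ioo
    (fun x hx => (hd x hx).differentiableAt.differentiableWithinAt) fun x hx => (hd x hx).deriv
  refine ⟨c, fun x hx => ?_⟩
  rw [← hc x hx, mul_right_comm, ← Real.rpow_add (Dom.one_add_pos hx)]
  simp

end Weight

/-! ### Bounded continuous functions on `(-1, 1)` and weighted integral operators -/

/-- The Banach algebra of bounded continuous functions on `(-1, 1)`. -/
abbrev BddFun : Type := BoundedContinuousFunction Dom ℝ

/-- Extension by zero of a function on `(-1, 1)`, so that it can be integrated over `ℝ`. -/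
noncomputable def zeroExt (f : BddFun) (x : ℝ) : ℝ :=
  open Classical in if h : x ∈ Dom then f ⟨x, h⟩ else 0

section ZeroExt

variable {x : ℝ}

theorem zeroExt_of_mem (f : BddFun) (hx : x ∈ Dom) : zeroExt f x = f ⟨x, hx⟩ := dif_pos hx

theorem zeroExt_of_notMem (f : BddFun) (hx : x ∉ Dom) : zeroExt f x = 0 := dif_neg hx

variable (f g : BddFun) (x : ℝ)

@[simp] theorem zeroExt_add : zeroExt (f + g) x = zeroExt f x + zeroExt g x := by
  unfold zeroExt; split_ifs <;> simp

@[simp] theorem zeroExt_sub : zeroExt (f - g) x = zeroExt f x - zeroExt g x := by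
  unfold zeroExt; split_ifs <;> simp

@[simp] theorem zeroExt_neg : zeroExt (-f) x = -zeroExt f x := by
  unfold zeroExt; split_ifs <;> simp

@[simp] theorem zeroExt_smul (c : ℝ) : zeroExt (c • f) x = c * zeroExt f x := by
  unfold zeroExt; split_ifs <;> simp

@[simp] theorem zeroExt_mul : zeroExt (f * g) x = zeroExt f x * zeroExt g x := by
  unfold zeroExt; split_ifs <;> simp

@[simp] theorem zeroExt_zero : zeroExt 0 x = 0 := by
  unfold zeroExt; split_ifs <;> simp

theorem abs_zeroExt_le : |zeroExt f x| ≤ ‖f‖ := by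
  unfold zeroExt
  split_ifs
  · exact f.norm_coe_le_norm _
  · simp

theorem abs_mul_zeroExt_le {k K : ℝ} (hk : |k| ≤ K) : |k * zeroExt f x| ≤ K * ‖f‖ := by
  rw [abs_mul]
  exact mul_le_mul hk (abs_zeroExt_le f x) (abs_nonneg _) ((abs_nonneg k).trans hk)

theorem continuousOn_zeroExt : ContinuousOn (zeroExt f) Dom := by
  rw [continuousOn_iff_continuous_domRestrict]
  convert f.continuous using 1
  ext x
  exact zeroExt_of_mem f x.2

end ZeroExt

theorem BddFun.eq_of_eqOn {f g : BddFun} (h : EqOn (zeroExt f) (zeroExt g) Dom) : f = g := by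
  ext x
  rw [← zeroExt_of_mem f x.2, ← zeroExt_of_mem g x.2, h x.2]

theorem BddFun.norm_le {f : BddFun} {C : ℝ} (hC : 0 ≤ C) (h : ∀ x ∈ Dom, |zeroExt f x| ≤ C) :
    ‖f‖ ≤ C :=
  (BoundedContinuousFunction.norm_le hC).2 fun x => by
    rw [← zeroExt_of_mem f x.2]
    exact h x x.2

/-- The restriction to `(-1, 1)` of a function that is continuous and bounded there. -/
noncomputable def BddFun.mk (φ : ℝ → ℝ) (hφ : ContinuousOn φ Dom) (C : ℝ)
    (hC : ∀ x ∈ Dom, |φ x| ≤ C) : BddFun :=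
  BoundedContinuousFunction.ofNormedAddCommGroup (fun x : Dom => φ x)
    (continuousOn_iff_continuous_domRestrict.1 hφ) C fun x => hC x x.2

@[simp] theorem zeroExt_mk (φ : ℝ → ℝ) (hφ : ContinuousOn φ Dom) (C : ℝ)
    (hC : ∀ x ∈ Dom, |φ x| ≤ C) {x : ℝ} (hx : x ∈ Dom) :
    zeroExt (BddFun.mk φ hφ C hC) x = φ x := by
  rw [zeroExt_of_mem _ hx]
  rfl

section MkCLM

variable {E : Type*} [SeminormedAddCommGroup E] [NormedSpace ℝ E]

/-- The continuous linear map to `BddFun` given by a pointwise bounded linear operation. -/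
noncomputable def BddFun.mkCLM (Φ : E → ℝ → ℝ) (C : ℝ) (hC : 0 ≤ C)
    (hcont : ∀ f, ContinuousOn (Φ f) Dom)
    (hadd : ∀ f g, ∀ x ∈ Dom, Φ (f + g) x = Φ f x + Φ g x)
    (hsmul : ∀ (c : ℝ) f, ∀ x ∈ Dom, Φ (c • f) x = c * Φ f x)
    (hbdd : ∀ f, ∀ x ∈ Dom, |Φ f x| ≤ C * ‖f‖) : E →L[ℝ] BddFun :=
  LinearMap.mkContinuous
    { toFun := fun f => BddFun.mk (Φ f) (hcont f) (C * ‖f‖) (hbdd f)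
      map_add' := fun f g => BddFun.eq_of_eqOn fun x hx => by simp [hx, hadd f g x hx]
      map_smul' := fun c f => BddFun.eq_of_eqOn fun x hx => by simp [hx, hsmul c f x hx] } C
    fun f => BddFun.norm_le (mul_nonneg hC (norm_nonneg _)) fun x hx => by
      simpa [hx] using hbdd f x hx

theorem zeroExt_mkCLM {Φ : E → ℝ → ℝ} {C : ℝ} {hC : 0 ≤ C}
    {hcont : ∀ f, ContinuousOn (Φ f) Dom}
    {hadd : ∀ f g, ∀ x ∈ Dom, Φ (f + g) x = Φ f x + Φ g x}
    {hsmul : ∀ (c : ℝ) f, ∀ x ∈ Dom, Φ (c • f) x = c * Φ f x}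
    {hbdd : ∀ f, ∀ x ∈ Dom, |Φ f x| ≤ C * ‖f‖} (f : E) {x : ℝ} (hx : x ∈ Dom) :
    zeroExt (BddFun.mkCLM Φ C hC hcont hadd hsmul hbdd f) x = Φ f x :=
  zeroExt_mk (Φ f) (hcont f) (C * ‖f‖) (hbdd f) hx

end MkCLM

theorem Dom.continuousOn_rpow (p : ℝ) : ContinuousOn (fun s : ℝ => (1 + s) ^ p) Dom :=
  (continuousOn_one_add_rpow p).mono Ioo_subset_Ioc_self

theorem Dom.rpow_pos (p : ℝ) {x : ℝ} (hx : x ∈ Dom) : 0 < (1 + x) ^ p :=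
  Real.rpow_pos_of_pos (Dom.one_add_pos hx) p

theorem Dom.rpow_le {p : ℝ} (hp : 0 ≤ p) {x : ℝ} (hx : x ∈ Dom) : (1 + x) ^ p ≤ 2 ^ p :=
  Real.rpow_le_rpow (Dom.one_add_pos hx).le (by linarith [hx.2]) hp

theorem Dom.rpow_neg_mul_rpow (p : ℝ) {x : ℝ} (hx : x ∈ Dom) :
    (1 + x) ^ (-p) * (1 + x) ^ p = 1 := by
  rw [← Real.rpow_add (Dom.one_add_pos hx), neg_add_cancel, Real.rpow_zero]

theorem Dom.rpow_mul_rpow {p q r x : ℝ} (hx : x ∈ Dom) (h : p + q = r) :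
    (1 + x) ^ p * (1 + x) ^ q = (1 + x) ^ r := by
  rw [← Real.rpow_add (Dom.one_add_pos hx), h]

/-- The function `(1 + x)^p`, `p ≥ 0`, as a bounded function. -/
noncomputable def oneAddRpow (p : ℝ) (hp : 0 ≤ p) : BddFun :=
  BddFun.mk (fun x => (1 + x) ^ p) (Dom.continuousOn_rpow p) (2 ^ p) fun x hx => by
    rw [abs_of_pos (Dom.rpow_pos p hx)]
    exact Dom.rpow_le hp hx

theorem zeroExt_oneAddRpow {p : ℝ} (hp : 0 ≤ p) {x : ℝ} (hx : x ∈ Dom) :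
    zeroExt (oneAddRpow p hp) x = (1 + x) ^ p := zeroExt_mk _ _ _ _ hx

/-- The function `1 - x` as a bounded function. -/
noncomputable def oneSub : BddFun :=
  BddFun.mk (fun x => 1 - x) (continuousOn_const.sub continuousOn_id) 2 fun x hx => by
    rw [abs_of_pos (Dom.one_sub_pos hx)]
    linarith [hx.1]

theorem zeroExt_oneSub {x : ℝ} (hx : x ∈ Dom) : zeroExt oneSub x = 1 - x := zeroExt_mk _ _ _ _ hx

section HeadOp

variable {p : ℝ}

theorem continuousOn_rpow_mul_zeroExt (p : ℝ) (f : BddFun) :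
    ContinuousOn (fun s => (1 + s) ^ p * zeroExt f s) Dom :=
  (Dom.continuousOn_rpow p).mul (continuousOn_zeroExt f)

theorem abs_rpow_mul_zeroExt_le (p : ℝ) (f : BddFun) :
    ∀ x ∈ Dom, |(1 + x) ^ p * zeroExt f x| ≤ ‖f‖ * (1 + x) ^ p := fun x hx => by
  have hw := Dom.rpow_pos p hx
  rw [abs_mul, abs_of_pos hw, mul_comm]
  exact mul_le_mul_of_nonneg_right (abs_zeroExt_le f x) hw.le

theorem intervalIntegrable_rpow_mul_zeroExt (hp : -1 < p) (f : BddFun) :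
    IntervalIntegrable (fun s => (1 + s) ^ p * zeroExt f s) volume (-1) 1 :=
  intervalIntegrable_of_abs_le_rpow (continuousOn_rpow_mul_zeroExt p f) hp
    (abs_rpow_mul_zeroExt_le p f)

theorem abs_rpow_neg_mul_headInt_le (hp : -1 < p) (f : BddFun) {x : ℝ} (hx : x ∈ Dom) :
    |(1 + x) ^ (-(p + 1)) * headInt (fun s => (1 + s) ^ p * zeroExt f s) x| ≤
      1 / (p + 1) * ‖f‖ := by
  have hw := Dom.rpow_pos (-(p + 1)) hx
  rw [abs_mul, abs_of_pos hw]
  calc _ ≤ (1 + x) ^ (-(p + 1)) * (‖f‖ * ((1 + x) ^ (p + 1) / (p + 1))) := by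
        gcongr
        exact abs_headInt_le hp (abs_rpow_mul_zeroExt_le p f) ⟨hx.1.le, hx.2.le⟩
    _ = ((1 + x) ^ (-(p + 1)) * (1 + x) ^ (p + 1)) * (1 / (p + 1) * ‖f‖) := by ring
    _ = 1 / (p + 1) * ‖f‖ := by rw [Dom.rpow_neg_mul_rpow _ hx, one_mul]

/-- The operator `f ↦ (1+x)^{-(p+1)} ∫_{-1}^x (1+s)^p f(s) ds`. -/
noncomputable def headOp (p : ℝ) (hp : -1 < p) : BddFun →L[ℝ] BddFun :=
  BddFun.mkCLM
    (fun f x => (1 + x) ^ (-(p + 1)) * headInt (fun s => (1 + s) ^ p * zeroExt f s) x)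
    (1 / (p + 1)) (one_div_nonneg.2 (by linarith))
    (fun f => (Dom.continuousOn_rpow _).mul
      ((continuousOn_headInt (intervalIntegrable_rpow_mul_zeroExt hp f)).mono Ioo_subset_Icc_self))
    (fun f g x hx => by
      have hint := intervalIntegrable_rpow_mul_zeroExt hp
      simp only [zeroExt_add, mul_add]
      rw [← mul_add, headInt_add (hint f) (hint g) hx])
    (fun c f x _ => by
      simp only [zeroExt_smul, mul_left_comm _ c]
      rw [headInt_const_mul, mul_left_comm])
    (fun f _ hx => abs_rpow_neg_mul_headInt_le hp f hx)

theorem rpow_mul_zeroExt_headOp (hp : -1 < p) (f : BddFun) {x : ℝ} (hx : x ∈ Dom) (r : ℝ) :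
    (1 + x) ^ r * zeroExt (headOp p hp f) x =
      (1 + x) ^ (r - (p + 1)) * headInt (fun s => (1 + s) ^ p * zeroExt f s) x := by
  rw [headOp, zeroExt_mkCLM f hx, ← mul_assoc, ← Real.rpow_add (Dom.one_add_pos hx),
    sub_eq_add_neg]

end HeadOp

section TailOp

variable {q : ℝ} (n : ℕ)

theorem TailIntegrable.pow_mul_rpow_mul_zeroExt (p : ℝ) (f : BddFun) :
    TailIntegrable (fun s => (1 - s) ^ n * (1 + s) ^ p * zeroExt f s) :=
  ((TailIntegrable.one_sub_pow_mul_rpow n p).mul_of_bdd (continuousOn_zeroExt f)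
    fun x _ => abs_zeroExt_le f x).congr fun _ _ => mul_comm _ _

theorem abs_pow_mul_rpow_mul_zeroExt_le (p : ℝ) (f : BddFun) : ∀ x ∈ Dom,
    |(1 - x) ^ n * (1 + x) ^ p * zeroExt f x| ≤ ‖f‖ * ((1 - x) ^ n * (1 + x) ^ p) :=
  fun x hx => by
    have hw : 0 < (1 - x) ^ n * (1 + x) ^ p :=
      mul_pos (pow_pos (Dom.one_sub_pos hx) n) (Dom.rpow_pos p hx)
    rw [abs_mul, abs_of_pos hw, mul_comm]
    exact mul_le_mul_of_nonneg_right (abs_zeroExt_le f x) hw.le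

theorem inv_pow_mul_rpow_mul_cancel (q : ℝ) {x : ℝ} (hx : x ∈ Dom) :
    ((1 - x) ^ (n + 1))⁻¹ * (1 + x) ^ q * ((1 - x) ^ (n + 1) * (1 + x) ^ (-q)) = 1 := by
  rw [mul_mul_mul_comm, inv_mul_cancel₀ (pow_pos (Dom.one_sub_pos hx) _).ne', one_mul, mul_comm,
    Dom.rpow_neg_mul_rpow q hx]

theorem abs_inv_pow_mul_rpow_mul_tailInt_le (hq : 0 < q) (f : BddFun) {x : ℝ} (hx : x ∈ Dom) :
    |((1 - x) ^ (n + 1))⁻¹ * (1 + x) ^ q *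
      tailInt (fun s => (1 - s) ^ n * (1 + s) ^ (-1 - q) * zeroExt f s) x| ≤
      (1 + 1 / q) * ‖f‖ := by
  have hw : 0 < ((1 - x) ^ (n + 1))⁻¹ * (1 + x) ^ q :=
    mul_pos (inv_pos.2 (pow_pos (Dom.one_sub_pos hx) _)) (Dom.rpow_pos q hx)
  rw [abs_mul, abs_of_pos hw]
  calc _ ≤ ((1 - x) ^ (n + 1))⁻¹ * (1 + x) ^ q *
        (‖f‖ * (1 + 1 / q) * ((1 - x) ^ (n + 1) * (1 + x) ^ (-q))) := by
        gcongr
        exact abs_tailInt_le n hq (norm_nonneg f) (abs_pow_mul_rpow_mul_zeroExt_le n _ f) hx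
    _ = (1 + 1 / q) * ‖f‖ := by
        rw [mul_left_comm, inv_pow_mul_rpow_mul_cancel n q hx, mul_one, mul_comm]

/-- The operator `f ↦ (1-x)^{-(n+1)} (1+x)^q ∫_x^1 (1-s)^n (1+s)^{-1-q} f(s) ds`. -/
noncomputable def tailOp (q : ℝ) (hq : 0 < q) : BddFun →L[ℝ] BddFun :=
  BddFun.mkCLM
    (fun f x => ((1 - x) ^ (n + 1))⁻¹ * (1 + x) ^ q *
      tailInt (fun s => (1 - s) ^ n * (1 + s) ^ (-1 - q) * zeroExt f s) x)
    (1 + 1 / q) (by positivity)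
    (fun f => ((ContinuousOn.inv₀ (by fun_prop) fun x hx =>
        (pow_pos (Dom.one_sub_pos hx) _).ne').mul (Dom.continuousOn_rpow _)).mul
      ((TailIntegrable.pow_mul_rpow_mul_zeroExt n _ f).continuousOn_tailInt.mono
        Ioo_subset_Ioc_self))
    (fun f g x hx => by
      have hint := TailIntegrable.pow_mul_rpow_mul_zeroExt n (-1 - q)
      simp only [zeroExt_add, mul_add]
      rw [(hint f).tailInt_add (hint g) hx, mul_add])
    (fun c f x _ => by
      simp only [zeroExt_smul, mul_left_comm _ c]
      rw [tailInt_const_mul, mul_left_comm])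
    (fun f _ hx => abs_inv_pow_mul_rpow_mul_tailInt_le n hq f hx)

theorem pow_mul_rpow_mul_zeroExt_tailOp (hq : 0 < q) (f : BddFun) {x : ℝ} (hx : x ∈ Dom) :
    (1 - x) ^ (n + 1) * (1 + x) ^ (-q) * zeroExt (tailOp n q hq f) x =
      tailInt (fun s => (1 - s) ^ n * (1 + s) ^ (-1 - q) * zeroExt f s) x := by
  rw [tailOp, zeroExt_mkCLM f hx, ← mul_assoc, mul_comm (_ * _) (_⁻¹ * _),
    inv_pow_mul_rpow_mul_cancel n q hx, one_mul]

end TailOp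

/-! ### First-order equations with a power singularity at `-1` -/

section FirstOrder

variable {b p r : ℝ} {x : ℝ}

theorem hasDerivAt_rpow_neg_mul {F : ℝ → ℝ} {g : ℝ} (hr : r = b + p - 1) (hx : x ∈ Dom)
    (hF : HasDerivAt F ((1 + x) ^ r * g) x) :
    HasDerivAt (fun s => (1 + s) ^ (-b) * F s)
      (((1 + x) ^ p * g - b * ((1 + x) ^ (-b) * F x)) / (1 + x)) x := by
  have hx0 := Dom.one_add_pos hx
  refine ((hasDerivAt_one_add_rpow (-b) hx).mul hF).congr_deriv ((eq_div_iff hx0.ne').2 ?_)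
  have hb : (1 + x) ^ (-b - 1) * (1 + x) = (1 + x) ^ (-b) := by
    rw [← Real.rpow_add_one hx0.ne', sub_add_cancel]
  have hp : (1 + x) ^ (-b) * (1 + x) ^ r * (1 + x) = (1 + x) ^ p := by
    rw [Dom.rpow_mul_rpow hx rfl, ← Real.rpow_add_one hx0.ne', hr]
    ring_nf
  linear_combination -b * F x * hb + g * hp

theorem exists_sub_eq_const_mul_rpow {f f' f₀ g : ℝ → ℝ}
    (hf : ∀ x ∈ Dom, HasDerivAt f (f' x) x)
    (h : ∀ x ∈ Dom, (1 + x) * f' x + b * f x = g x)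
    (hf₀ : ∀ x ∈ Dom, HasDerivAt f₀ ((g x - b * f₀ x) / (1 + x)) x) :
    ∃ k, ∀ x ∈ Dom, f x - f₀ x = k * (1 + x) ^ (-b) :=
  exists_eq_const_mul_rpow (fun x hx => (hf x hx).sub (hf₀ x hx)) fun x hx => by
    have := Dom.one_add_pos hx
    rw [← h x hx]
    field_simp
    ring

theorem eq_zero_of_abs_le_rpow {k C : ℝ} (hp : 0 < p) (h : ∀ x ∈ Dom, |k| ≤ C * (1 + x) ^ p) :
    k = 0 := by
  have hlim : Tendsto (fun x : ℝ => C * (1 + x) ^ p) (𝓝[>] (-1)) (𝓝 (C * (1 + -1) ^ p)) :=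
    (Tendsto.mono_left ((continuousAt_const.add continuousAt_id).rpow_const (.inr hp.le))
      nhdsWithin_le_nhds).const_mul C
  rw [add_neg_cancel, Real.zero_rpow hp.ne', mul_zero] at hlim
  refine abs_nonpos_iff.1 (ge_of_tendsto hlim ?_)
  filter_upwards [Ioo_mem_nhdsGT (show (-1 : ℝ) < 1 by norm_num)] with x hx using h x hx

theorem BddFun.eq_of_rpow_mul_eq {f g : BddFun}
    (h : ∀ x ∈ Dom, (1 + x) ^ p * zeroExt f x = (1 + x) ^ p * zeroExt g x) : f = g :=
  BddFun.eq_of_eqOn fun x hx => mul_left_cancel₀ (Dom.rpow_pos p hx).ne' (h x hx)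

end FirstOrder

/-! ### The operators of the linearized system

The unknowns are bounded functions, which represent weighted functions through `zFun`, `yFun`,
`hFun` and `uFun`: `y = ∫_{-1}^x z` is, up to the factor `1 - x`, the `θ`-component and
`u = -∫_x^1 h` is the `φ`-component. -/

section Unweighted

variable {ε : ℝ}

/-- The function `z = (1+x)^{-2ε} f` represented by `f`. -/
noncomputable def zFun (ε : ℝ) (f : BddFun) (x : ℝ) : ℝ := (1 + x) ^ (-2 * ε) * zeroExt f x

/-- The function `y = (1+x)^{1-2ε} f` represented by `f`. -/
noncomputable def yFun (ε : ℝ) (f : BddFun) (x : ℝ) : ℝ := (1 + x) ^ (1 - 2 * ε) * zeroExt f x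

/-- The function `h = (1+x)^{-1-ε} f` represented by `f`. -/
noncomputable def hFun (ε : ℝ) (f : BddFun) (x : ℝ) : ℝ := (1 + x) ^ (-1 - ε) * zeroExt f x

/-- The function `u = (1-x) (1+x)^{-ε} f` represented by `f`. -/
noncomputable def uFun (ε : ℝ) (f : BddFun) (x : ℝ) : ℝ := (1 - x) * (1 + x) ^ (-ε) * zeroExt f x

theorem continuousOn_zFun (f : BddFun) : ContinuousOn (zFun ε f) Dom :=
  continuousOn_rpow_mul_zeroExt _ f

theorem intervalIntegrable_zFun (hε : ε < 1 / 2) (f : BddFun) :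
    IntervalIntegrable (zFun ε f) volume (-1) 1 :=
  intervalIntegrable_rpow_mul_zeroExt (by linarith) f

theorem continuousOn_hFun (f : BddFun) : ContinuousOn (hFun ε f) Dom :=
  continuousOn_rpow_mul_zeroExt _ f

theorem TailIntegrable.rpow_mul_zeroExt (p : ℝ) (f : BddFun) :
    TailIntegrable (fun s => (1 + s) ^ p * zeroExt f s) :=
  (TailIntegrable.pow_mul_rpow_mul_zeroExt 0 p f).congr fun x _ => by simp

theorem tailIntegrable_hFun (f : BddFun) : TailIntegrable (hFun ε f) := .rpow_mul_zeroExt _ f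

theorem hFun_sub_smul (f g : BddFun) (k x : ℝ) :
    hFun ε (f - k • g) x = hFun ε f x - k * hFun ε g x := by
  simp only [hFun, zeroExt_sub, zeroExt_smul]
  ring

end Unweighted

/-- The range of the parameters: `a` stands for `√(1+2μ)`. -/
structure Admissible (ε a : ℝ) : Prop where
  nonneg : 0 ≤ a
  lt : a < ε
  lt_half : ε < 1 / 2

namespace Admissible

variable {ε a : ℝ} (c : Admissible ε a)

theorem pos (c : Admissible ε a) : 0 < ε := c.nonneg.trans_lt c.lt

/-- The operator `z ↦ y = ∫_{-1}^x z`. -/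
noncomputable def yInt : BddFun →L[ℝ] BddFun := headOp (-2 * ε) (by linarith [c.lt_half])

/-- The operator `h ↦ u = -∫_x^1 h`. -/
noncomputable def uInt : BddFun →L[ℝ] BddFun := -tailOp 0 ε c.pos

/-- The functional `h ↦ u(0) = -∫_0^1 h`. -/
noncomputable def uZero : BddFun →L[ℝ] ℝ :=
  (BoundedContinuousFunction.evalCLM ℝ (⟨0, Dom.zero_mem⟩ : Dom)).comp c.uInt

/-- The solution operator `ζ ↦ z` of `(1+x) z' + (1+a) z = ζ`. -/
noncomputable def zSolve : BddFun →L[ℝ] BddFun :=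
  headOp (a - 2 * ε) (by linarith [c.nonneg, c.lt_half])

/-- The solution `h = -(1+x)^{-1-a}` of the homogeneous equation `(1+x) h' + (1+a) h = 0`. -/
noncomputable def hHom : BddFun := -oneAddRpow (ε - a) (sub_nonneg.2 c.lt.le)

/-- A solution operator `g ↦ h` of `(1+x) h' + (1+a) h = g`. -/
noncomputable def hSolveAux : BddFun →L[ℝ] BddFun :=
  -(ContinuousLinearMap.mul ℝ BddFun oneSub).comp (tailOp 0 (ε - a) (sub_pos.2 c.lt))

/-- The multiple of `hHom` by which `hSolve` and `hSolveAux` differ. -/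
noncomputable def hConst : BddFun →L[ℝ] ℝ := (c.uZero c.hHom)⁻¹ • c.uZero.comp c.hSolveAux

/-- The solution operator `g ↦ h` of `(1+x) h' + (1+a) h = g`, `∫_0^1 h = 0`. -/
noncomputable def hSolve : BddFun →L[ℝ] BddFun := c.hSolveAux - c.hConst.smulRight c.hHom

/-- The operator which yields the term `ψ` of the first equation when it is applied to the
product of `u` and `h`. -/
noncomputable def swirlOp : BddFun →L[ℝ] BddFun :=
  (-2 : ℝ) • (tailOp 2 (2 * ε) (by linarith [c.pos])).comp
    (tailOp 1 (1 + 2 * ε) (by linarith [c.pos]))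

/-- The function `(1+x)^{1-2ε}`: the product of functions represented by `zFun` and `yFun` is
represented by `zFun` after multiplication by it. -/
noncomputable def yWeight : BddFun := oneAddRpow (1 - 2 * ε) (by linarith [c.lt_half])

theorem yFun_yInt (f : BddFun) {x : ℝ} (hx : x ∈ Dom) :
    yFun ε (c.yInt f) x = headInt (zFun ε f) x := by
  have hexp : 1 - 2 * ε - (-2 * ε + 1) = 0 := by ring
  rw [yFun, yInt, rpow_mul_zeroExt_headOp _ _ hx, hexp, Real.rpow_zero, one_mul]
  rfl

theorem hasDerivAt_yFun (f : BddFun) {x : ℝ} (hx : x ∈ Dom) :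
    HasDerivAt (yFun ε (c.yInt f)) (zFun ε f x) x := by
  refine (hasDerivAt_headInt (continuousOn_zFun f) (intervalIntegrable_zFun c.lt_half f)
    hx).congr_of_eventuallyEq ?_
  filter_upwards [Dom.mem_nhds hx] with y hy using c.yFun_yInt f hy

theorem uFun_uInt (f : BddFun) {x : ℝ} (hx : x ∈ Dom) :
    uFun ε (c.uInt f) x = -tailInt (hFun ε f) x := by
  have htail := pow_mul_rpow_mul_zeroExt_tailOp 0 c.pos f hx
  simp only [zero_add, pow_one, pow_zero, one_mul] at htail
  simp only [uFun, uInt, neg_apply, zeroExt_neg, mul_neg, htail]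
  rfl

theorem hasDerivAt_uFun (f : BddFun) {x : ℝ} (hx : x ∈ Dom) :
    HasDerivAt (uFun ε (c.uInt f)) (hFun ε f x) x := by
  have htail := ((tailIntegrable_hFun (ε := ε) f).hasDerivAt_tailInt hx).neg
  rw [neg_neg] at htail
  refine htail.congr_of_eventuallyEq ?_
  filter_upwards [Dom.mem_nhds hx] with y hy using c.uFun_uInt f hy

theorem uZero_apply (f : BddFun) : c.uZero f = zeroExt (c.uInt f) 0 := by
  rw [zeroExt_of_mem _ Dom.zero_mem]
  rfl

theorem uZero_eq (f : BddFun) : c.uZero f = -tailInt (hFun ε f) 0 := by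
  simp [← c.uFun_uInt f Dom.zero_mem, uZero_apply, uFun]

section ZSolve

theorem zFun_zSolve (ζ : BddFun) {x : ℝ} (hx : x ∈ Dom) : zFun ε (c.zSolve ζ) x =
    (1 + x) ^ (-(1 + a)) * headInt (fun s => (1 + s) ^ (a - 2 * ε) * zeroExt ζ s) x := by
  rw [zFun, zSolve, rpow_mul_zeroExt_headOp _ _ hx]
  congr 2
  ring

theorem hasDerivAt_zFun (ζ : BddFun) {x : ℝ} (hx : x ∈ Dom) :
    HasDerivAt (zFun ε (c.zSolve ζ))
      ((zFun ε ζ x - (1 + a) * zFun ε (c.zSolve ζ) x) / (1 + x)) x := by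
  have hhead := hasDerivAt_headInt (continuousOn_rpow_mul_zeroExt (a - 2 * ε) ζ)
    (intervalIntegrable_rpow_mul_zeroExt (by linarith [c.nonneg, c.lt_half]) ζ) hx
  rw [c.zFun_zSolve ζ hx]
  refine (hasDerivAt_rpow_neg_mul (p := -2 * ε) (by ring) hx hhead).congr_of_eventuallyEq ?_
  filter_upwards [Dom.mem_nhds hx] with y hy using c.zFun_zSolve ζ hy

/-- A solution of the homogeneous equation is a multiple of `(1+x)^{-1-a}`, which is too singular
at `-1` to be represented by a bounded function. -/
theorem zSolve_eq {ζ z : BddFun} {z' : ℝ → ℝ} (hz : ∀ x ∈ Dom, HasDerivAt (zFun ε z) (z' x) x)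
    (h : ∀ x ∈ Dom, (1 + x) * z' x + (1 + a) * zFun ε z x = zFun ε ζ x) : c.zSolve ζ = z := by
  obtain ⟨k, hk⟩ := exists_sub_eq_const_mul_rpow hz h fun _ hx => c.hasDerivAt_zFun ζ hx
  have hbound : ∀ x ∈ Dom, |k| ≤ ‖z - c.zSolve ζ‖ * (1 + x) ^ (1 + a - 2 * ε) := fun x hx => by
    have hk_eq : k = (1 + x) ^ (1 + a - 2 * ε) * zeroExt (z - c.zSolve ζ) x := by
      have hkx := hk x hx
      simp only [zFun] at hkx
      rw [← Dom.rpow_mul_rpow (p := 1 + a) (q := -2 * ε) hx (by ring), zeroExt_sub]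
      linear_combination (-k) * Dom.rpow_neg_mul_rpow (1 + a) hx - (1 + x) ^ (1 + a) * hkx
    rw [hk_eq]
    exact abs_rpow_mul_zeroExt_le _ _ x hx
  have hk0 : k = 0 := eq_zero_of_abs_le_rpow (by linarith [c.lt_half, c.nonneg]) hbound
  refine BddFun.eq_of_rpow_mul_eq (p := -2 * ε) fun x hx => ?_
  have hkx := hk x hx
  rw [hk0, zero_mul] at hkx
  exact (sub_eq_zero.1 hkx).symm

end ZSolve

section HSolve

theorem hFun_hHom {x : ℝ} (hx : x ∈ Dom) : hFun ε c.hHom x = -(1 + x) ^ (-(1 + a)) := by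
  rw [hFun, hHom, zeroExt_neg, zeroExt_oneAddRpow _ hx, mul_neg,
    Dom.rpow_mul_rpow (r := -(1 + a)) hx (by ring)]

theorem uFun_uInt_hHom {x : ℝ} (hx : x ∈ Dom) :
    uFun ε (c.uInt c.hHom) x = tailInt (fun s => (1 + s) ^ (-(1 + a))) x := by
  have hcongr : EqOn (hFun ε c.hHom) (fun s => (-1) * (1 + s) ^ (-(1 + a))) Dom :=
    fun s hs => by simp only [c.hFun_hHom hs, neg_one_mul]
  rw [c.uFun_uInt _ hx, tailInt_congr hcongr (Ioo_subset_Icc_self hx), tailInt_const_mul,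
    neg_one_mul, neg_neg]

theorem uZero_hHom_pos : 0 < c.uZero c.hHom := by
  rw [uZero_eq, ← c.uFun_uInt _ Dom.zero_mem, c.uFun_uInt_hHom Dom.zero_mem]
  refine intervalIntegral.intervalIntegral_pos_of_pos_on ?_ (fun x hx => ?_) one_pos
  · exact (TailIntegrable.of_continuousOn_Ioc (continuousOn_one_add_rpow _)).intervalIntegrable 0
      Dom.zero_mem
  · exact Real.rpow_pos_of_pos (by linarith [hx.1]) _

theorem hSolve_apply (g : BddFun) : c.hSolve g = c.hSolveAux g - c.hConst g • c.hHom := rfl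

theorem uZero_hSolve (g : BddFun) : c.uZero (c.hSolve g) = 0 := by
  have hpos := c.uZero_hHom_pos.ne'
  rw [hSolve_apply, map_sub, map_smul, smul_eq_mul]
  simp only [hConst, smul_apply, ContinuousLinearMap.comp_apply, smul_eq_mul]
  field_simp
  ring

theorem hFun_hSolveAux (g : BddFun) {x : ℝ} (hx : x ∈ Dom) : hFun ε (c.hSolveAux g) x =
    -((1 + x) ^ (-(1 + a)) * tailInt (fun s => (1 + s) ^ (-1 - (ε - a)) * zeroExt g s) x) := by
  have htail := pow_mul_rpow_mul_zeroExt_tailOp 0 (sub_pos.2 c.lt) g hx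
  simp only [zero_add, pow_one, pow_zero, one_mul] at htail
  rw [← htail, hFun, hSolveAux,
    ← Dom.rpow_mul_rpow (p := -(1 + a)) (q := -(ε - a)) hx (by ring : _ = -1 - ε)]
  simp only [neg_apply, ContinuousLinearMap.comp_apply, ContinuousLinearMap.mul_apply',
    zeroExt_neg, zeroExt_mul, zeroExt_oneSub hx]
  ring

theorem hFun_hSolve (g : BddFun) {x : ℝ} (hx : x ∈ Dom) : hFun ε (c.hSolve g) x =
    (1 + x) ^ (-(1 + a)) *
      (c.hConst g - tailInt (fun s => (1 + s) ^ (-1 - (ε - a)) * zeroExt g s) x) := by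
  rw [hSolve_apply, hFun_sub_smul, c.hFun_hSolveAux g hx, c.hFun_hHom hx]
  ring

theorem hasDerivAt_hFun (g : BddFun) {x : ℝ} (hx : x ∈ Dom) :
    HasDerivAt (hFun ε (c.hSolve g))
      ((hFun ε g x - (1 + a) * hFun ε (c.hSolve g) x) / (1 + x)) x := by
  have htail := ((TailIntegrable.rpow_mul_zeroExt (-1 - (ε - a)) g).hasDerivAt_tailInt
    hx).const_sub (c.hConst g)
  rw [neg_neg] at htail
  rw [c.hFun_hSolve g hx]
  refine (hasDerivAt_rpow_neg_mul (p := -1 - ε) (by ring) hx htail).congr_of_eventuallyEq ?_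
  filter_upwards [Dom.mem_nhds hx] with y hy using c.hFun_hSolve g hy

theorem hSolve_eq {g h : BddFun} {h' : ℝ → ℝ} (hh : ∀ x ∈ Dom, HasDerivAt (hFun ε h) (h' x) x)
    (he : ∀ x ∈ Dom, (1 + x) * h' x + (1 + a) * hFun ε h x = hFun ε g x) (h0 : c.uZero h = 0) :
    c.hSolve g = h := by
  obtain ⟨k, hk⟩ := exists_sub_eq_const_mul_rpow hh he fun _ hx => c.hasDerivAt_hFun g hx
  have hdiff : h = c.hSolve g - k • c.hHom := BddFun.eq_of_rpow_mul_eq (p := -1 - ε) fun x hx => by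
    change hFun ε h x = hFun ε (c.hSolve g - k • c.hHom) x
    rw [hFun_sub_smul, c.hFun_hHom hx]
    linear_combination hk x hx
  have hk0 : k = 0 := by
    have huZero := congrArg c.uZero hdiff
    simpa [h0, c.uZero_hSolve, c.uZero_hHom_pos.ne'] using huZero
  rw [hdiff, hk0, zero_smul, sub_zero]

end HSolve

theorem zFun_swirlOp (f : BddFun) {x : ℝ} (hx : x ∈ Dom) :
    (1 - x) ^ 3 * zFun ε (c.swirlOp f) x =
      -2 * tailInt (tailInt (fun s => (1 - s) * (1 + s) ^ (-2 - 2 * ε) * zeroExt f s)) x := by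
  have hinner : EqOn (fun s => (1 - s) ^ 2 * (1 + s) ^ (-1 - 2 * ε) *
      zeroExt (tailOp 1 (1 + 2 * ε) (by linarith [c.pos]) f) s)
      (tailInt (fun s => (1 - s) * (1 + s) ^ (-2 - 2 * ε) * zeroExt f s)) Dom := fun s hs => by
    have htail := pow_mul_rpow_mul_zeroExt_tailOp 1 (q := 1 + 2 * ε) (by linarith [c.pos]) f hs
    have hexp : -(1 + 2 * ε) = -1 - 2 * ε := by ring
    have hexp' : -1 - (1 + 2 * ε) = -2 - 2 * ε := by ring
    simpa only [hexp, hexp', pow_one] using htail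
  have houter := pow_mul_rpow_mul_zeroExt_tailOp 2 (q := 2 * ε) (by linarith [c.pos])
    (tailOp 1 (1 + 2 * ε) (by linarith [c.pos]) f) hx
  rw [tailInt_congr hinner ⟨hx.1.le, hx.2.le⟩, ← neg_mul] at houter
  rw [← houter]
  simp only [zFun, swirlOp, smul_apply, ContinuousLinearMap.comp_apply, zeroExt_smul]
  ring

end Admissible

/-! ### The solution operators with values in `M₁(ε)` and `M₂(ε)` -/

section Bounds

variable {ε : ℝ} (f : BddFun) {x : ℝ}

/-- The function `w = (1-x) y = (1-x) (1+x)^{1-2ε} f` represented by `f`. -/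
noncomputable def wFun (ε : ℝ) (f : BddFun) (x : ℝ) : ℝ := (1 - x) * yFun ε f x

theorem uFun_of_notMem (hx : x ∉ Dom) : uFun ε f x = 0 := by simp [uFun, zeroExt_of_notMem f hx]

theorem yFun_of_notMem (hx : x ∉ Dom) : yFun ε f x = 0 := by simp [yFun, zeroExt_of_notMem f hx]

theorem abs_rpow_mul_one_sub_mul_le {p q : ℝ} (h : p + q = 0) (hx : x ∈ Dom) :
    |(1 + x) ^ p * ((1 - x) * (1 + x) ^ q * zeroExt f x)| ≤ 2 * ‖f‖ := by
  have hcancel : (1 + x) ^ p * ((1 - x) * (1 + x) ^ q * zeroExt f x) = (1 - x) * zeroExt f x := by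
    linear_combination
      (1 - x) * zeroExt f x * (Dom.rpow_mul_rpow hx h).trans (Real.rpow_zero _)
  rw [hcancel]
  exact abs_mul_zeroExt_le f x (abs_le.2 ⟨by linarith [hx.2], by linarith [hx.1]⟩)

theorem abs_rpow_mul_wFun_le (hx : x ∈ Dom) :
    |(1 + x) ^ (-1 + 2 * ε) * wFun ε f x| ≤ 2 * ‖f‖ := by
  rw [wFun, yFun, ← mul_assoc (1 - x)]
  exact abs_rpow_mul_one_sub_mul_le f (by ring) hx

theorem rpow_mul_hFun (hx : x ∈ Dom) : (1 + x) ^ (1 + ε) * hFun ε f x = zeroExt f x := by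
  rw [hFun, ← mul_assoc, Dom.rpow_mul_rpow (r := 0) hx (by ring), Real.rpow_zero, one_mul]

theorem rpow_mul_zFun (hx : x ∈ Dom) : (1 + x) ^ (2 * ε) * zFun ε f x = zeroExt f x := by
  rw [zFun, ← mul_assoc, Dom.rpow_mul_rpow (r := 0) hx (by ring), Real.rpow_zero, one_mul]

theorem rpow_mul_yFun (hx : x ∈ Dom) :
    (1 + x) ^ (2 * ε) * yFun ε f x = (1 + x) * zeroExt f x := by
  rw [yFun, ← mul_assoc, Dom.rpow_mul_rpow (r := 1) hx (by ring), Real.rpow_one]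

theorem abs_zFun_le (hε : 0 ≤ ε) (hx : x ∈ Ioo (0 : ℝ) 1) : |zFun ε f x| ≤ ‖f‖ := by
  have hw : |(1 + x) ^ (-2 * ε)| ≤ 1 := by
    rw [abs_of_pos (Real.rpow_pos_of_pos (by linarith [hx.1]) _)]
    exact Real.rpow_le_one_of_one_le_of_nonpos (by linarith [hx.1]) (by linarith)
  simpa [zFun] using abs_mul_zeroExt_le f x hw

theorem hasDerivAt_one_sub_mul {y : ℝ → ℝ} {y' : ℝ} (hy : HasDerivAt y y' x) :
    HasDerivAt (fun s => (1 - s) * y s) ((1 - x) * y' - y x) x :=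
  (((hasDerivAt_id x).const_sub 1).mul hy).congr_deriv (by simp only [id]; ring)

end Bounds

section M2Derivative

variable {ε : ℝ}

/-- The bounded function which represents through `hFun` the derivative of an element of
`M₂(ε)`. -/
noncomputable def hHat (ε : ℝ) : M2 ε →L[ℝ] BddFun :=
  BddFun.mkCLM (fun u x => (1 + x) ^ (1 + ε) * deriv (u : ℝ → ℝ) x) 1 zero_le_one
    (fun u => (Dom.continuousOn_rpow _).mul
      (u.2.2.2.1.continuousOn_deriv_of_isOpen isOpen_Ioo (by norm_num)))
    (fun u v x hx => by
      have hadd : deriv ((u + v : M2 ε) : ℝ → ℝ) x = deriv (u : ℝ → ℝ) x + deriv (v : ℝ → ℝ) x :=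
        deriv_add_on isOpen_Ioo (u.2.2.2.1.differentiableOn (by norm_num))
          (v.2.2.2.1.differentiableOn (by norm_num)) x hx
      rw [hadd, mul_add])
    (fun k u x hx => by
      have hsmul : deriv ((k • u : M2 ε) : ℝ → ℝ) x = k * deriv (u : ℝ → ℝ) x :=
        deriv_smul_on (s := Dom) (f := u.1) k x hx
      rw [hsmul, mul_left_comm])
    (fun u x hx => by
      rw [one_mul]
      have hu : wSup (Ioo (-1) 1) (fun x => (1 + x) ^ (1 + ε)) (deriv u.1) ≤ normM2 ε u.1 :=
        (le_add_of_nonneg_left wSup_nonneg).trans (le_add_of_nonneg_right wSup_nonneg)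
      exact (le_wSup u.2.2.2.2.2.1 hx).trans hu)

theorem hFun_hHat (u : M2 ε) {x : ℝ} (hx : x ∈ Dom) :
    hFun ε (hHat ε u) x = deriv (u : ℝ → ℝ) x := by
  rw [hFun, hHat, zeroExt_mkCLM u hx, ← mul_assoc, Dom.rpow_mul_rpow (r := 0) hx (by ring),
    Real.rpow_zero, one_mul]

theorem hasDerivAt_hHat (u : M2 ε) {x : ℝ} (hx : x ∈ Dom) :
    HasDerivAt (u : ℝ → ℝ) (hFun ε (hHat ε u) x) x := by
  rw [hFun_hHat u hx]
  exact ((u.2.2.2.1.differentiableOn (by norm_num)).differentiableAt (Dom.mem_nhds hx)).hasDerivAt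

end M2Derivative

namespace Admissible

variable {ε a : ℝ} (c : Admissible ε a)

section M2Valued

variable {g h : BddFun}

theorem deriv_uFun (h : BddFun) : EqOn (deriv (uFun ε (c.uInt h))) (hFun ε h) Dom :=
  fun _ hx => (c.hasDerivAt_uFun h hx).deriv

theorem abs_rpow_mul_deriv_uFun_le (h : BddFun) {x : ℝ} (hx : x ∈ Dom) :
    |(1 + x) ^ (1 + ε) * deriv (uFun ε (c.uInt h)) x| ≤ ‖h‖ := by
  rw [c.deriv_uFun h hx, rpow_mul_hFun h hx]
  exact abs_zeroExt_le h x

variable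
  (hh : ∀ x ∈ Dom, HasDerivAt (hFun ε h) ((hFun ε g x - (1 + a) * hFun ε h x) / (1 + x)) x)

include hh in
theorem abs_rpow_mul_deriv_deriv_uFun_le {x : ℝ} (hx : x ∈ Dom) :
    |(1 + x) ^ (2 + ε) * deriv (deriv (uFun ε (c.uInt h))) x| ≤ ‖g‖ + 2 * ‖h‖ := by
  have hx0 := Dom.one_add_pos hx
  have hw : (1 + x) ^ (2 + ε) = (1 + x) ^ (1 + ε) * (1 + x) := by
    rw [← Real.rpow_add_one hx0.ne']
    ring_nf
  have hweight : (1 + x) ^ (2 + ε) * ((hFun ε g x - (1 + a) * hFun ε h x) / (1 + x)) =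
      zeroExt g x - (1 + a) * zeroExt h x := by
    rw [← rpow_mul_hFun (ε := ε) g hx, ← rpow_mul_hFun (ε := ε) h hx, hw]
    field_simp
  rw [((eventuallyEq_of_mem (Dom.mem_nhds hx) (c.deriv_uFun h)).deriv_eq), (hh x hx).deriv, hweight]
  refine (abs_sub _ _).trans (add_le_add (abs_zeroExt_le g x) (abs_mul_zeroExt_le h x ?_))
  exact abs_le.2 ⟨by linarith [c.nonneg], by linarith [c.lt, c.lt_half]⟩

include hh in
theorem normM2_uFun_le :
    normM2 ε (uFun ε (c.uInt h)) ≤ 2 * ‖c.uInt h‖ + ‖h‖ + (‖g‖ + 2 * ‖h‖) := by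
  refine add_le_add (add_le_add (wSup_le (by positivity) fun x hx => ?_)
    (wSup_le (norm_nonneg h) fun x hx => c.abs_rpow_mul_deriv_uFun_le h hx))
    (wSup_le (by positivity) fun x hx => c.abs_rpow_mul_deriv_deriv_uFun_le hh hx)
  exact abs_rpow_mul_one_sub_mul_le _ (add_neg_cancel ε) hx

include hh in
theorem uFun_mem_M2Sub {H : ℝ → ℝ} (hH : EqOn (hFun ε h) H Dom)
    (hHc : ContinuousOn H (Ioc (-1) 1)) : uFun ε (c.uInt h) ∈ M2Sub ε := by
  have huc : ContinuousOn (uFun ε (c.uInt h)) (Ioc (-1) 1) := by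
    refine (tailIntegrable_hFun (ε := ε) h).continuousOn_tailInt.neg.congr fun x hx => ?_
    rcases hx.2.lt_or_eq with hx1 | rfl
    · exact c.uFun_uInt h ⟨hx.1, hx1⟩
    · simp [uFun]
  refine ⟨fun x hx => uFun_of_notMem _ hx, ?_, ?_,
    wbdd_of_le fun x hx => abs_rpow_mul_one_sub_mul_le _ (add_neg_cancel ε) hx,
    wbdd_of_le fun x hx => c.abs_rpow_mul_deriv_uFun_le h hx,
    wbdd_of_le fun x hx => c.abs_rpow_mul_deriv_deriv_uFun_le hh hx⟩
  · exact contDiffOn_one_Ioc huc (fun x hx => hH hx ▸ c.hasDerivAt_uFun h hx) hHc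
  · refine contDiffOn_two_of_hasDerivAt isOpen_Ioo (fun x hx => c.hasDerivAt_uFun h hx) hh ?_
    exact ((continuousOn_hFun g).sub (continuousOn_const.mul (continuousOn_hFun h))).div
      (by fun_prop) fun x hx => (Dom.one_add_pos hx).ne'

end M2Valued

theorem uFun_hSolve_mem_M2Sub (g : BddFun) : uFun ε (c.uInt (c.hSolve g)) ∈ M2Sub ε :=
  c.uFun_mem_M2Sub (fun _ hx => c.hasDerivAt_hFun g hx) (fun _ hx => c.hFun_hSolve g hx) <|
    (continuousOn_one_add_rpow _).mul
      (continuousOn_const.sub (TailIntegrable.rpow_mul_zeroExt _ g).continuousOn_tailInt)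

/-- The solution operator `g ↦ u` of `(1+x) u'' + (1+a) u' = g`, `u(0) = u(1) = 0`. -/
noncomputable def phiOp : BddFun →L[ℝ] M2 ε :=
  LinearMap.mkContinuous
    { toFun := fun g => (⟨uFun ε (c.uInt (c.hSolve g)), c.uFun_hSolve_mem_M2Sub g⟩ : M2Sub ε)
      map_add' := fun f g => Subtype.ext <| funext fun x => by
        change uFun ε _ x = uFun ε _ x + uFun ε _ x
        simp only [uFun, map_add, zeroExt_add, mul_add]
      map_smul' := fun k g => Subtype.ext <| funext fun x => by
        change uFun ε _ x = k * uFun ε _ x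
        simp only [uFun, map_smul, zeroExt_smul, mul_left_comm] }
    (2 * ‖c.uInt.comp c.hSolve‖ + ‖c.hSolve‖ + (1 + 2 * ‖c.hSolve‖)) fun g => by
      refine (c.normM2_uFun_le fun _ hx => c.hasDerivAt_hFun g hx).trans ?_
      have hu := (c.uInt.comp c.hSolve).le_opNorm g
      have hh := c.hSolve.le_opNorm g
      rw [ContinuousLinearMap.comp_apply] at hu
      linarith

theorem phiOp_apply (g : BddFun) : (c.phiOp g : ℝ → ℝ) = uFun ε (c.uInt (c.hSolve g)) := rfl

theorem hasDerivAt_hFun_hHom {x : ℝ} (hx : x ∈ Dom) : HasDerivAt (hFun ε c.hHom)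
    ((hFun ε 0 x - (1 + a) * hFun ε c.hHom x) / (1 + x)) x := by
  have hx0 := Dom.one_add_pos hx
  have hpow : (1 + x) ^ (-(1 + a) - 1) * (1 + x) = (1 + x) ^ (-(1 + a)) := by
    rw [← Real.rpow_add_one hx0.ne', sub_add_cancel]
  refine ((hasDerivAt_one_add_rpow (-(1 + a)) hx).neg.congr_of_eventuallyEq
    (eventuallyEq_of_mem (Dom.mem_nhds hx) fun y hy => c.hFun_hHom hy)).congr_deriv ?_
  rw [c.hFun_hHom hx, eq_div_iff hx0.ne', hFun, zeroExt_zero]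
  linear_combination (1 + a) * hpow

/-- The kernel element `∫_x^1 (1+t)^{-1-a} dt` of `M₂(ε)`. -/
noncomputable def kerElt : M2 ε :=
  (⟨uFun ε (c.uInt c.hHom), c.uFun_mem_M2Sub (fun _ hx => c.hasDerivAt_hFun_hHom hx)
    (fun _ hx => c.hFun_hHom hx) (continuousOn_one_add_rpow _).neg⟩ : M2Sub ε)

theorem kerElt_apply : (c.kerElt : ℝ → ℝ) = uFun ε (c.uInt c.hHom) := rfl

theorem kerElt_eq_tailInt {x : ℝ} (hx : x ∈ Dom) :
    c.kerElt x = tailInt (fun s => (1 + s) ^ (-(1 + a))) x :=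
  c.uFun_uInt_hHom hx

theorem norm_kerElt_le_add : ‖c.kerElt‖ ≤ 2 * ‖c.uInt c.hHom‖ + 3 * ‖c.hHom‖ := by
  have h := c.normM2_uFun_le (h := c.hHom) (g := 0) fun _ hx => c.hasDerivAt_hFun_hHom hx
  rw [norm_zero] at h
  exact h.trans_eq (by ring)

theorem eq_uFun (u : M2 ε) : (u : ℝ → ℝ) = uFun ε (c.uInt (hHat ε u)) := by
  funext x
  by_cases hx : x ∈ Dom
  · have htail := (tailIntegrable_hFun _).eqOn_tailInt u.2.2.1.continuousOn.neg
      (fun x hx => (hasDerivAt_hHat u hx).neg) (by simp [u.2.1 1 (by simp)]) ⟨hx.1, hx.2.le⟩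
    rw [c.uFun_uInt _ hx, ← htail, Pi.neg_apply, neg_neg]
  · rw [uFun_of_notMem _ hx, u.2.1 x hx]

theorem uZero_hHat (u : M2 ε) : c.uZero (hHat ε u) = (u : ℝ → ℝ) 0 := by
  rw [uZero_apply, c.eq_uFun u]
  simp [uFun]

theorem hHat_eq {u : M2 ε} {h : BddFun} (hu : (u : ℝ → ℝ) = uFun ε (c.uInt h)) : hHat ε u = h :=
  BddFun.eq_of_rpow_mul_eq (p := -1 - ε) fun x hx => by
    change hFun ε (hHat ε u) x = hFun ε h x
    rw [hFun_hHat u hx, hu, c.deriv_uFun h hx]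

theorem hHat_phiOp (g : BddFun) : hHat ε (c.phiOp g) = c.hSolve g := c.hHat_eq (c.phiOp_apply g)

theorem hHat_kerElt : hHat ε c.kerElt = c.hHom := c.hHat_eq c.kerElt_apply

include c in
theorem hHat_injective : Function.Injective (hHat ε) := fun u v h =>
  Subtype.ext (by rw [c.eq_uFun u, c.eq_uFun v, h])

section M1Valued

theorem hasDerivAt_wFun (z : BddFun) {x : ℝ} (hx : x ∈ Dom) :
    HasDerivAt (wFun ε (c.yInt z)) ((1 - x) * zFun ε z x - yFun ε (c.yInt z) x) x :=
  hasDerivAt_one_sub_mul (c.hasDerivAt_yFun z hx)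

theorem hasDerivAt_deriv_wFun (ζ : BddFun) {x : ℝ} (hx : x ∈ Dom) :
    HasDerivAt (fun s => (1 - s) * zFun ε (c.zSolve ζ) s - yFun ε (c.yInt (c.zSolve ζ)) s)
      ((1 - x) * ((zFun ε ζ x - (1 + a) * zFun ε (c.zSolve ζ) x) / (1 + x)) -
        2 * zFun ε (c.zSolve ζ) x) x :=
  ((hasDerivAt_one_sub_mul (c.hasDerivAt_zFun ζ hx)).sub
    (c.hasDerivAt_yFun (c.zSolve ζ) hx)).congr_deriv (by ring)

theorem deriv_wFun (z : BddFun) : EqOn (deriv (wFun ε (c.yInt z)))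
    (fun x => (1 - x) * zFun ε z x - yFun ε (c.yInt z) x) Dom :=
  fun _ hx => (c.hasDerivAt_wFun z hx).deriv

theorem continuousOn_wFun (z : BddFun) : ContinuousOn (wFun ε (c.yInt z)) (Icc (-1) 1) := by
  have hhead := continuousOn_headInt (intervalIntegrable_zFun c.lt_half z)
  refine ((continuousOn_const (c := (1 : ℝ)).sub continuousOn_id).mul hhead).congr fun x hx => ?_
  rcases hx.1.eq_or_lt with rfl | hx0
  · simp [wFun, yFun_of_notMem]
  rcases hx.2.lt_or_eq with hx1 | rfl
  · simp [wFun, c.yFun_yInt z ⟨hx0, hx1⟩]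
  · simp [wFun]

theorem contDiffOn_one_wFun (ζ : BddFun) :
    ContDiffOn ℝ 1 (wFun ε (c.yInt (c.zSolve ζ))) (Ioc (-1) 1) := by
  have hz : ContinuousOn (fun x => (1 + x) ^ (-(1 + a)) *
      headInt (fun s => (1 + s) ^ (a - 2 * ε) * zeroExt ζ s) x) (Ioc (-1) 1) :=
    (continuousOn_one_add_rpow _).mul ((continuousOn_headInt (intervalIntegrable_rpow_mul_zeroExt
      (by linarith [c.nonneg, c.lt_half]) ζ)).mono Ioc_subset_Icc_self)
  have hy := (continuousOn_headInt (intervalIntegrable_zFun c.lt_half (c.zSolve ζ))).mono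
    (Ioc_subset_Icc_self : Ioc (-1 : ℝ) 1 ⊆ _)
  refine contDiffOn_one_Ioc ((c.continuousOn_wFun _).mono Ioc_subset_Icc_self) (fun x hx => ?_)
    (((continuousOn_const (c := (1 : ℝ)).sub continuousOn_id).mul hz).sub hy)
  simpa only [Pi.sub_apply, Pi.mul_apply, id, ← c.zFun_zSolve ζ hx, ← c.yFun_yInt _ hx]
    using c.hasDerivAt_wFun (c.zSolve ζ) hx

theorem contDiffOn_two_wFun (ζ : BddFun) :
    ContDiffOn ℝ 2 (wFun ε (c.yInt (c.zSolve ζ))) Dom := by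
  refine contDiffOn_two_of_hasDerivAt isOpen_Ioo (fun _ hx => c.hasDerivAt_wFun _ hx)
    (fun _ hx => c.hasDerivAt_deriv_wFun ζ hx) ?_
  refine .sub (.mul (by fun_prop) (.div ?_ (by fun_prop) fun x hx => (Dom.one_add_pos hx).ne'))
    (continuousOn_const.mul (continuousOn_zFun _))
  exact (continuousOn_zFun ζ).sub (continuousOn_const.mul (continuousOn_zFun _))

theorem abs_rpow_mul_deriv_wFun_le (z : BddFun) {x : ℝ} (hx : x ∈ Dom) :
    |(1 + x) ^ (2 * ε) * deriv (wFun ε (c.yInt z)) x| ≤ 2 * ‖z‖ + 2 * ‖c.yInt z‖ := by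
  have hweight : (1 + x) ^ (2 * ε) * deriv (wFun ε (c.yInt z)) x =
      (1 - x) * zeroExt z x - (1 + x) * zeroExt (c.yInt z) x := by
    rw [c.deriv_wFun z hx, ← rpow_mul_yFun (ε := ε) _ hx, ← rpow_mul_zFun (ε := ε) z hx]
    ring
  rw [hweight]
  refine (abs_sub _ _).trans (add_le_add (abs_mul_zeroExt_le _ x ?_) (abs_mul_zeroExt_le _ x ?_))
  all_goals exact abs_le.2 ⟨by linarith [hx.1, hx.2], by linarith [hx.1, hx.2]⟩

theorem abs_deriv_deriv_wFun_le (ζ : BddFun) {x : ℝ} (hx : x ∈ Ioo (0 : ℝ) 1) :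
    |1 * deriv (deriv (wFun ε (c.yInt (c.zSolve ζ)))) x| ≤ ‖ζ‖ + 4 * ‖c.zSolve ζ‖ := by
  have hxD : x ∈ Dom := Dom.Ioo_subset Dom.zero_mem hx
  have hx0 := Dom.one_add_pos hxD
  have hbound : ∀ f, |zFun ε f x| ≤ ‖f‖ := fun f => abs_zFun_le f c.pos.le hx
  have hnum : |zFun ε ζ x - (1 + a) * zFun ε (c.zSolve ζ) x| ≤ ‖ζ‖ + 2 * ‖c.zSolve ζ‖ := by
    refine (abs_sub _ _).trans (add_le_add (hbound _) ?_)
    rw [abs_mul, abs_of_pos (by linarith [c.nonneg])]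
    exact mul_le_mul (by linarith [c.lt, c.lt_half]) (hbound _) (abs_nonneg _) (by norm_num)
  have hratio : |(1 - x) / (1 + x)| ≤ 1 := by
    rw [abs_of_pos (div_pos (Dom.one_sub_pos hxD) hx0), div_le_one hx0]
    linarith [hx.1]
  rw [one_mul, (eventuallyEq_of_mem (Dom.mem_nhds hxD) (c.deriv_wFun _)).deriv_eq,
    (c.hasDerivAt_deriv_wFun ζ hxD).deriv, mul_div_assoc', mul_div_right_comm]
  calc _ ≤ |(1 - x) / (1 + x)| * |zFun ε ζ x - (1 + a) * zFun ε (c.zSolve ζ) x| +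
        |2 * zFun ε (c.zSolve ζ) x| := (abs_sub _ _).trans (by rw [abs_mul])
    _ ≤ 1 * (‖ζ‖ + 2 * ‖c.zSolve ζ‖) + 2 * ‖c.zSolve ζ‖ := by
        rw [abs_mul 2, abs_two]
        gcongr
        exact hbound _
    _ = ‖ζ‖ + 4 * ‖c.zSolve ζ‖ := by ring

theorem wFun_mem_M1Sub (ζ : BddFun) : wFun ε (c.yInt (c.zSolve ζ)) ∈ M1Sub ε :=
  ⟨fun x hx => by simp [wFun, yFun_of_notMem _ hx], c.continuousOn_wFun _, c.contDiffOn_one_wFun ζ,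
    (c.contDiffOn_two_wFun ζ).mono (Dom.Ioo_subset Dom.zero_mem),
    wbdd_of_le fun _ hx => abs_rpow_mul_wFun_le _ hx,
    wbdd_of_le fun _ hx => c.abs_rpow_mul_deriv_wFun_le _ hx,
    wbdd_of_le fun _ hx => c.abs_deriv_deriv_wFun_le ζ hx⟩

theorem normM1_wFun_le (ζ : BddFun) :
    normM1 ε (wFun ε (c.yInt (c.zSolve ζ))) ≤ 2 * ‖c.yInt (c.zSolve ζ)‖ +
      (2 * ‖c.zSolve ζ‖ + 2 * ‖c.yInt (c.zSolve ζ)‖) + (‖ζ‖ + 4 * ‖c.zSolve ζ‖) :=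
  add_le_add (add_le_add (wSup_le (by positivity) fun _ hx => abs_rpow_mul_wFun_le _ hx)
    (wSup_le (by positivity) fun _ hx => c.abs_rpow_mul_deriv_wFun_le _ hx))
    (wSup_le (by positivity) fun _ hx => c.abs_deriv_deriv_wFun_le ζ hx)

/-- The operator `ζ ↦ (1-x) ∫_{-1}^x z`, where `(1+x) z' + (1+a) z = ζ`. -/
noncomputable def thetaOp : BddFun →L[ℝ] M1 ε :=
  LinearMap.mkContinuous
    { toFun := fun ζ => (⟨wFun ε (c.yInt (c.zSolve ζ)), c.wFun_mem_M1Sub ζ⟩ : M1Sub ε)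
      map_add' := fun f g => Subtype.ext <| funext fun x => by
        change wFun ε _ x = wFun ε _ x + wFun ε _ x
        simp only [wFun, yFun, map_add, zeroExt_add, mul_add]
      map_smul' := fun k g => Subtype.ext <| funext fun x => by
        change wFun ε _ x = k * wFun ε _ x
        simp only [wFun, yFun, map_smul, zeroExt_smul, mul_left_comm] }
    (2 * ‖c.yInt.comp c.zSolve‖ + (2 * ‖c.zSolve‖ + 2 * ‖c.yInt.comp c.zSolve‖) +
      (1 + 4 * ‖c.zSolve‖)) fun g => by
      refine (c.normM1_wFun_le g).trans ?_
      have hy := (c.yInt.comp c.zSolve).le_opNorm g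
      have hz := c.zSolve.le_opNorm g
      rw [ContinuousLinearMap.comp_apply] at hy
      linarith

theorem thetaOp_apply (ζ : BddFun) : (c.thetaOp ζ : ℝ → ℝ) = wFun ε (c.yInt (c.zSolve ζ)) := rfl

end M1Valued

end Admissible

/-! ### The elements of `M₁(ε)` -/

section M1Derivative

variable {ε : ℝ} (w : M1 ε) {x : ℝ}

theorem abs_rpow_mul_M1_le (hx : x ∈ Dom) : |(1 + x) ^ (-1 + 2 * ε) * w x| ≤ ‖w‖ :=
  (le_wSup w.2.2.2.2.2.1 hx).trans
    ((le_add_of_nonneg_right wSup_nonneg).trans (le_add_of_nonneg_right wSup_nonneg))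

theorem abs_rpow_mul_deriv_M1_le (hx : x ∈ Dom) :
    |(1 + x) ^ (2 * ε) * deriv (w : ℝ → ℝ) x| ≤ ‖w‖ :=
  (le_wSup w.2.2.2.2.2.2.1 hx).trans
    ((le_add_of_nonneg_left wSup_nonneg).trans (le_add_of_nonneg_right wSup_nonneg))

theorem abs_deriv_deriv_M1_le (hx : x ∈ Ioo (0 : ℝ) 1) : |deriv (deriv (w : ℝ → ℝ)) x| ≤ ‖w‖ := by
  have hle := le_wSup w.2.2.2.2.2.2.2 hx
  rw [one_mul] at hle
  exact hle.trans (le_add_of_nonneg_left (add_nonneg wSup_nonneg wSup_nonneg))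

theorem contDiffOn_M1 : ContDiffOn ℝ 1 (w : ℝ → ℝ) Dom := w.2.2.2.1.mono Ioo_subset_Ioc_self

theorem differentiableAt_M1 (hx : x ∈ Dom) : DifferentiableAt ℝ (w : ℝ → ℝ) x :=
  ((contDiffOn_M1 w).differentiableOn (by norm_num)).differentiableAt (Dom.mem_nhds hx)

theorem differentiableAt_deriv_M1 (hx : x ∈ Ioo (0 : ℝ) 1) :
    DifferentiableAt ℝ (deriv (w : ℝ → ℝ)) x :=
  ((w.2.2.2.2.1.deriv_of_isOpen (m := 1) isOpen_Ioo (by norm_num)).differentiableOn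
    (by norm_num)).differentiableAt (isOpen_Ioo.mem_nhds hx)

theorem tendsto_M1_one : Tendsto (w : ℝ → ℝ) (𝓝[<] 1) (𝓝 0) := by
  have hcont : ContinuousWithinAt (w : ℝ → ℝ) (Icc (-1) 1) 1 := w.2.2.1 1 (by norm_num)
  rw [ContinuousWithinAt, w.2.1 1 (by simp)] at hcont
  exact hcont.mono_left (nhdsWithin_le_of_mem (Icc_mem_nhdsLT (by norm_num)))

theorem tendsto_M1_neg_one : Tendsto (w : ℝ → ℝ) (𝓝[>] (-1)) (𝓝 0) := by
  have hcont : ContinuousWithinAt (w : ℝ → ℝ) (Icc (-1) 1) (-1) := w.2.2.1 (-1) (by norm_num)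
  rw [ContinuousWithinAt, w.2.1 (-1) (by simp)] at hcont
  exact hcont.mono_left (nhdsWithin_le_of_mem (Icc_mem_nhdsGT (by norm_num)))

/-- The Wronskian of `1 - x` and `w`, which is `(1-x)²` times the derivative of `w / (1-x)`. -/
noncomputable def wronskian (w : ℝ → ℝ) (x : ℝ) : ℝ := (1 - x) * deriv w x + w x

theorem hasDerivAt_div_one_sub (hx : x ∈ Dom) :
    HasDerivAt (fun s => w s / (1 - s)) (wronskian w x / (1 - x) ^ 2) x := by
  refine ((differentiableAt_M1 w hx).hasDerivAt.div ((hasDerivAt_id x).const_sub 1)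
    (Dom.one_sub_pos hx).ne').congr_deriv ?_
  simp only [id, wronskian]
  ring

theorem hasDerivAt_wronskian (hx : x ∈ Ioo (0 : ℝ) 1) :
    HasDerivAt (wronskian w) ((1 - x) * deriv (deriv (w : ℝ → ℝ)) x) x :=
  ((hasDerivAt_one_sub_mul (differentiableAt_deriv_M1 w hx).hasDerivAt).add
    (differentiableAt_M1 w (Dom.Ioo_subset Dom.zero_mem hx)).hasDerivAt).congr_deriv (by ring)

theorem abs_wronskian_sub_le (hx : 0 < x) {y : ℝ} (hy : y ∈ Ioo x 1) :
    |wronskian w y - wronskian w x| ≤ ‖w‖ * (1 - x) ^ 2 := by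
  have hmem : ∀ s ∈ Icc x y, s ∈ Ioo (0 : ℝ) 1 := fun s hs =>
    ⟨hx.trans_le hs.1, hs.2.trans_lt hy.2⟩
  have hderiv : ∀ s ∈ Icc x y, ‖(1 - s) * deriv (deriv (w : ℝ → ℝ)) s‖ ≤ (1 - x) * ‖w‖ :=
    fun s hs => by
      have hs1 : 0 < 1 - s := by linarith [(hmem s hs).2]
      rw [Real.norm_eq_abs, abs_mul, abs_of_pos hs1]
      exact mul_le_mul (by linarith [hs.1]) (abs_deriv_deriv_M1_le w (hmem s hs)) (abs_nonneg _)
        (by linarith [hs.1])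
  calc |wronskian w y - wronskian w x| ≤ (1 - x) * ‖w‖ * |y - x| :=
        Convex.norm_image_sub_le_of_norm_hasDerivWithin_le
          (fun s hs => (hasDerivAt_wronskian w (hmem s hs)).hasDerivWithinAt) hderiv
          (convex_Icc x y) (left_mem_Icc.2 hy.1.le) (right_mem_Icc.2 hy.1.le)
    _ ≤ (1 - x) * ‖w‖ * (1 - x) := by
        rw [abs_of_pos (sub_pos.2 hy.1)]
        have hx1 : 0 ≤ 1 - x := by linarith [hy.1, hy.2]
        gcongr
        exact hy.2.le
    _ = ‖w‖ * (1 - x) ^ 2 := by ring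

theorem abs_wronskian_le_add (hε : 0 ≤ ε) (hx : x ∈ Ioo (0 : ℝ) 1) :
    |wronskian w x| ≤ (1 - x) * ‖w‖ + |w x| := by
  have hxD : x ∈ Dom := Dom.Ioo_subset Dom.zero_mem hx
  have hderiv : |deriv (w : ℝ → ℝ) x| ≤ ‖w‖ := by
    have hweight : 1 ≤ (1 + x) ^ (2 * ε) := Real.one_le_rpow (by linarith [hx.1]) (by positivity)
    have hle := abs_rpow_mul_deriv_M1_le w hxD
    rw [abs_mul, abs_of_pos (Dom.rpow_pos _ hxD)] at hle
    exact (le_mul_of_one_le_left (abs_nonneg _) hweight).trans hle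
  refine (abs_add_le _ _).trans (add_le_add_left ?_ _)
  rw [abs_mul, abs_of_pos (Dom.one_sub_pos hxD)]
  exact mul_le_mul_of_nonneg_left hderiv (Dom.one_sub_pos hxD).le

theorem tendsto_wronskian (hε : 0 ≤ ε) : Tendsto (wronskian w) (𝓝[<] 1) (𝓝 0) := by
  have hsub : Tendsto (fun y : ℝ => 1 - y) (𝓝[<] 1) (𝓝 (1 - 1)) :=
    (tendsto_id.mono_left nhdsWithin_le_nhds).const_sub 1
  have hbound := (hsub.mul_const ‖w‖).add (tendsto_M1_one w).abs
  simp only [sub_self, zero_mul, abs_zero, add_zero] at hbound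
  refine squeeze_zero_norm' ?_ hbound
  filter_upwards [Ioo_mem_nhdsLT zero_lt_one] with y hy using abs_wronskian_le_add w hε hy

theorem abs_wronskian_le (hε : 0 ≤ ε) (hx : x ∈ Ioo (0 : ℝ) 1) :
    |wronskian w x| ≤ ‖w‖ * (1 - x) ^ 2 := by
  have hlim : Tendsto (fun y => |wronskian w y - wronskian w x|) (𝓝[<] 1)
      (𝓝 |0 - wronskian w x|) := ((tendsto_wronskian w hε).sub_const _).abs
  rw [zero_sub, abs_neg] at hlim
  refine le_of_tendsto hlim ?_
  filter_upwards [Ioo_mem_nhdsLT hx.2] with y hy using abs_wronskian_sub_le w hx.1 hy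

theorem abs_rpow_mul_wronskian_div_le_of_nonpos (hx : x ∈ Dom) (h0 : x ≤ 0) :
    |(1 + x) ^ (2 * ε) * (wronskian w x / (1 - x) ^ 2)| ≤ 2 * ‖w‖ := by
  have hx0 := Dom.one_add_pos hx
  have hval : |(1 + x) ^ (2 * ε) * w x| ≤ ‖w‖ := by
    rw [← Dom.rpow_mul_rpow (p := 1) (q := -1 + 2 * ε) hx (by ring), Real.rpow_one, mul_assoc,
      abs_mul, abs_of_pos hx0]
    exact (mul_le_of_le_one_left (abs_nonneg _) (by linarith)).trans (abs_rpow_mul_M1_le w hx)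
  have hderiv : |(1 - x) * ((1 + x) ^ (2 * ε) * deriv (w : ℝ → ℝ) x)| ≤ (1 - x) * ‖w‖ := by
    rw [abs_mul, abs_of_pos (Dom.one_sub_pos hx)]
    exact mul_le_mul_of_nonneg_left (abs_rpow_mul_deriv_M1_le w hx) (Dom.one_sub_pos hx).le
  have hsq : 0 < (1 - x) ^ 2 := pow_pos (Dom.one_sub_pos hx) 2
  rw [mul_div_assoc', abs_div, abs_of_pos hsq, div_le_iff₀ hsq]
  calc |(1 + x) ^ (2 * ε) * wronskian w x|
      = |(1 - x) * ((1 + x) ^ (2 * ε) * deriv (w : ℝ → ℝ) x) + (1 + x) ^ (2 * ε) * w x| := by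
        rw [wronskian]; congr 1; ring
    _ ≤ (1 - x) * ‖w‖ + ‖w‖ := (abs_add_le _ _).trans (add_le_add hderiv hval)
    _ ≤ (1 - x) ^ 2 * ‖w‖ + (1 - x) ^ 2 * ‖w‖ := by
        have hw := norm_nonneg w
        gcongr
        · nlinarith
        · exact le_mul_of_one_le_left hw (one_le_pow₀ (by linarith))
    _ = 2 * ‖w‖ * (1 - x) ^ 2 := by ring

theorem abs_rpow_mul_wronskian_div_le_of_pos (hε : 0 ≤ ε) (hε' : ε < 1 / 2)
    (hx : x ∈ Ioo (0 : ℝ) 1) :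
    |(1 + x) ^ (2 * ε) * (wronskian w x / (1 - x) ^ 2)| ≤ 2 * ‖w‖ := by
  have hxD : x ∈ Dom := Dom.Ioo_subset Dom.zero_mem hx
  have hsq : 0 < (1 - x) ^ 2 := pow_pos (Dom.one_sub_pos hxD) 2
  have hweight : (1 + x) ^ (2 * ε) ≤ 2 := calc
    (1 + x) ^ (2 * ε) ≤ (1 + x) ^ (1 : ℝ) :=
      Real.rpow_le_rpow_of_exponent_le (by linarith [hx.1]) (by linarith)
    _ ≤ 2 := by rw [Real.rpow_one]; linarith [hx.2]
  rw [abs_mul, abs_of_pos (Dom.rpow_pos _ hxD), abs_div, abs_of_pos hsq]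
  exact mul_le_mul hweight ((div_le_iff₀ hsq).2 (abs_wronskian_le w hε hx)) (by positivity)
    zero_le_two

end M1Derivative

namespace Admissible

variable {ε a : ℝ} (c : Admissible ε a)

section M1

/-- The bounded function which represents through `zFun` the derivative of `w / (1-x)`, for `w` in
`M₁(ε)`. -/
noncomputable def zHat (c : Admissible ε a) : M1 ε →L[ℝ] BddFun :=
  BddFun.mkCLM (fun w x => (1 + x) ^ (2 * ε) * (wronskian w x / (1 - x) ^ 2)) 2 zero_le_two
    (fun w => by
      have hderiv := (contDiffOn_M1 w).continuousOn_deriv_of_isOpen isOpen_Ioo le_rfl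
      exact (Dom.continuousOn_rpow _).mul ((((continuousOn_const.sub continuousOn_id).mul
        hderiv).add (contDiffOn_M1 w).continuousOn).div (by fun_prop)
        fun x hx => (pow_pos (Dom.one_sub_pos hx) 2).ne'))
    (fun u v x hx => by
      have hderiv : deriv ((u + v : M1 ε) : ℝ → ℝ) x = deriv (u : ℝ → ℝ) x + deriv (v : ℝ → ℝ) x :=
        deriv_add (differentiableAt_M1 u hx) (differentiableAt_M1 v hx)
      have hval : ((u + v : M1 ε) : ℝ → ℝ) x = u x + v x := rfl
      simp only [wronskian, hderiv, hval]
      ring)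
    (fun k u x hx => by
      have hderiv : deriv ((k • u : M1 ε) : ℝ → ℝ) x = k * deriv (u : ℝ → ℝ) x :=
        deriv_smul_on k x hx
      have hval : ((k • u : M1 ε) : ℝ → ℝ) x = k * u x := rfl
      simp only [wronskian, hderiv, hval]
      ring)
    (fun w x hx => by
      rcases le_or_gt x 0 with h0 | h0
      · exact abs_rpow_mul_wronskian_div_le_of_nonpos w hx h0
      · exact abs_rpow_mul_wronskian_div_le_of_pos w c.pos.le c.lt_half ⟨h0, hx.2⟩)

theorem zFun_zHat (w : M1 ε) {x : ℝ} (hx : x ∈ Dom) :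
    zFun ε (c.zHat w) x = wronskian w x / (1 - x) ^ 2 := by
  rw [zFun, zHat, zeroExt_mkCLM w hx, ← mul_assoc, Dom.rpow_mul_rpow (r := 0) hx (by ring),
    Real.rpow_zero, one_mul]

theorem div_one_sub_eq_yFun (w : M1 ε) {x : ℝ} (hx : x ∈ Dom) :
    w x / (1 - x) = yFun ε (c.yInt (c.zHat w)) x := by
  have hsub : Tendsto (fun x : ℝ => 1 - x) (𝓝[>] (-1)) (𝓝 (1 - -1)) :=
    (tendsto_id.mono_left nhdsWithin_le_nhds).const_sub 1
  have hlim := (tendsto_M1_neg_one w).div hsub (by norm_num)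
  rw [zero_div] at hlim
  rw [c.yFun_yInt _ hx]
  refine eqOn_headInt hlim (fun s hs => ?_) (continuousOn_zFun _)
    (intervalIntegrable_zFun c.lt_half _) hx
  rw [c.zFun_zHat w hs]
  exact hasDerivAt_div_one_sub w hs

theorem eq_wFun (w : M1 ε) : (w : ℝ → ℝ) = wFun ε (c.yInt (c.zHat w)) := by
  funext x
  by_cases hx : x ∈ Dom
  · rw [wFun, ← c.div_one_sub_eq_yFun w hx, mul_div_cancel₀ _ (Dom.one_sub_pos hx).ne']
  · rw [wFun, yFun_of_notMem _ hx, mul_zero]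
    exact w.2.1 x hx

theorem zHat_injective : Function.Injective c.zHat := fun w v h =>
  Subtype.ext (by rw [c.eq_wFun w, c.eq_wFun v, h])

theorem zHat_thetaOp (ζ : BddFun) : c.zHat (c.thetaOp ζ) = c.zSolve ζ :=
  BddFun.eq_of_rpow_mul_eq (p := -2 * ε) fun x hx => by
    change zFun ε (c.zHat (c.thetaOp ζ)) x = zFun ε (c.zSolve ζ) x
    rw [c.zFun_zHat _ hx, thetaOp_apply, wronskian, c.deriv_wFun _ hx, wFun,
      div_eq_iff (pow_ne_zero 2 (Dom.one_sub_pos hx).ne')]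
    ring

end M1

end Admissible

/-! ### The function `ψ` -/

section Psi

variable {f g : ℝ → ℝ}

theorem swirlDensity_congr (h : EqOn f g Dom) : EqOn (swirlDensity f) (swirlDensity g) Dom :=
  fun x hx => by
    rw [swirlDensity, swirlDensity, h hx, (h.eventuallyEq_of_mem (Dom.mem_nhds hx)).deriv_eq]

theorem psiInner_eq (f : ℝ → ℝ) : psiInner f = tailInt (tailInt (swirlDensity f)) := rfl

theorem psi_eq (f : ℝ → ℝ) : psi f = tailInt (psiInner f) := rfl

theorem psiInner_congr (h : EqOn f g Dom) : EqOn (psiInner f) (psiInner g) Dom := fun _ hx =>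
  tailInt_congr (fun _ ht => tailInt_congr (swirlDensity_congr h) (Ioo_subset_Icc_self ht))
    (Ioo_subset_Icc_self hx)

theorem psi_congr (h : EqOn f g Dom) : EqOn (psi f) (psi g) (Icc (-1) 1) :=
  fun _ hx => tailInt_congr (psiInner_congr h) hx

theorem IsSolution.congr {f' g' : ℝ → ℝ} {κ : ℝ} (h : IsSolution f g κ) (hf : EqOn f' f Dom)
    (hg : EqOn g' g Dom) : IsSolution f' g' κ where
  contDiffOn_theta := h.contDiffOn_theta.congr hf
  contDiffOn_phi := h.contDiffOn_phi.congr hg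
  integrable t ht := by
    refine (intervalIntegrable_congr_uIoo fun x hx => ?_).1 (h.integrable t ht)
    rw [uIoo_of_le ht.2.le] at hx
    exact (swirlDensity_congr hg (Dom.Ioo_subset ht hx)).symm
  eq_theta x hx := by
    rw [hf hx, (hf.eventuallyEq_of_mem (Dom.mem_nhds hx)).deriv_eq,
      psi_congr hg (Ioo_subset_Icc_self hx)]
    exact h.eq_theta x hx
  eq_phi x hx := by
    rw [hf hx, (hg.eventuallyEq_of_mem (Dom.mem_nhds hx)).deriv_eq,
      (hg.eventuallyEq_of_mem (Dom.mem_nhds hx)).deriv.deriv_eq]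
    exact h.eq_phi x hx

end Psi

theorem bFun_eq {μ x : ℝ} (hx : x ∈ Dom) : bFun μ x = (1 + √(1 + 2 * μ)) * Real.log (1 + x) := by
  have hsub : uIcc 0 x ⊆ Dom := (convex_Ioo (-1 : ℝ) 1).ordConnected.uIcc_subset Dom.zero_mem hx
  have hfactor : ∀ s : ℝ, 1 - s ^ 2 = (1 - s) * (1 + s) := fun s => by ring
  have hprim : ∀ s ∈ uIcc 0 x, HasDerivAt (fun s => (1 + √(1 + 2 * μ)) * Real.log (1 + s))
      (Ubar μ s / (1 - s ^ 2)) s := fun s hs => by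
    have hs0 := (Dom.one_add_pos (hsub hs)).ne'
    have hs1 := (Dom.one_sub_pos (hsub hs)).ne'
    refine ((((hasDerivAt_id s).const_add 1).log hs0).const_mul _).congr_deriv ?_
    rw [Ubar, hfactor]
    simp only [id]
    field_simp
  have hcont : ContinuousOn (fun s => Ubar μ s / (1 - s ^ 2)) (uIcc 0 x) := by
    unfold Ubar
    refine ContinuousOn.div (by fun_prop) (by fun_prop) fun s hs => ?_
    rw [hfactor]
    exact (mul_pos (Dom.one_sub_pos (hsub hs)) (Dom.one_add_pos (hsub hs))).ne'
  rw [bFun, intervalIntegral.integral_eq_sub_of_hasDerivAt hprim hcont.intervalIntegrable]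
  simp

theorem V2phi_eq_tailInt {μ x : ℝ} (hx : x ∈ Dom) :
    V2phi μ x = tailInt (fun s => (1 + s) ^ (-(1 + √(1 + 2 * μ)))) x := by
  refine tailInt_congr (fun t ht => ?_) (Ioo_subset_Icc_self hx)
  simp only [bFun_eq ht, Real.rpow_def_of_pos (Dom.one_add_pos ht)]
  ring_nf

namespace Admissible

variable {ε a : ℝ} (c : Admissible ε a)

section Kernel

theorem kerElt_eq {μ : ℝ} (ha : √(1 + 2 * μ) = a) {x : ℝ} (hx : x ∈ Dom) :
    c.kerElt x = V2phi μ x := by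
  rw [V2phi_eq_tailInt hx, ha, c.kerElt_eq_tailInt hx]

theorem uZero_hHom : c.uZero c.hHom = c.kerElt 0 := by
  rw [← hHat_kerElt, uZero_hHat]

theorem kerElt_zero_pos : 0 < c.kerElt 0 := c.uZero_hHom ▸ c.uZero_hHom_pos

end Kernel

section Density

/-- The product of the bounded functions which represent `u` and `u'`. -/
noncomputable def prodHat (u : M2 ε) : BddFun := c.uInt (hHat ε u) * hHat ε u

variable (u : M2 ε) {x : ℝ}

theorem swirlDensity_eq (hx : x ∈ Dom) :
    swirlDensity u x = 2 * ((1 + x) ^ (-2 - 2 * ε) * zeroExt (c.prodHat u) x) := by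
  have hx0 := Dom.one_add_pos hx
  have hx1 := Dom.one_sub_pos hx
  have hpow : (1 + x) ^ (-2 - 2 * ε) * (1 + x) = (1 + x) ^ (-ε) * (1 + x) ^ (-1 - ε) := by
    rw [← Real.rpow_add_one hx0.ne', ← Real.rpow_add hx0]
    congr 1
    ring
  have hfactor : 1 - x ^ 2 = (1 - x) * (1 + x) := by ring
  have hu : (u : ℝ → ℝ) x = uFun ε (c.uInt (hHat ε u)) x := congrFun (c.eq_uFun u) x
  rw [swirlDensity, ← hFun_hHat u hx, hfactor, div_eq_iff (mul_pos hx1 hx0).ne', prodHat,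
    zeroExt_mul, hu, uFun, hFun]
  linear_combination
    (-2 * (1 - x) * zeroExt (c.uInt (hHat ε u)) x * zeroExt (hHat ε u) x) * hpow

include c in
theorem tailIntegrable_swirlDensity : TailIntegrable (swirlDensity u) :=
  ((TailIntegrable.rpow_mul_zeroExt (-2 - 2 * ε) (c.prodHat u)).const_mul 2).congr
    fun _ hx => c.swirlDensity_eq u hx

include c in
theorem exists_psiInner_bound : ∃ C, ∀ x ∈ Dom, |psiInner u x| ≤ C * (1 + x) ^ (-2 * ε) := by
  have hε := c.pos
  have hdensity : ∀ x ∈ Dom, |swirlDensity u x| ≤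
      (2 * ‖c.prodHat u‖) * ((1 - x) ^ 0 * (1 + x) ^ (-1 - (1 + 2 * ε))) := fun x hx => by
    rw [c.swirlDensity_eq u hx, abs_mul, abs_two, pow_zero, one_mul, mul_assoc,
      show -1 - (1 + 2 * ε) = -2 - 2 * ε by ring]
    exact mul_le_mul_of_nonneg_left (abs_rpow_mul_zeroExt_le _ _ x hx) zero_le_two
  have htail : ∀ x ∈ Dom, |tailInt (swirlDensity u) x| ≤
      (2 * ‖c.prodHat u‖ * (1 + 1 / (1 + 2 * ε))) *
        ((1 - x) ^ 1 * (1 + x) ^ (-1 - 2 * ε)) := fun x hx => by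
    rw [show -1 - 2 * ε = -(1 + 2 * ε) by ring]
    exact abs_tailInt_le 0 (by positivity) (by positivity) hdensity hx
  refine ⟨2 * ‖c.prodHat u‖ * (1 + 1 / (1 + 2 * ε)) * (1 + 1 / (2 * ε)) * 4, fun x hx => ?_⟩
  refine (abs_tailInt_le 1 (by positivity) (by positivity) htail hx).trans ?_
  have hsq : (1 - x) ^ (1 + 1) ≤ 4 :=
    (pow_le_pow_left₀ (Dom.one_sub_pos hx).le (by linarith [hx.1] : 1 - x ≤ 2) _).trans
      (by norm_num)
  have hweight := Dom.rpow_pos (-2 * ε) hx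
  rw [mul_assoc _ (4 : ℝ), show -(2 * ε) = -2 * ε by ring]
  gcongr

include c in
theorem intervalIntegrable_psiInner : IntervalIntegrable (psiInner u) volume (-1) 1 := by
  obtain ⟨C, hC⟩ := c.exists_psiInner_bound u
  exact intervalIntegrable_of_abs_le_rpow (c.tailIntegrable_swirlDensity u).tail.tail.continuousOn
    (by linarith [c.lt_half]) hC

include c in
theorem tendsto_psi : Tendsto (psi u) (𝓝[>] (-1)) (𝓝 (psi u (-1))) := by
  have hint := c.intervalIntegrable_psiInner u
  have hcont : ContinuousOn (psi u) (uIcc (-1) 1) :=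
    intervalIntegral.continuousOn_primitive_interval_left
      ((intervalIntegrable_iff' (by simp)).1 hint)
  rw [uIcc_of_le (by norm_num)] at hcont
  exact (hcont (-1) (by norm_num)).mono_left
    (nhdsWithin_le_of_mem (Icc_mem_nhdsGT (by norm_num)))

end Density

end Admissible

section TailIntegration

variable {φ : ℝ → ℝ}

theorem TailIntegrable.one_sub_mul (h : TailIntegrable φ) :
    TailIntegrable (fun s => (1 - s) * φ s) :=
  h.mul_of_bdd (by fun_prop) (C := 2) fun x hx => by
    rw [abs_of_pos (Dom.one_sub_pos hx)]
    linarith [hx.1]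

theorem TailIntegrable.one_sub_mul_tailInt_sub (h : TailIntegrable φ) :
    EqOn (fun x => (1 - x) * tailInt φ x - tailInt (tailInt φ) x)
      (tailInt fun s => (1 - s) * φ s) (Ioc (-1) 1) := by
  have hsub : ContinuousOn (fun x : ℝ => 1 - x) (Ioc (-1) 1) := by fun_prop
  refine h.one_sub_mul.eqOn_tailInt
    ((hsub.mul h.continuousOn_tailInt).sub h.tail.continuousOn_tailInt) (fun x hx => ?_) (by simp)
  exact ((hasDerivAt_one_sub_mul (h.hasDerivAt_tailInt hx)).sub
    (h.tail.hasDerivAt_tailInt hx)).congr_deriv (by ring)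

theorem TailIntegrable.one_sub_mul_tailInt_tailInt_sub (h : TailIntegrable φ) :
    EqOn (fun x => (1 - x) * tailInt (tailInt φ) x - 2 * tailInt (tailInt (tailInt φ)) x)
      (tailInt (tailInt fun s => (1 - s) * φ s)) (Ioc (-1) 1) := by
  have hsub : ContinuousOn (fun x : ℝ => 1 - x) (Ioc (-1) 1) := by fun_prop
  refine h.one_sub_mul.tail.eqOn_tailInt ((hsub.mul h.tail.continuousOn_tailInt).sub
    (continuousOn_const.mul h.tail.tail.continuousOn_tailInt)) (fun x hx => ?_) (by simp)
  refine ((hasDerivAt_one_sub_mul (h.tail.hasDerivAt_tailInt hx)).sub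
    ((h.tail.tail.hasDerivAt_tailInt hx).const_mul 2)).congr_deriv ?_
  rw [← h.one_sub_mul_tailInt_sub (Ioo_subset_Ioc_self hx)]
  ring

end TailIntegration

namespace Admissible

variable {ε a : ℝ} (c : Admissible ε a) (u : M2 ε) {x : ℝ}

theorem two_mul_psi_sub (hx : x ∈ Dom) :
    2 * psi u x - (1 - x) * psiInner u x = (1 - x) ^ 3 * zFun ε (c.swirlOp (c.prodHat u)) x := by
  have hdensity : EqOn (fun s => (1 - s) * swirlDensity u s)
      (fun s => 2 * ((1 - s) * (1 + s) ^ (-2 - 2 * ε) * zeroExt (c.prodHat u) s)) Dom :=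
    fun s hs => by simp only [c.swirlDensity_eq u hs]; ring
  have htail : EqOn (tailInt fun s => (1 - s) * swirlDensity u s)
      (fun x => 2 * tailInt (fun s => (1 - s) * (1 + s) ^ (-2 - 2 * ε) *
        zeroExt (c.prodHat u) s) x) Dom :=
    fun s hs => by rw [tailInt_congr hdensity (Ioo_subset_Icc_self hs), tailInt_const_mul]
  have hpsi := (c.tailIntegrable_swirlDensity u).one_sub_mul_tailInt_tailInt_sub
    (Ioo_subset_Ioc_self hx)
  rw [tailInt_congr htail (Ioo_subset_Icc_self hx), tailInt_const_mul] at hpsi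
  rw [c.zFun_swirlOp _ hx, psi_eq, psiInner_eq]
  linarith

theorem hasDerivAt_psi_div (hx : x ∈ Dom) :
    HasDerivAt (fun s => psi u s / (1 - s) ^ 2) (zFun ε (c.swirlOp (c.prodHat u)) x) x := by
  have hx1 := (Dom.one_sub_pos hx).ne'
  have hpsi : HasDerivAt (psi u) (-psiInner u x) x :=
    (c.tailIntegrable_swirlDensity u).tail.tail.hasDerivAt_tailInt hx
  refine (hpsi.div (((hasDerivAt_id x).const_sub 1).pow 2) (pow_ne_zero 2 hx1)).congr_deriv ?_
  rw [div_eq_iff (by simpa using hx1)]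
  simp only [id, Pi.pow_apply]
  linear_combination (1 - x) * c.two_mul_psi_sub u hx

end Admissible

/-! ### The reduced system -/

theorem tendsto_one_add_rpow_mul_zeroExt {p : ℝ} (hp : 0 < p) (f : BddFun) :
    Tendsto (fun x => (1 + x) ^ p * zeroExt f x) (𝓝[>] (-1)) (𝓝 0) := by
  have hbound : Tendsto (fun x : ℝ => ‖f‖ * (1 + x) ^ p) (𝓝[>] (-1)) (𝓝 (‖f‖ * (1 + -1) ^ p)) := by
    refine Tendsto.const_mul _ (Tendsto.mono_left ?_ nhdsWithin_le_nhds)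
    exact ContinuousAt.rpow_const (continuousAt_const.add continuousAt_id) (Or.inr hp.le)
  rw [add_neg_cancel, Real.zero_rpow hp.ne', mul_zero] at hbound
  refine squeeze_zero_norm' ?_ hbound
  filter_upwards [Ioo_mem_nhdsGT (show (-1 : ℝ) < 1 by norm_num)] with x hx
  exact abs_rpow_mul_zeroExt_le p f x hx

theorem differentiableAt_deriv_M2 {ε : ℝ} (u : M2 ε) {x : ℝ} (hx : x ∈ Dom) :
    DifferentiableAt ℝ (deriv (u : ℝ → ℝ)) x :=
  ((u.2.2.2.1.deriv_of_isOpen (m := 1) isOpen_Ioo (by norm_num)).differentiableOn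
    (by norm_num)).differentiableAt (Dom.mem_nhds hx)

/-- The linear equation `(1+x) f' + (1+a) f = g` on `(-1,1)`. -/
def EulerEq (a : ℝ) (f g : ℝ → ℝ) : Prop :=
  ∀ x ∈ Dom, HasDerivAt f ((g x - (1 + a) * f x) / (1 + x)) x

namespace Admissible

variable {ε a : ℝ} (c : Admissible ε a)

/-- The difference of the two sides of the first equation of `(∗)` for `U = Ū^μ + (w, u)`, divided
by `(1-x)²`, up to the additive constant `μ - μ̂`. Here `w = (1-x) y` and `y' = z`. -/
noncomputable def firstIntegral (w : M1 ε) (u : ℝ → ℝ) (x : ℝ) : ℝ :=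
  (1 + x) * zFun ε (c.zHat w) x + a * yFun ε (c.yInt (c.zHat w)) x +
    1 / 2 * yFun ε (c.yInt (c.zHat w)) x ^ 2 - psi u x / (1 - x) ^ 2

/-- The system satisfied by the representatives of `w` and `u`: the first equation of `(∗)`
divided by `(1-x)²` and differentiated, which removes the constant `μ̂`, and the second equation
divided by `1-x`. -/
structure Reduced (w : M1 ε) (u : M2 ε) : Prop where
  theta : EulerEq a (zFun ε (c.zHat w)) fun x =>
    zFun ε (c.swirlOp (c.prodHat u)) x - yFun ε (c.yInt (c.zHat w)) x * zFun ε (c.zHat w) x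
  phi : EulerEq a (hFun ε (hHat ε u)) fun x =>
    -(yFun ε (c.yInt (c.zHat w)) x * hFun ε (hHat ε u) x)

variable {μ : ℝ} {w : M1 ε} {u : M2 ε} {x : ℝ}

theorem hasDerivAt_Ubar_add (ha : √(1 + 2 * μ) = a) (hx : x ∈ Dom) :
    HasDerivAt (fun x => Ubar μ x + w x)
      (-(1 + a) + ((1 - x) * zFun ε (c.zHat w) x - yFun ε (c.yInt (c.zHat w)) x)) x := by
  have hUbar : HasDerivAt (Ubar μ) (-(1 + a)) x := by
    refine (((hasDerivAt_id x).const_sub 1).const_mul (1 + √(1 + 2 * μ))).congr_deriv ?_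
    rw [ha]
    ring
  have hw := c.hasDerivAt_wFun (c.zHat w) hx
  rw [← c.eq_wFun w] at hw
  exact hUbar.add hw

theorem theta_eq_iff (ha : √(1 + 2 * μ) = a) (hμ : a ^ 2 = 1 + 2 * μ) {f : ℝ → ℝ} {κ : ℝ}
    (hx : x ∈ Dom) :
    (1 - x ^ 2) * deriv (fun x => Ubar μ x + w x) x + 2 * x * (Ubar μ x + w x) +
      1 / 2 * (Ubar μ x + w x) ^ 2 - psi f x = κ * (1 - x) ^ 2 ↔
    c.firstIntegral w f x = κ - μ := by
  have hne := (pow_pos (Dom.one_sub_pos hx) 2).ne'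
  have hw : w x = (1 - x) * yFun ε (c.yInt (c.zHat w)) x := congrFun (c.eq_wFun w) x
  have hpsi : psi f x = psi f x / (1 - x) ^ 2 * (1 - x) ^ 2 := (div_mul_cancel₀ _ hne).symm
  rw [(c.hasDerivAt_Ubar_add ha hx).deriv, hw, Ubar, ha, hpsi, firstIntegral, ← hpsi]
  constructor
  · intro h
    apply mul_right_cancel₀ hne
    linear_combination h - (1 - x) ^ 2 / 2 * hμ + hpsi
  · intro h
    linear_combination (1 - x) ^ 2 * h + (1 - x) ^ 2 / 2 * hμ - hpsi

theorem phi_eq_iff (ha : √(1 + 2 * μ) = a) (hx : x ∈ Dom) (d : ℝ) :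
    (1 - x ^ 2) * d + (Ubar μ x + w x) * deriv (u : ℝ → ℝ) x = 0 ↔
    d = (-(yFun ε (c.yInt (c.zHat w)) x * hFun ε (hHat ε u) x) -
      (1 + a) * hFun ε (hHat ε u) x) / (1 + x) := by
  have hne := (Dom.one_sub_pos hx).ne'
  have hw : w x = (1 - x) * yFun ε (c.yInt (c.zHat w)) x := congrFun (c.eq_wFun w) x
  rw [eq_div_iff (Dom.one_add_pos hx).ne', hw, Ubar, ha, ← hFun_hHat u hx]
  constructor
  · intro h
    apply mul_left_cancel₀ hne
    linear_combination h
  · intro h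
    linear_combination (1 - x) * h

theorem eulerEq_zFun_zHat {k : ℝ} (hk : ∀ x ∈ Dom, c.firstIntegral w u x = k) :
    EulerEq a (zFun ε (c.zHat w)) fun x => zFun ε (c.swirlOp (c.prodHat u)) x -
      yFun ε (c.yInt (c.zHat w)) x * zFun ε (c.zHat w) x := fun x hx => by
  have hsolved : EqOn (zFun ε (c.zHat w)) (fun x => (psi u x / (1 - x) ^ 2 -
      a * yFun ε (c.yInt (c.zHat w)) x - 1 / 2 * yFun ε (c.yInt (c.zHat w)) x ^ 2 + k) / (1 + x))
      Dom := fun x hx => by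
    have hkx := hk x hx
    rw [firstIntegral] at hkx
    simp only [eq_div_iff (Dom.one_add_pos hx).ne']
    linarith
  have hne := (Dom.one_add_pos hx).ne'
  have hy := c.hasDerivAt_yFun (c.zHat w) hx
  have hderiv := ((((c.hasDerivAt_psi_div u hx).sub (hy.const_mul a)).sub
    ((hy.pow 2).const_mul (1 / 2))).add_const k).div ((hasDerivAt_id' x).const_add 1) hne
  refine (hderiv.congr_of_eventuallyEq
    (hsolved.eventuallyEq_of_mem (Dom.mem_nhds hx))).congr_deriv ?_
  have hzx := hsolved hx
  simp only [eq_div_iff hne] at hzx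
  rw [div_eq_div_iff (pow_ne_zero 2 hne) hne]
  simp only [Pi.sub_apply, Pi.pow_apply]
  push_cast
  linear_combination (1 + x) * hzx

theorem reduced_of_isSolution (ha : √(1 + 2 * μ) = a) (hμ : a ^ 2 = 1 + 2 * μ) {κ : ℝ}
    (h : IsSolution (fun x => Ubar μ x + w x) u κ) : c.Reduced w u where
  theta := c.eulerEq_zFun_zHat fun y hy => (c.theta_eq_iff ha hμ hy).1 (h.eq_theta y hy)
  phi x hx := by
    rw [← (c.phi_eq_iff ha hx _).1 (h.eq_phi x hx)]
    have hEqOn : EqOn (hFun ε (hHat ε u)) (deriv u) Dom := fun y hy => hFun_hHat u hy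
    exact (differentiableAt_deriv_M2 u hx).hasDerivAt.congr_of_eventuallyEq
      (hEqOn.eventuallyEq_of_mem (Dom.mem_nhds hx))

theorem Reduced.hasDerivAt_firstIntegral (h : c.Reduced w u) (hx : x ∈ Dom) :
    HasDerivAt (c.firstIntegral w u) 0 x := by
  have hy := c.hasDerivAt_yFun (c.zHat w) hx
  refine ((((((hasDerivAt_id x).const_add 1).mul (h.theta x hx)).add (hy.const_mul a)).add
    ((hy.pow 2).const_mul (1 / 2))).sub (c.hasDerivAt_psi_div u hx)).congr_deriv ?_
  have hne := (Dom.one_add_pos hx).ne'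
  simp only [id]
  field_simp
  ring

theorem tendsto_firstIntegral (w : M1 ε) (u : M2 ε) :
    Tendsto (c.firstIntegral w u) (𝓝[>] (-1)) (𝓝 (-(1 / 4 * psi u (-1)))) := by
  have hexponent : 0 < 1 - 2 * ε := by linarith [c.lt_half]
  have hz : Tendsto (fun x => (1 + x) * zFun ε (c.zHat w) x) (𝓝[>] (-1)) (𝓝 0) := by
    refine (tendsto_one_add_rpow_mul_zeroExt hexponent (c.zHat w)).congr' ?_
    filter_upwards [Ioo_mem_nhdsGT (show (-1 : ℝ) < 1 by norm_num)] with x hx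
    rw [zFun, ← mul_assoc, mul_comm (1 + x), ← Real.rpow_add_one (Dom.one_add_pos hx).ne',
      show -2 * ε + 1 = 1 - 2 * ε by ring]
  have hy : Tendsto (yFun ε (c.yInt (c.zHat w))) (𝓝[>] (-1)) (𝓝 0) :=
    tendsto_one_add_rpow_mul_zeroExt hexponent _
  have hsq : Tendsto (fun x : ℝ => (1 - x) ^ 2) (𝓝[>] (-1)) (𝓝 ((1 - -1) ^ 2)) :=
    ((tendsto_id.mono_left nhdsWithin_le_nhds).const_sub 1).pow 2
  have hlim := ((hz.add (hy.const_mul a)).add ((hy.pow 2).const_mul (1 / 2))).sub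
    ((c.tendsto_psi u).div hsq (by norm_num))
  rw [show -(1 / 4 * psi u (-1)) =
    0 + a * 0 + 1 / 2 * 0 ^ 2 - psi u (-1) / (1 - -1) ^ 2 by ring]
  exact hlim

theorem Reduced.firstIntegral_eq (h : c.Reduced w u) (hx : x ∈ Dom) :
    c.firstIntegral w u x = -(1 / 4 * psi u (-1)) := by
  obtain ⟨k, hk⟩ := IsOpen.exists_is_const_of_deriv_eq_zero isOpen_Ioo isPreconnected_Ioo
    (fun x hx => (h.hasDerivAt_firstIntegral c hx).differentiableAt.differentiableWithinAt)
    fun x hx => (h.hasDerivAt_firstIntegral c hx).deriv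
  have hconst : Tendsto (c.firstIntegral w u) (𝓝[>] (-1)) (𝓝 k) := by
    refine tendsto_const_nhds.congr' ?_
    filter_upwards [Ioo_mem_nhdsGT (show (-1 : ℝ) < 1 by norm_num)] with x hx
    exact (hk x hx).symm
  rw [hk x hx, tendsto_nhds_unique hconst (c.tendsto_firstIntegral w u)]

theorem Reduced.isSolution (ha : √(1 + 2 * μ) = a) (hμ : a ^ 2 = 1 + 2 * μ) (h : c.Reduced w u) :
    IsSolution (fun x => Ubar μ x + w x) u (μ - 1 / 4 * psi u (-1)) where
  contDiffOn_theta := by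
    refine ContDiffOn.add ?_ (contDiffOn_M1 w)
    unfold Ubar
    fun_prop
  contDiffOn_phi := u.2.2.2.1
  integrable := (c.tailIntegrable_swirlDensity u).intervalIntegrable
  eq_theta x hx := (c.theta_eq_iff ha hμ hx).2 ((h.firstIntegral_eq c hx).trans (by ring))
  eq_phi x hx := by
    have hEqOn : EqOn (deriv u) (hFun ε (hHat ε u)) Dom := fun y hy => (hFun_hHat u hy).symm
    exact (c.phi_eq_iff ha hx _).2 (((h.phi x hx).congr_of_eventuallyEq
      (hEqOn.eventuallyEq_of_mem (Dom.mem_nhds hx))).deriv)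

end Admissible

/-! ### The reduced system as a fixed point equation -/

section EulerEq

variable {a a' k : ℝ} {f f' g g' : ℝ → ℝ}

theorem eulerEq_congr (h : ∀ x ∈ Dom, g x - (1 + a) * f x = g' x - (1 + a') * f x) :
    EulerEq a f g ↔ EulerEq a' f g' := by
  refine forall₂_congr fun x hx => ?_
  rw [h x hx]

theorem EulerEq.add (h : EulerEq a f g) (h' : EulerEq a f' g') :
    EulerEq a (f + f') (g + g') := fun x hx =>
  ((h x hx).add (h' x hx)).congr_deriv (by simp only [Pi.add_apply]; ring)

theorem EulerEq.sub (h : EulerEq a f g) (h' : EulerEq a f' g') :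
    EulerEq a (f - f') (g - g') := fun x hx =>
  ((h x hx).sub (h' x hx)).congr_deriv (by simp only [Pi.sub_apply]; ring)

theorem EulerEq.const_smul (k : ℝ) (h : EulerEq a f g) : EulerEq a (k • f) (k • g) := fun x hx =>
  ((h x hx).const_smul k).congr_deriv (by simp only [Pi.smul_apply, smul_eq_mul]; ring)

end EulerEq

section Linear

variable {ε : ℝ}

theorem zFun_sub (f g : BddFun) : zFun ε (f - g) = zFun ε f - zFun ε g := by
  funext x
  simp only [zFun, zeroExt_sub, mul_sub, Pi.sub_apply]

theorem zFun_smul (k : ℝ) (f : BddFun) : zFun ε (k • f) = k • zFun ε f := by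
  funext x
  simp only [zFun, zeroExt_smul, mul_left_comm, Pi.smul_apply, smul_eq_mul]

theorem hFun_add (f g : BddFun) : hFun ε (f + g) = hFun ε f + hFun ε g := by
  funext x
  simp only [hFun, zeroExt_add, mul_add, Pi.add_apply]

theorem hFun_sub (f g : BddFun) : hFun ε (f - g) = hFun ε f - hFun ε g := by
  funext x
  simp only [hFun, zeroExt_sub, mul_sub, Pi.sub_apply]

theorem hFun_smul (k : ℝ) (f : BddFun) : hFun ε (k • f) = k • hFun ε f := by
  funext x
  simp only [hFun, zeroExt_smul, mul_left_comm, Pi.smul_apply, smul_eq_mul]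

theorem hFun_neg (f : BddFun) : hFun ε (-f) = -hFun ε f := by
  funext x
  simp only [hFun, zeroExt_neg, mul_neg, Pi.neg_apply]

end Linear

namespace Admissible

variable {ε a : ℝ} (c : Admissible ε a)

theorem zSolve_eq_iff {ζ z : BddFun} : c.zSolve ζ = z ↔ EulerEq a (zFun ε z) (zFun ε ζ) := by
  refine ⟨fun h x hx => h ▸ c.hasDerivAt_zFun ζ hx, fun h => c.zSolve_eq h fun x hx => ?_⟩
  rw [mul_div_cancel₀ _ (Dom.one_add_pos hx).ne', sub_add_cancel]

theorem hSolve_eq_iff {g h : BddFun} (h0 : c.uZero h = 0) :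
    c.hSolve g = h ↔ EulerEq a (hFun ε h) (hFun ε g) := by
  refine ⟨fun hg x hx => hg ▸ c.hasDerivAt_hFun g hx, fun hh => c.hSolve_eq hh (fun x hx => ?_) h0⟩
  rw [mul_div_cancel₀ _ (Dom.one_add_pos hx).ne', sub_add_cancel]

theorem eulerEq_hHom : EulerEq a (hFun ε c.hHom) (hFun ε 0) := fun _ hx =>
  c.hasDerivAt_hFun_hHom hx

theorem eulerEq_hHom_add_hSolve (k : BddFun) :
    EulerEq a (hFun ε (c.hHom + c.hSolve k)) (hFun ε k) := by
  have hadd := c.eulerEq_hHom.add ((c.hSolve_eq_iff (c.uZero_hSolve k)).1 rfl)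
  rwa [← hFun_add, ← hFun_add, zero_add] at hadd

/-- The product of the functions represented by `c.yInt z` and by `f`. -/
noncomputable def yMul (z f : BddFun) : BddFun := c.yWeight * c.yInt z * f

theorem zFun_yMul (z f : BddFun) {x : ℝ} (hx : x ∈ Dom) :
    zFun ε (c.yMul z f) x = yFun ε (c.yInt z) x * zFun ε f x := by
  rw [zFun, zFun, yFun, yMul, zeroExt_mul, zeroExt_mul, yWeight, zeroExt_oneAddRpow _ hx]
  ring

theorem hFun_yMul (z f : BddFun) {x : ℝ} (hx : x ∈ Dom) :
    hFun ε (c.yMul z f) x = yFun ε (c.yInt z) x * hFun ε f x := by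
  rw [hFun, hFun, yFun, yMul, zeroExt_mul, zeroExt_mul, yWeight, zeroExt_oneAddRpow _ hx]
  ring

/-- The representative of the derivative of the swirl, where `h` represents the derivative of its
component in `X₁`, and `k` determines the kernel element of a perturbed parameter: see
`smul_hHom_eq`. -/
noncomputable def swirlHat (b : ℝ) (h k : BddFun) : BddFun := b • (c.hHom + c.hSolve k) + h

/-- The right side of the first equation of the reduced system for the parameter `a + t`, where
the left side is `(1+x) z' + (1+a) z`. -/
noncomputable def thetaSource (t : ℝ) (z s : BddFun) : BddFun :=
  c.swirlOp (c.uInt s * s) - t • z - c.yMul z z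

/-- The right side of the second equation of the reduced system for the parameter `a + t`, where
the left side is `(1+x) h' + (1+a) h`. -/
noncomputable def phiSource (t : ℝ) (z h s : BddFun) : BddFun := -(t • h) - c.yMul z s

section ChangeOfParameter

variable {a' : ℝ} (c' : Admissible ε a')

theorem reduced_iff {w : M1 ε} {u : M2 ε} : c'.Reduced w u ↔
    EulerEq a (zFun ε (c.zHat w)) (zFun ε (c.thetaSource (a' - a) (c.zHat w) (hHat ε u))) ∧
      EulerEq a (hFun ε (hHat ε u))
        (hFun ε (c.phiSource (a' - a) (c.zHat w) (hHat ε u) (hHat ε u))) := by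
  have htheta := eulerEq_congr (a := a') (a' := a) (f := zFun ε (c.zHat w))
    (g := fun x => zFun ε (c.swirlOp (c.prodHat u)) x -
      yFun ε (c.yInt (c.zHat w)) x * zFun ε (c.zHat w) x)
    (g' := zFun ε (c.thetaSource (a' - a) (c.zHat w) (hHat ε u))) fun x hx => by
      simp only [thetaSource, zFun_sub, zFun_smul, Pi.sub_apply, Pi.smul_apply, smul_eq_mul,
        c.zFun_yMul _ _ hx, prodHat]
      ring
  have hphi := eulerEq_congr (a := a') (a' := a) (f := hFun ε (hHat ε u))
    (g := fun x => -(yFun ε (c.yInt (c.zHat w)) x * hFun ε (hHat ε u) x))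
    (g' := hFun ε (c.phiSource (a' - a) (c.zHat w) (hHat ε u) (hHat ε u))) fun x hx => by
      simp only [phiSource, hFun_sub, hFun_neg, hFun_smul, Pi.sub_apply, Pi.neg_apply,
        Pi.smul_apply, smul_eq_mul, c.hFun_yMul _ _ hx]
      ring
  exact ⟨fun h => ⟨htheta.1 h.theta, hphi.1 h.phi⟩, fun h => ⟨htheta.2 h.1, hphi.2 h.2⟩⟩

variable {k : BddFun} (hk : k + (a' - a) • (c.hHom + c.hSolve k) = 0) {b β : ℝ}
  (hb : b * c.kerElt 0 = β * c'.kerElt 0)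

include hk hb

theorem smul_hHom_eq : β • c'.hHom = b • (c.hHom + c.hSolve k) := by
  set h := c.hHom + c.hSolve k with hh
  have hk' : ∀ x, hFun ε k x + (a' - a) * hFun ε h x = hFun ε 0 x := fun x => by
    rw [← hk, hFun_add k, hFun_smul]
    rfl
  have hh' : EulerEq a' (hFun ε h) (hFun ε 0) :=
    (eulerEq_congr fun x _ => by linear_combination hk' x).1 (c.eulerEq_hHom_add_hSolve k)
  have hdiff := (hh'.const_smul b).sub (c'.eulerEq_hHom.const_smul β)
  simp only [← hFun_smul, ← hFun_sub, smul_zero, sub_zero] at hdiff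
  have huZero : c'.uZero (b • h - β • c'.hHom) = 0 := by
    have hh0 : c'.uZero h = c.kerElt 0 := by
      rw [hh, map_add, ← c.uZero_hHom]
      exact (congrArg (c.uZero c.hHom + ·) (c.uZero_hSolve k)).trans (add_zero _)
    rw [map_sub, map_smul, map_smul, hh0, uZero_hHom, smul_eq_mul, smul_eq_mul, hb, sub_self]
  have hzero := (c'.hSolve_eq_iff huZero).2 hdiff
  rw [map_zero] at hzero
  exact (sub_eq_zero.1 hzero.symm).symm

theorem hHat_smul_kerElt_add (v : M2 ε) :
    hHat ε (β • c'.kerElt + v) = c.swirlHat b (hHat ε v) k := by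
  rw [map_add, map_smul, hHat_kerElt, c.smul_hHom_eq c' hk hb, swirlHat]

theorem reduced_smul_kerElt_add_iff {w : M1 ε} {v : M2 ε} (hv : v 0 = 0) :
    c'.Reduced w (β • c'.kerElt + v) ↔
      c.zSolve (c.thetaSource (a' - a) (c.zHat w) (c.swirlHat b (hHat ε v) k)) = c.zHat w ∧
      c.hSolve (c.phiSource (a' - a) (c.zHat w) (hHat ε v) (c.swirlHat b (hHat ε v) k)) =
        hHat ε v := by
  rw [c.reduced_iff c', c.hHat_smul_kerElt_add c' hk hb, zSolve_eq_iff,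
    c.hSolve_eq_iff (by rw [uZero_hHat, hv])]
  refine and_congr_right fun _ => ?_
  have hker := (c.eulerEq_hHom_add_hSolve k).const_smul b
  have hsource : c.phiSource (a' - a) (c.zHat w) (c.swirlHat b (hHat ε v) k)
      (c.swirlHat b (hHat ε v) k) = b • k +
        c.phiSource (a' - a) (c.zHat w) (hHat ε v) (c.swirlHat b (hHat ε v) k) := by
    simp only [phiSource, swirlHat]
    linear_combination (norm := module) (-b) • hk
  rw [hsource, hFun_add, hFun_smul, swirlHat, hFun_add, hFun_smul]
  refine ⟨fun h => ?_, fun h => hker.add h⟩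
  simpa using h.sub hker

end ChangeOfParameter

end Admissible

/-! ### The local solution map -/

theorem hasFDerivAt_bilin_of_eq_zero {E F G H : Type*} [NormedAddCommGroup E] [NormedSpace ℝ E]
    [NormedAddCommGroup F] [NormedSpace ℝ F] [NormedAddCommGroup G] [NormedSpace ℝ G]
    [NormedAddCommGroup H] [NormedSpace ℝ H] (B : F →L[ℝ] G →L[ℝ] H) {f : E → F} {g : E → G} {x : E}
    (hf : DifferentiableAt ℝ f x) (hg : DifferentiableAt ℝ g x) (hf0 : f x = 0) (hg0 : g x = 0) :
    HasFDerivAt (fun y => B (f y) (g y)) (0 : E →L[ℝ] H) x := by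
  refine (B.hasFDerivAt_of_bilinear hf.hasFDerivAt hg.hasFDerivAt).congr_fderiv ?_
  ext
  simp [hf0, hg0]

/-- The space of the triples `(p, (e, k))` of parameters and unknowns on which
`Admissible.chartMap` is defined. -/
abbrev ChartSpace : Type := (ℝ × ℝ) × (BddFun × BddFun) × BddFun

namespace Admissible

variable {ε a : ℝ} (c : Admissible ε a)

section ZeroDerivative

variable {G : Type*} [NormedAddCommGroup G] [NormedSpace ℝ G] {t : G → ℝ} {z h s : G → BddFun}
  {x : G}

theorem hasFDerivAt_thetaSource (ht : DifferentiableAt ℝ t x) (hz : DifferentiableAt ℝ z x)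
    (hs : DifferentiableAt ℝ s x) (ht0 : t x = 0) (hz0 : z x = 0) (hs0 : s x = 0) :
    HasFDerivAt (fun y => c.thetaSource (t y) (z y) (s y)) (0 : G →L[ℝ] BddFun) x := by
  have hswirl : HasFDerivAt (fun y => c.uInt (s y) * s y) (0 : G →L[ℝ] BddFun) x :=
    hasFDerivAt_bilin_of_eq_zero ((ContinuousLinearMap.mul ℝ BddFun).comp c.uInt) hs hs hs0 hs0
  have hparam : HasFDerivAt (fun y => t y • z y) (0 : G →L[ℝ] BddFun) x :=
    hasFDerivAt_bilin_of_eq_zero (ContinuousLinearMap.lsmul ℝ ℝ) ht hz ht0 hz0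
  have hquad : HasFDerivAt (fun y => c.yMul (z y) (z y)) (0 : G →L[ℝ] BddFun) x :=
    hasFDerivAt_bilin_of_eq_zero ((ContinuousLinearMap.mul ℝ BddFun).comp
      ((ContinuousLinearMap.mul ℝ BddFun c.yWeight).comp c.yInt)) hz hz hz0 hz0
  refine (((c.swirlOp.hasFDerivAt.comp x hswirl).sub hparam).sub hquad).congr_fderiv ?_
  simp only [ContinuousLinearMap.comp_zero, sub_zero]

theorem hasFDerivAt_phiSource (ht : DifferentiableAt ℝ t x) (hz : DifferentiableAt ℝ z x)
    (hh : DifferentiableAt ℝ h x) (hs : DifferentiableAt ℝ s x) (ht0 : t x = 0) (hz0 : z x = 0)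
    (hh0 : h x = 0) (hs0 : s x = 0) :
    HasFDerivAt (fun y => c.phiSource (t y) (z y) (h y) (s y)) (0 : G →L[ℝ] BddFun) x := by
  have hparam : HasFDerivAt (fun y => t y • h y) (0 : G →L[ℝ] BddFun) x :=
    hasFDerivAt_bilin_of_eq_zero (ContinuousLinearMap.lsmul ℝ ℝ) ht hh ht0 hh0
  have hquad : HasFDerivAt (fun y => c.yMul (z y) (s y)) (0 : G →L[ℝ] BddFun) x :=
    hasFDerivAt_bilin_of_eq_zero ((ContinuousLinearMap.mul ℝ BddFun).comp
      ((ContinuousLinearMap.mul ℝ BddFun c.yWeight).comp c.yInt)) hz hs hz0 hs0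
  refine (hparam.neg.sub hquad).congr_fderiv ?_
  simp only [neg_zero, sub_zero]

end ZeroDerivative

/-- The right sides of the reduced system at the parameters `p = (t, b)`, where `k` determines the
kernel element of the parameter `a + t` and `e` represents the unknown element of `X₁`. -/
noncomputable def chartSource (p : ℝ × ℝ) (k : BddFun) (e : BddFun × BddFun) : BddFun × BddFun :=
  (c.thetaSource p.1 e.1 (c.swirlHat p.2 e.2 k), c.phiSource p.1 e.1 e.2 (c.swirlHat p.2 e.2 k))

theorem contDiff_chartSource : ContDiff ℝ ω
    fun ξ : (ℝ × ℝ) × BddFun × BddFun × BddFun => c.chartSource ξ.1 ξ.2.1 ξ.2.2 := by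
  unfold chartSource thetaSource phiSource yMul swirlHat
  fun_prop

theorem chartSource_zero : c.chartSource 0 0 0 = 0 := by
  simp [chartSource, thetaSource, phiSource, yMul, swirlHat]

theorem hasFDerivAt_chartSource : HasFDerivAt
    (fun ξ : (ℝ × ℝ) × BddFun × BddFun × BddFun => c.chartSource ξ.1 ξ.2.1 ξ.2.2)
    (0 : (ℝ × ℝ) × BddFun × BddFun × BddFun →L[ℝ] BddFun × BddFun) 0 := by
  have hs : Differentiable ℝ fun ξ : (ℝ × ℝ) × BddFun × BddFun × BddFun =>
      c.swirlHat ξ.1.2 ξ.2.2.2 ξ.2.1 := by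
    unfold swirlHat
    fun_prop
  have hs0 : c.swirlHat 0 0 0 = 0 := by simp [swirlHat]
  exact (c.hasFDerivAt_thetaSource (by fun_prop) (by fun_prop) hs.differentiableAt rfl rfl
    hs0).prodMk (c.hasFDerivAt_phiSource (by fun_prop) (by fun_prop) (by fun_prop)
      hs.differentiableAt rfl rfl rfl hs0)

/-- The inverse of the linear part of the reduced system. -/
noncomputable def chartSolve : BddFun × BddFun →L[ℝ] BddFun × BddFun := c.zSolve.prodMap c.hSolve

/-- The reduced system near `a` as an equation `chartMap (p, (e, k)) = 0` in a Banach space, where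
`p` and `k` are as in `chartSource`, and `e` stands for the right sides of the reduced system. -/
noncomputable def chartMap (ξ : ChartSpace) :
    (BddFun × BddFun) × BddFun :=
  (ξ.2.1 - c.chartSource ξ.1 ξ.2.2 (c.chartSolve ξ.2.1),
    ξ.2.2 + ξ.1.1 • (c.hHom + c.hSolve ξ.2.2))

theorem chartMap_eq_zero_iff {p : ℝ × ℝ} {e : BddFun × BddFun} {k : BddFun} :
    c.chartMap (p, (e, k)) = 0 ↔
      c.chartSource p k (c.chartSolve e) = e ∧ k + p.1 • (c.hHom + c.hSolve k) = 0 := by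
  rw [chartMap, Prod.mk_eq_zero, sub_eq_zero, eq_comm (a := e)]

theorem chartMap_zero : c.chartMap 0 = 0 := by
  refine c.chartMap_eq_zero_iff.2 ⟨?_, ?_⟩
  · rw [map_zero, chartSource_zero]
  · simp

theorem contDiff_chartMap : ContDiff ℝ ω c.chartMap :=
  (ContDiff.sub (by fun_prop) (c.contDiff_chartSource.comp
    (g := fun ξ : (ℝ × ℝ) × BddFun × BddFun × BddFun => c.chartSource ξ.1 ξ.2.1 ξ.2.2)
    (f := fun ξ : ChartSpace => (ξ.1, ξ.2.2, c.chartSolve ξ.2.1))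
    (by fun_prop))).prodMk (by fun_prop)

/-- The derivative of `chartMap` at `0`. -/
noncomputable def chartDeriv : ChartSpace →L[ℝ] (BddFun × BddFun) × BddFun :=
  .snd ℝ _ _ + (ContinuousLinearMap.inr ℝ (BddFun × BddFun) BddFun).comp
    (((ContinuousLinearMap.fst ℝ ℝ ℝ).comp (.fst ℝ _ _)).smulRight c.hHom)

theorem hasFDerivAt_chartMap : HasFDerivAt c.chartMap c.chartDeriv 0 := by
  have hid : HasFDerivAt (fun ξ : ChartSpace => ξ.2) (.snd ℝ _ _) 0 := hasFDerivAt_snd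
  have hsource : HasFDerivAt (fun ξ : ChartSpace => c.chartSource ξ.1 ξ.2.2 (c.chartSolve ξ.2.1))
      (0 : ChartSpace →L[ℝ] BddFun × BddFun) 0 := by
    have hinner : DifferentiableAt ℝ
        (fun ξ : ChartSpace => (ξ.1, ξ.2.2, c.chartSolve ξ.2.1)) 0 := by fun_prop
    have houter := c.hasFDerivAt_chartSource
    rw [← show ((0 : ChartSpace).1, (0 : BddFun), c.chartSolve 0) = 0 by simp] at houter
    exact (houter.comp (0 : ChartSpace) hinner.hasFDerivAt).congr_fderiv
      (ContinuousLinearMap.zero_comp _)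
  have hcross : HasFDerivAt (fun ξ : ChartSpace => ξ.1.1 • c.hSolve ξ.2.2)
      (0 : ChartSpace →L[ℝ] BddFun) 0 :=
    hasFDerivAt_bilin_of_eq_zero (ContinuousLinearMap.lsmul ℝ ℝ) (f := fun ξ : ChartSpace => ξ.1.1)
      (g := fun ξ => c.hSolve ξ.2.2) (by fun_prop) (by fun_prop) rfl (map_zero _)
  have hkernel : HasFDerivAt (fun ξ : ChartSpace => ξ.1.1 • c.hHom + ξ.1.1 • c.hSolve ξ.2.2)
      (((ContinuousLinearMap.fst ℝ ℝ ℝ).comp (.fst ℝ _ _)).smulRight c.hHom + 0) 0 :=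
    (ContinuousLinearMap.hasFDerivAt (((ContinuousLinearMap.fst ℝ ℝ ℝ).comp
      (.fst ℝ _ _)).smulRight c.hHom)).add hcross
  simp only [← smul_add] at hkernel
  refine ((hid.fst.sub hsource).prodMk (hid.snd.add hkernel)).congr_fderiv ?_
  ext ξ <;> simp [chartDeriv]

theorem exists_implicit : ∃ φ : ℝ × ℝ → (BddFun × BddFun) × BddFun,
    ContDiffAt ℝ ω φ 0 ∧ φ 0 = 0 ∧ HasDerivAt (fun b => φ (0, b)) 0 0 ∧
    (∀ᶠ p in 𝓝 0, c.chartMap (p, φ p) = 0) ∧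
    ∀ᶠ ξ : ChartSpace in 𝓝 0, c.chartMap ξ = 0 → φ ξ.1 = ξ.2 := by
  have hsmooth : ContDiffAt ℝ ω c.chartMap 0 := c.contDiff_chartMap.contDiffAt
  have hfderiv := c.hasFDerivAt_chartMap.fderiv
  have hinv : (fderiv ℝ c.chartMap 0 ∘L
      .inr ℝ (ℝ × ℝ) ((BddFun × BddFun) × BddFun)).IsInvertible := by
    refine ⟨ContinuousLinearEquiv.refl ℝ _, ?_⟩
    rw [hfderiv]
    ext ξ <;> simp [chartDeriv]
  have hω : (ω : WithTop ℕ∞) ≠ 0 := by simp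
  refine ⟨hsmooth.implicitFunction hω hinv, hsmooth.contDiffAt_implicitFunction hω hinv,
    hsmooth.implicitFunction_apply_self hω hinv, ?_, ?_, ?_⟩
  · have hpartial : fderiv ℝ c.chartMap 0 ((0, 1), 0) = 0 := by simp [hfderiv, chartDeriv]
    have hline : HasDerivAt (fun b : ℝ => ((0 : ℝ), b)) (0, 1) 0 :=
      (hasDerivAt_const _ _).prodMk (hasDerivAt_id _)
    refine (HasFDerivAt.comp_hasDerivAt (0 : ℝ)
      (hsmooth.hasStrictFDerivAt_implicitFunction hω hinv).hasFDerivAt hline).congr_deriv ?_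
    simp [hpartial]
  · have := hsmooth.eventually_apply_implicitFunction hω hinv
    rwa [c.chartMap_zero] at this
  · filter_upwards [hsmooth.eventually_apply_eq_iff_implicitFunction hω hinv] with ξ hξ h
    exact hξ.1 (h.trans c.chartMap_zero.symm)

/-- The pair of representatives of an element of `X₁(ε)`. -/
noncomputable def hatX1 : X1 ε →L[ℝ] BddFun × BddFun :=
  (c.zHat.prodMap (hHat ε)).comp
    ((WithLp.prodContinuousLinearEquiv 1 ℝ (M1 ε) (M2 ε) : X ε →L[ℝ] M1 ε × M2 ε).comp
      (X1 ε).subtypeL)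

theorem hatX1_apply (v : X1 ε) : c.hatX1 v = (c.zHat v.1.fst, hHat ε v.1.snd) := rfl

theorem hatX1_injective : Function.Injective c.hatX1 := fun v w h => by
  rw [hatX1_apply, hatX1_apply, Prod.mk.injEq] at h
  exact Subtype.ext (WithLp.ofLp_injective 1 (Prod.ext (c.zHat_injective h.1)
    (c.hHat_injective h.2)))

/-- The element of `X₁(ε)` whose representatives solve the linear part of the reduced system with
a given right side. -/
noncomputable def chartOut : BddFun × BddFun →L[ℝ] X1 ε :=
  ((WithLp.prodContinuousLinearEquiv 1 ℝ (M1 ε) (M2 ε)).symm.toContinuousLinearMap.comp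
    (c.thetaOp.prodMap c.phiOp)).codRestrict (X1 ε) fun e => by
      change c.phiOp e.2 0 = 0
      rw [← c.uZero_hHat, hHat_phiOp, uZero_hSolve]

theorem hatX1_chartOut (e : BddFun × BddFun) : c.hatX1 (c.chartOut e) = c.chartSolve e :=
  Prod.ext (c.zHat_thetaOp e.1) (c.hHat_phiOp e.2)

section ChangeOfParameter

variable {a' : ℝ} (c' : Admissible ε a') {p : ℝ × ℝ} {k : BddFun} {β : ℝ}

theorem reduced_iff_chartSolve (hk : k + p.1 • (c.hHom + c.hSolve k) = 0) (hp : a' - a = p.1)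
    (hb : p.2 * c.kerElt 0 = β * c'.kerElt 0) (v : X1 ε) :
    c'.Reduced v.1.fst (β • c'.kerElt + v.1.snd) ↔
      c.chartSolve (c.chartSource p k (c.hatX1 v)) = c.hatX1 v := by
  rw [← hp] at hk
  rw [c.reduced_smul_kerElt_add_iff c' hk hb v.2, hatX1_apply, chartSource, chartSolve, ← hp]
  exact (Prod.ext_iff (x := (_, _)) (y := (_, _))).symm

theorem reduced_chartOut (hp : a' - a = p.1) (hb : p.2 * c.kerElt 0 = β * c'.kerElt 0)
    {e : BddFun × BddFun} (h : c.chartMap (p, (e, k)) = 0) :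
    c'.Reduced (c.chartOut e).1.fst (β • c'.kerElt + (c.chartOut e).1.snd) := by
  obtain ⟨he, hk⟩ := c.chartMap_eq_zero_iff.1 h
  rw [c.reduced_iff_chartSolve c' hk hp hb, hatX1_chartOut, he]

theorem chartMap_eq_zero_of_reduced (hk : k + p.1 • (c.hHom + c.hSolve k) = 0) (hp : a' - a = p.1)
    (hb : p.2 * c.kerElt 0 = β * c'.kerElt 0) {v : X1 ε}
    (h : c'.Reduced v.1.fst (β • c'.kerElt + v.1.snd)) :
    c.chartMap (p, (c.chartSource p k (c.hatX1 v), k)) = 0 ∧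
      c.chartOut (c.chartSource p k (c.hatX1 v)) = v := by
  have hsolve := (c.reduced_iff_chartSolve c' hk hp hb v).1 h
  refine ⟨c.chartMap_eq_zero_iff.2 ⟨by rw [hsolve], hk⟩, c.hatX1_injective ?_⟩
  rw [hatX1_chartOut, hsolve]

end ChangeOfParameter

end Admissible

/-! ### Gluing local solution maps -/

theorem exists_pos_forall_eventually_nhds {P : Type*} [TopologicalSpace P] {K : Set P}
    (hK : IsCompact K) {U : ℝ → P → Prop} (hU : ∀ p r r', r ≤ r' → U r' p → U r p)
    (hloc : ∀ k ∈ K, ∃ r > 0, ∀ᶠ p in 𝓝 k, U r p) : ∃ r > 0, ∀ k ∈ K, ∀ᶠ p in 𝓝 k, U r p := by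
  refine hK.induction_on (p := fun s => ∃ r > 0, ∀ k ∈ s, ∀ᶠ p in 𝓝 k, U r p)
    ⟨1, one_pos, by simp⟩ (fun s t hst ⟨r, hr, h⟩ => ⟨r, hr, fun k hk => h k (hst hk)⟩)
    (fun s t ⟨r, hr, h⟩ ⟨r', hr', h'⟩ => ⟨min r r', lt_min hr hr', ?_⟩) fun k hk => ?_
  · rintro k (hk | hk)
    · exact (h k hk).mono fun p => hU p _ _ (min_le_left _ _)
    · exact (h' k hk).mono fun p => hU p _ _ (min_le_right _ _)
  · obtain ⟨r, hr, h⟩ := hloc k hk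
    exact ⟨{p | ∀ᶠ q in 𝓝 p, U r q}, mem_nhdsWithin_of_mem_nhds (eventually_eventually_nhds.2 h),
      r, hr, fun p hp => hp⟩

/-- Local uniqueness lets one glue local solution maps: choosing at each parameter a solution of
norm less than a uniform radius gives a map with the germs of all of them. -/
theorem exists_glued {P X : Type*} [TopologicalSpace P] [SeminormedAddCommGroup X] {K : Set P}
    (hK : IsCompact K) (Sol : P → X → Prop)
    (hloc : ∀ k ∈ K, ∃ V : P → X, ∃ r > 0, ∀ᶠ p in 𝓝 k, ∀ v, ‖v‖ < r → Sol p v → v = V p) :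
    ∃ r > 0, ∃ V : P → X, ∀ k ∈ K, (∀ᶠ p in 𝓝 k, ∀ v, ‖v‖ < r → Sol p v → v = V p) ∧
      ∀ W : P → X, ContinuousAt W k → W k = 0 → (∀ᶠ p in 𝓝 k, Sol p (W p)) → V =ᶠ[𝓝 k] W := by
  classical
  obtain ⟨r, hr, hunique⟩ := exists_pos_forall_eventually_nhds hK
    (U := fun r p => ∀ v w, ‖v‖ < r → ‖w‖ < r → Sol p v → Sol p w → v = w)
    (fun p r r' hrr' h v w hv hw => h v w (hv.trans_le hrr') (hw.trans_le hrr')) fun k hk => by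
      obtain ⟨V, r, hr, h⟩ := hloc k hk
      exact ⟨r, hr, h.mono fun p hp v w hv hw hsv hsw => (hp v hv hsv).trans (hp w hw hsw).symm⟩
  let V : P → X := fun p => if h : ∃ v, ‖v‖ < r ∧ Sol p v then h.choose else 0
  have hV : ∀ k ∈ K, ∀ᶠ p in 𝓝 k, ∀ v, ‖v‖ < r → Sol p v → v = V p := fun k hk => by
    filter_upwards [hunique k hk] with p hp v hv hs
    have hex : ∃ v, ‖v‖ < r ∧ Sol p v := ⟨v, hv, hs⟩
    rw [show V p = hex.choose from dif_pos hex]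
    exact hp v _ hv hex.choose_spec.1 hs hex.choose_spec.2
  refine ⟨r, hr, V, fun k hk => ⟨hV k hk, fun W hW hW0 hs => ?_⟩⟩
  have hsmall : ∀ᶠ p in 𝓝 k, ‖W p‖ < r := hW.norm.eventually_lt_const (by simpa [hW0] using hr)
  filter_upwards [hV k hk, hsmall, hs] with p hp hpr hps using (hp _ hpr hps).symm

/-! ### The family of solutions near `U^μ` -/

section Family

variable {ε a μ : ℝ} (c : Admissible ε a) (ha : √(1 + 2 * μ) = a) (β : ℝ)

include c ha

theorem Admissible.eqOn_kerElt : EqOn (c.kerElt : ℝ → ℝ) (V2phi μ) (Ioc (-1) 1) := fun x hx => by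
  rcases hx.2.lt_or_eq with hx1 | rfl
  · exact c.kerElt_eq ha ⟨hx.1, hx1⟩
  · rw [V2phi, intervalIntegral.integral_same]
    exact c.kerElt.2.1 1 (by simp)

theorem Admissible.familyPhi_eqOn_dom (V : X ε) :
    EqOn (familyPhi μ β V) (β • c.kerElt + V.snd : M2 ε) Dom := fun x hx => by
  change β * V2phi μ x + V.snd x = β * c.kerElt x + V.snd x
  rw [c.kerElt_eq ha hx]

theorem Admissible.intervalIntegrable_psiInner_familyPhi (V : X ε) :
    IntervalIntegrable (psiInner (familyPhi μ β V)) volume (-1) 1 :=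
  (intervalIntegrable_congr_uIoo fun x hx => by
    rw [uIoo_of_le (by norm_num)] at hx
    exact psiInner_congr (c.familyPhi_eqOn_dom ha β V) hx).2
      (c.intervalIntegrable_psiInner (β • c.kerElt + V.snd))

variable (hμ : a ^ 2 = 1 + 2 * μ) {β} {V : X ε}

include hμ

theorem Admissible.reduced_of_isSolution_family {κ : ℝ}
    (h : IsSolution (familyTheta μ V) (familyPhi μ β V) κ) :
    c.Reduced V.fst (β • c.kerElt + V.snd) :=
  c.reduced_of_isSolution ha hμ
    (h.congr (fun _ _ => rfl) (c.familyPhi_eqOn_dom ha β V).symm)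

theorem Admissible.Reduced.isSolution_family (h : c.Reduced V.fst (β • c.kerElt + V.snd)) :
    IsSolution (familyTheta μ V) (familyPhi μ β V)
      (μ - 1 / 4 * psi (familyPhi μ β V) (-1)) := by
  have heq := c.familyPhi_eqOn_dom ha β V
  rw [psi_congr heq (left_mem_Icc.2 (by norm_num))]
  exact (h.isSolution c ha hμ).congr (fun _ _ => rfl) heq

end Family

/-- The pair `U^μ + β V² + v`, where `p = (ν, β)` and `μ = m ν`, solves the system. The
reparametrization `m` is constant when `K = {-1/2}`: there `√(1 + 2μ)` is not smooth. -/
def Solves {ε : ℝ} (m : ℝ → ℝ) (p : ℝ × ℝ) (v : X1 ε) : Prop :=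
  ∃ κ, IsSolution (familyTheta (m p.1) v.1) (familyPhi (m p.1) p.2 v.1) κ

/-- Near `ν₀` the parameters `μ = m ν` satisfy `-1/2 ≤ μ` and `√(1 + 2μ) < ε < 1/2`, and both
`√(1 + 2μ)` and the value at `0` of the swirl of `V²_μ` are smooth functions of `ν`. -/
structure ParamAt (ε : ℝ) (m : ℝ → ℝ) (ν₀ : ℝ) : Prop where
  lt_half : ε < 1 / 2
  lt : √(1 + 2 * m ν₀) < ε
  ge : ∀ᶠ ν in 𝓝 ν₀, -1 / 2 ≤ m ν
  sqrt : ContDiffAt ℝ ω (fun ν => √(1 + 2 * m ν)) ν₀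
  swirl : ContDiffAt ℝ ω (fun ν => V2phi (m ν) 0) ν₀

theorem ParamAt.admissible {ε : ℝ} {m : ℝ → ℝ} {ν₀ : ℝ} (h : ParamAt ε m ν₀) :
    ∀ᶠ ν in 𝓝 ν₀, Admissible ε √(1 + 2 * m ν) ∧ √(1 + 2 * m ν) ^ 2 = 1 + 2 * m ν := by
  filter_upwards [h.ge, h.sqrt.continuousAt.eventually_lt_const h.lt] with ν hge hlt
  exact ⟨⟨Real.sqrt_nonneg _, hlt, h.lt_half⟩, Real.sq_sqrt (by linarith)⟩

section Chart

variable {ε a : ℝ} (c : Admissible ε a) {m : ℝ → ℝ} {ν₀ : ℝ}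

/-- The parameters of `chartMap` that correspond to the parameters `(ν, β)` of `Solves`; the second
one is rescaled so that the swirl has the same value at `0`. -/
noncomputable def Admissible.chartParam (m : ℝ → ℝ) (p : ℝ × ℝ) : ℝ × ℝ :=
  (√(1 + 2 * m p.1) - a, p.2 * V2phi (m p.1) 0 / c.kerElt 0)

theorem Admissible.chartParam_snd_mul {p : ℝ × ℝ} (c' : Admissible ε √(1 + 2 * m p.1)) :
    (c.chartParam m p).2 * c.kerElt 0 = p.2 * c'.kerElt 0 := by
  rw [c'.kerElt_eq rfl Dom.zero_mem]
  exact div_mul_cancel₀ _ c.kerElt_zero_pos.ne'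

theorem Admissible.chartParam_self (ha : √(1 + 2 * m ν₀) = a) (β : ℝ) :
    c.chartParam m (ν₀, β) = (0, β) := by
  rw [chartParam, ha, sub_self, ← c.kerElt_eq ha Dom.zero_mem,
    mul_div_cancel_right₀ β c.kerElt_zero_pos.ne']

theorem ParamAt.contDiffAt_chartParam (h : ParamAt ε m ν₀) :
    ContDiffAt ℝ ω (c.chartParam m) (ν₀, 0) :=
  ((h.sqrt.comp (ν₀, (0 : ℝ)) contDiffAt_fst).sub contDiffAt_const).prodMk
    ((contDiffAt_snd.mul (h.swirl.comp (ν₀, (0 : ℝ)) contDiffAt_fst)).div_const _)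

section Correspondence

variable {p : ℝ × ℝ} (c' : Admissible ε √(1 + 2 * m p.1))
  (hm : √(1 + 2 * m p.1) ^ 2 = 1 + 2 * m p.1)

include c' hm

theorem Admissible.solves_chartOut {e : BddFun × BddFun} {k : BddFun}
    (h : c.chartMap (c.chartParam m p, (e, k)) = 0) : Solves m p (c.chartOut e) :=
  ⟨_, (c.reduced_chartOut c' rfl (c.chartParam_snd_mul c') h).isSolution_family c' rfl hm⟩

theorem Admissible.chartMap_eq_zero_of_solves {k : BddFun}
    (hk : k + (c.chartParam m p).1 • (c.hHom + c.hSolve k) = 0) {v : X1 ε} (h : Solves m p v) :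
    c.chartMap (c.chartParam m p, (c.chartSource (c.chartParam m p) k (c.hatX1 v), k)) = 0 ∧
      c.chartOut (c.chartSource (c.chartParam m p) k (c.hatX1 v)) = v := by
  obtain ⟨κ, hκ⟩ := h
  exact c.chartMap_eq_zero_of_reduced c' hk rfl (c.chartParam_snd_mul c')
    (c'.reduced_of_isSolution_family rfl hm hκ)

end Correspondence

theorem exists_radius_of_continuous {P E F Y X : Type*} [TopologicalSpace P] [TopologicalSpace E]
    [TopologicalSpace F] [TopologicalSpace Y] [SeminormedAddCommGroup X] {S : P → F → Y → E}
    (hS : Continuous fun x : P × F × Y => S x.1 x.2.1 x.2.2) {L : X → Y} (hL : Continuous L)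
    {p₀ : P} {φ : P → F} (hφ : ContinuousAt φ p₀) {Q : P × E × F → Prop}
    (hQ : ∀ᶠ ξ in 𝓝 (p₀, S p₀ (φ p₀) (L 0), φ p₀), Q ξ) :
    ∃ r > 0, ∀ᶠ p in 𝓝 p₀, ∀ v, ‖v‖ < r → Q (p, S p (φ p) (L v), φ p) := by
  have hφfst : ContinuousAt (fun x : P × X => φ x.1) (p₀, 0) :=
    ContinuousAt.comp (f := Prod.fst) hφ continuousAt_fst
  have hsource : ContinuousAt (fun x : P × X => S x.1 (φ x.1) (L x.2)) (p₀, 0) :=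
    hS.continuousAt.comp
      (continuousAt_fst.prodMk (hφfst.prodMk (hL.continuousAt.comp continuousAt_snd)))
  have hev := (continuousAt_fst.prodMk (hsource.prodMk hφfst)).eventually hQ
  rw [nhds_prod_eq] at hev
  obtain ⟨P, hP, R, hR, hPR⟩ := eventually_prod_iff.1 hev
  obtain ⟨r, hr, hball⟩ := Metric.eventually_nhds_iff_ball.1 hR
  exact ⟨r, hr, hP.mono fun p hp v hv => hPR hp (hball v (mem_ball_zero_iff.2 hv))⟩

theorem Admissible.exists_radius {φ : ℝ × ℝ → BddFun} (hφ : ContinuousAt φ 0)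
    (hφ0 : φ 0 = 0) {Q : ChartSpace → Prop} (hQ : ∀ᶠ ξ in 𝓝 0, Q ξ) :
    ∃ r > 0, ∀ᶠ p in 𝓝 0, ∀ v : X1 ε, ‖v‖ < r →
      Q (p, (c.chartSource p (φ p) (c.hatX1 v), φ p)) := by
  refine exists_radius_of_continuous c.contDiff_chartSource.continuous c.hatX1.continuous hφ ?_
  rw [hφ0, map_zero, c.chartSource_zero]
  exact hQ

theorem ParamAt.exists_local (h : ParamAt ε m ν₀) :
    ∃ V : ℝ × ℝ → X1 ε, ContDiffAt ℝ ω V (ν₀, 0) ∧ V (ν₀, 0) = 0 ∧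
      HasDerivAt (fun β => V (ν₀, β)) 0 0 ∧ (∀ᶠ p in 𝓝 (ν₀, 0), Solves m p (V p)) ∧
      ∃ r > 0, ∀ᶠ p in 𝓝 (ν₀, 0), ∀ v : X1 ε, ‖v‖ < r → Solves m p v → v = V p := by
  obtain ⟨c, -⟩ := h.admissible.self_of_nhds
  obtain ⟨φ, hφ, hφ0, hφ', hφs, hφu⟩ := c.exists_implicit
  have hadm : ∀ᶠ p : ℝ × ℝ in 𝓝 (ν₀, 0), Admissible ε √(1 + 2 * m p.1) ∧
      √(1 + 2 * m p.1) ^ 2 = 1 + 2 * m p.1 :=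
    (continuous_fst.tendsto (ν₀, (0 : ℝ))).eventually h.admissible
  have hθ := h.contDiffAt_chartParam c
  have hθ0 : c.chartParam m (ν₀, 0) = 0 := c.chartParam_self rfl 0
  have hθt : Tendsto (c.chartParam m) (𝓝 (ν₀, 0)) (𝓝 0) := hθ0 ▸ hθ.continuousAt.tendsto
  let chartFst : (BddFun × BddFun) × BddFun →L[ℝ] X1 ε := c.chartOut.comp (.fst ℝ _ _)
  refine ⟨fun p => chartFst (φ (c.chartParam m p)), ?_, ?_, ?_, ?_, ?_⟩
  · exact chartFst.contDiff.contDiffAt.comp _ (ContDiffAt.comp _ (hθ0.symm ▸ hφ) hθ)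
  · simp only [hθ0, hφ0, map_zero]
  · simp only [c.chartParam_self rfl]
    exact (chartFst.hasFDerivAt.comp_hasDerivAt (0 : ℝ) hφ').congr_deriv (map_zero _)
  · filter_upwards [hadm, hθt.eventually hφs] with p ⟨c', hm⟩ hp
    exact c.solves_chartOut c' hm hp
  · obtain ⟨r, hr, hrad⟩ := c.exists_radius hφ.continuousAt.snd (congrArg Prod.snd hφ0) hφu
    refine ⟨r, hr, ?_⟩
    filter_upwards [hadm, hθt.eventually hφs, hθt.eventually hrad] with p ⟨c', hm⟩ hp hu v hv hs
    obtain ⟨hzero, hout⟩ :=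
      c.chartMap_eq_zero_of_solves c' hm (c.chartMap_eq_zero_iff.1 hp).2 hs
    exact hout.symm.trans (congrArg chartFst (hu v hv hzero)).symm

end Chart

section Decomposition

variable {ε a : ℝ} (c : Admissible ε a)

theorem Admissible.norm_hHom_le : ‖c.hHom‖ ≤ 2 := by
  refine BddFun.norm_le zero_le_two fun x hx => ?_
  have hle : 0 ≤ ε - a := sub_nonneg.2 c.lt.le
  rw [hHom, zeroExt_neg, zeroExt_oneAddRpow hle hx, abs_neg, abs_of_pos (Dom.rpow_pos _ hx)]
  calc (1 + x) ^ (ε - a) ≤ 2 ^ (ε - a) := Dom.rpow_le hle hx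
    _ ≤ 2 ^ (1 : ℝ) :=
        Real.rpow_le_rpow_of_exponent_le one_le_two (by linarith [c.lt_half, c.nonneg])
    _ = 2 := Real.rpow_one 2

theorem Admissible.norm_kerElt_le : ‖c.kerElt‖ ≤ 4 * ‖tailOp 0 ε c.pos‖ + 6 := by
  have huInt : ‖c.uInt c.hHom‖ ≤ ‖tailOp 0 ε c.pos‖ * 2 := by
    rw [uInt, neg_apply, norm_neg]
    exact ContinuousLinearMap.le_opNorm_of_le _ c.norm_hHom_le
  linarith [c.norm_kerElt_le_add, c.norm_hHom_le]

theorem Admissible.one_div_four_le_kerElt_zero : 1 / 4 ≤ c.kerElt 0 := by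
  have hweight : ∀ s ∈ Icc (0 : ℝ) 1, 1 / 4 ≤ (1 + s) ^ (-(1 + a)) := fun s hs => by
    calc (1 / 4 : ℝ) = 2 ^ (-2 : ℝ) := by
          rw [Real.rpow_neg zero_le_two, Real.rpow_two]; norm_num
      _ ≤ 2 ^ (-(1 + a)) :=
          Real.rpow_le_rpow_of_exponent_le one_le_two (by linarith [c.lt, c.lt_half])
      _ ≤ (1 + s) ^ (-(1 + a)) :=
          Real.rpow_le_rpow_of_nonpos (by linarith [hs.1]) (by linarith [hs.2])
            (by linarith [c.nonneg])
  rw [c.kerElt_eq_tailInt Dom.zero_mem]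
  calc (1 / 4 : ℝ) = ∫ _ in (0 : ℝ)..1, 1 / 4 := by simp
    _ ≤ tailInt (fun s => (1 + s) ^ (-(1 + a))) 0 :=
        intervalIntegral.integral_mono_on zero_le_one (by simp)
          ((TailIntegrable.of_continuousOn_Ioc (continuousOn_one_add_rpow _)).intervalIntegrable 0
            Dom.zero_mem) hweight

theorem abs_apply_zero_le (u : M2 ε) : |u 0| ≤ ‖u‖ := by
  have hle : |u 0| ≤ wSup (Ioo (-1) 1) (fun x => (1 + x) ^ ε) u := by
    simpa using le_wSup u.2.2.2.2.1 Dom.zero_mem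
  exact hle.trans ((le_add_of_nonneg_right wSup_nonneg).trans (le_add_of_nonneg_right wSup_nonneg))

theorem Admissible.exists_decomposition {μ : ℝ} (ha : √(1 + 2 * μ) = a) (W : X ε) :
    ∃ (β : ℝ) (v : X1 ε), |β| ≤ 4 * ‖W‖ ∧
      ‖v‖ ≤ (1 + 4 * (4 * ‖tailOp 0 ε c.pos‖ + 6)) * ‖W‖ ∧
      W.fst = v.1.fst ∧ EqOn (W.snd : ℝ → ℝ) (familyPhi μ β v.1) (Ioc (-1) 1) := by
  have hk := c.kerElt_zero_pos
  have hW : ‖W‖ = ‖W.fst‖ + ‖W.snd‖ := norm_X ε W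
  let β := W.snd 0 / c.kerElt 0
  let w : X ε := WithLp.toLp 1 (W.fst, W.snd - β • c.kerElt)
  have hβ : |β| ≤ 4 * ‖W‖ := by
    rw [abs_div, abs_of_pos hk, div_le_iff₀ hk]
    calc |W.snd 0| ≤ ‖W.snd‖ := abs_apply_zero_le W.snd
      _ ≤ 4 * ‖W‖ * (1 / 4) := by linarith [norm_nonneg W.fst]
      _ ≤ 4 * ‖W‖ * c.kerElt 0 := by gcongr; exact c.one_div_four_le_kerElt_zero
  have hβk : ‖β • c.kerElt‖ ≤ 4 * ‖W‖ * (4 * ‖tailOp 0 ε c.pos‖ + 6) := by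
    rw [norm_smul]
    exact mul_le_mul hβ c.norm_kerElt_le (norm_nonneg _) (by positivity)
  have hw0 : w.snd 0 = 0 := sub_eq_zero_of_eq (div_mul_cancel₀ _ hk.ne').symm
  have hw : ‖w‖ ≤ (1 + 4 * (4 * ‖tailOp 0 ε c.pos‖ + 6)) * ‖W‖ := by
    have hnorm : ‖w‖ = ‖W.fst‖ + ‖W.snd - β • c.kerElt‖ := norm_X ε w
    linarith [norm_sub_le W.snd (β • c.kerElt)]
  refine ⟨β, ⟨w, hw0⟩, hβ, hw, rfl, fun x hx => ?_⟩
  change W.snd x = β * V2phi μ x + (W.snd x - β * c.kerElt x)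
  rw [c.eqOn_kerElt ha hx]
  ring

theorem exists_familyTheta_familyPhi_of_norm_lt {δ r : ℝ} (hε0 : 0 < ε) (hδ : 0 < δ)
    (hr : 0 < r) : ∃ δ' > 0, ∀ {a μ : ℝ}, Admissible ε a → √(1 + 2 * μ) = a →
      ∀ {Uθ Uφ : ℝ → ℝ} {W : X ε},
        (∀ x ∈ Ioc (-1 : ℝ) 1, Uθ x - Ubar μ x = W.fst x ∧ Uφ x = W.snd x) → ‖W‖ < δ' →
        ∃ (β : ℝ) (v : X1 ε), |β| < δ ∧ ‖v‖ < r ∧ ∀ x ∈ Ioc (-1 : ℝ) 1,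
          Uθ x = familyTheta μ v.1 x ∧ Uφ x = familyPhi μ β v.1 x := by
  have hC : 0 < 1 + 4 * (4 * ‖tailOp 0 ε hε0‖ + 6) := by positivity
  refine ⟨min (δ / 4) (r / (1 + 4 * (4 * ‖tailOp 0 ε hε0‖ + 6))),
    lt_min (by positivity) (div_pos hr hC), fun {_ _} c ha {_ _ W} hW hWδ' => ?_⟩
  obtain ⟨hWδ, hWr⟩ := lt_min_iff.1 hWδ'
  obtain ⟨β, v, hβ, hv, hfst, hsnd⟩ := c.exists_decomposition ha W
  rw [lt_div_iff₀' hC] at hWr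
  refine ⟨β, v, by linarith, hv.trans_lt hWr, fun x hx => ⟨?_, (hW x hx).2.trans (hsnd hx)⟩⟩
  rw [familyTheta, ← hfst, ← (hW x hx).1, add_sub_cancel]

end Decomposition

theorem paramAt_const {ε ν : ℝ} (h0 : 0 < ε) (h : ε < 1 / 2) : ParamAt ε (fun _ => -1 / 2) ν where
  lt_half := h
  lt := by norm_num [h0]
  ge := by simp
  sqrt := contDiffAt_const
  swirl := contDiffAt_const

theorem V2phi_zero_eq {μ : ℝ} (hμ : -1 / 2 < μ) :
    V2phi μ 0 = (1 - 2 ^ (-√(1 + 2 * μ))) / √(1 + 2 * μ) := by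
  rw [V2phi_eq_tailInt Dom.zero_mem, neg_add',
    tailInt_one_add_rpow (Real.sqrt_pos.2 (by linarith)) Dom.zero_mem, add_zero, Real.one_rpow]

theorem paramAt_id {ε ν : ℝ} (h : ε < 1 / 2) (hν : -1 / 2 < ν) (hlt : √(1 + 2 * ν) < ε) :
    ParamAt ε id ν := by
  have hsqrt : ContDiffAt ℝ ω (fun ν : ℝ => √(1 + 2 * ν)) ν :=
    ContDiffAt.sqrt (by fun_prop) (by linarith)
  have hpos : 0 < √(1 + 2 * ν) := Real.sqrt_pos.2 (by linarith)
  refine ⟨h, hlt, ?_, hsqrt, ?_⟩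
  · filter_upwards [lt_mem_nhds hν] with μ hμ using le_of_lt hμ
  · have hswirl : ContDiffAt ℝ ω (fun μ => (1 - 2 ^ (-√(1 + 2 * μ))) / √(1 + 2 * μ)) ν :=
      (contDiffAt_const.sub (contDiffAt_const.rpow hsqrt.neg two_ne_zero)).div hsqrt hpos.ne'
    refine hswirl.congr_of_eventuallyEq ?_
    filter_upwards [lt_mem_nhds hν] with μ hμ using V2phi_zero_eq hμ

theorem exists_paramAt {K : Set ℝ} (hK : K ⊆ Ioi (-1 / 2) ∨ K = {-1 / 2}) {ε : ℝ} (hε0 : 0 < ε)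
    (hεK : ∀ μ ∈ K, √(1 + 2 * μ) < ε) (hε : ε < 1 / 2) :
    ∃ m : ℝ → ℝ, (∀ μ ∈ K, m μ = μ) ∧ ∀ μ ∈ K, ParamAt ε m μ := by
  rcases hK with hsub | rfl
  · exact ⟨id, fun _ _ => rfl, fun μ hμ => paramAt_id hε (hsub hμ) (hεK μ hμ)⟩
  · exact ⟨fun _ => -1 / 2, fun μ hμ => hμ.symm, fun μ _ => paramAt_const hε0 hε⟩

section SolutionMap

variable {K : Set ℝ} {ε : ℝ} {m : ℝ → ℝ}

theorem exists_solution_germs (hK : IsCompact K) (hm : ∀ μ ∈ K, ParamAt ε m μ) :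
    ∃ r > 0, ∃ V : ℝ × ℝ → X1 ε, ∀ μ ∈ K, ContDiffAt ℝ ω V (μ, 0) ∧ V (μ, 0) = 0 ∧
      HasDerivAt (fun β => V (μ, β)) 0 0 ∧ ∀ᶠ p in 𝓝 (μ, 0),
        Solves m p (V p) ∧ ∀ v : X1 ε, ‖v‖ < r → Solves m p v → v = V p := by
  obtain ⟨r, hr, V, hV⟩ := exists_glued (X := X1 ε) (hK.prod (isCompact_singleton (x := (0 : ℝ))))
    (Solves m) (by
      rintro ⟨μ, β⟩ ⟨hμ, rfl⟩
      obtain ⟨W, -, -, -, -, r, hr, hu⟩ := (hm μ hμ).exists_local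
      exact ⟨W, r, hr, hu⟩)
  refine ⟨r, hr, V, fun μ hμ => ?_⟩
  obtain ⟨hunique, hgerm⟩ := hV (μ, 0) ⟨hμ, rfl⟩
  obtain ⟨W, hW, hW0, hWd, hWs, -⟩ := (hm μ hμ).exists_local
  have heq := hgerm W hW.continuousAt hW0 hWs
  have hslice : ContinuousAt (fun β : ℝ => (μ, β)) 0 := by fun_prop
  refine ⟨hW.congr_of_eventuallyEq heq, heq.self_of_nhds.trans hW0,
    hWd.congr_of_eventuallyEq (hslice.eventually heq), ?_⟩
  filter_upwards [heq, hWs, hunique] with p hp hs hu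
  exact ⟨by rwa [hp], hu⟩

theorem exists_prod_ball_subset (hK : IsCompact K) {Q : ℝ × ℝ → Prop}
    (hQ : ∀ μ ∈ K, ∀ᶠ p in 𝓝 (μ, 0), Q p) :
    ∃ δ > 0, ∃ O, IsOpen O ∧ K ⊆ O ∧ ∀ p ∈ O ×ˢ Metric.ball (0 : ℝ) δ, Q p := by
  obtain ⟨O, T, hO, hT, hKO, h0T, hsub⟩ := generalized_tube_lemma hK
    (isCompact_singleton (x := (0 : ℝ))) (n := interior {p | Q p}) isOpen_interior fun
      | (μ, _), ⟨hμ, rfl⟩ => mem_interior_iff_mem_nhds.2 (hQ μ hμ)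
  obtain ⟨δ, hδ, hball⟩ := Metric.isOpen_iff.1 hT 0 (h0T rfl)
  exact ⟨δ, hδ, O, hO, hKO, fun p hp => interior_subset (hsub ⟨hp.1, hball hp.2⟩)⟩

theorem exists_solution_map (hK : IsCompact K) (hm : ∀ μ ∈ K, ParamAt ε m μ) :
    ∃ δ > 0, ∃ r > 0, ∃ V : ℝ × ℝ → X1 ε,
      (∃ O : Set ℝ, IsOpen O ∧ K ⊆ O ∧ ContDiffOn ℝ ∞ V (O ×ˢ Metric.ball (0 : ℝ) δ)) ∧
      (∀ μ ∈ K, V (μ, 0) = 0) ∧ (∀ μ ∈ K, HasDerivAt (fun β : ℝ => V (μ, β)) 0 0) ∧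
      ∀ μ ∈ K, ∀ β ∈ Metric.ball (0 : ℝ) δ, Solves m (μ, β) (V (μ, β)) ∧
        ∀ v : X1 ε, ‖v‖ < r → Solves m (μ, β) v → v = V (μ, β) := by
  obtain ⟨r, hr, V, hV⟩ := exists_solution_germs hK hm
  obtain ⟨δ, hδ, O, hO, hKO, hOδ⟩ := exists_prod_ball_subset hK fun μ hμ =>
    ((hV μ hμ).1.eventually (by simp)).and (hV μ hμ).2.2.2
  exact ⟨δ, hδ, r, hr, V,
    ⟨O, hO, hKO, fun p hp => ((hOδ p hp).1.of_le le_top).contDiffWithinAt⟩,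
    fun μ hμ => (hV μ hμ).2.1, fun μ hμ => (hV μ hμ).2.2.1,
    fun μ hμ β hβ => (hOδ (μ, β) ⟨hKO hμ, hβ⟩).2⟩

end SolutionMap

section Family

variable {ε a μ : ℝ} (c : Admissible ε a) (ha : √(1 + 2 * μ) = a)

include c ha

theorem Admissible.familyPhi_zero_ne_zero {β : ℝ} (hβ : β ≠ 0) (v : X1 ε) :
    familyPhi μ β v.1 0 ≠ 0 := by
  have hv : v.1.snd 0 = 0 := v.2
  rw [familyPhi, hv, add_zero, ← c.kerElt_eq ha Dom.zero_mem]
  exact mul_ne_zero hβ c.kerElt_zero_pos.ne'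

theorem Admissible.isSolution_family_of_isSolution (hμ : a ^ 2 = 1 + 2 * μ) {β : ℝ} {V : X ε}
    {κ : ℝ} (h : IsSolution (familyTheta μ V) (familyPhi μ β V) κ) :
    IsSolution (familyTheta μ V) (familyPhi μ β V) (μ - 1 / 4 * psi (familyPhi μ β V) (-1)) :=
  (c.reduced_of_isSolution_family ha hμ h).isSolution_family c ha hμ

end Family

end ConicalNS

theorem theorem4p3 (K : Set ℝ)
    (hK : (IsCompact K ∧ K ⊆ Ioo (-1 / 2) (-3 / 8)) ∨ K = {-1 / 2})
    (ε : ℝ) (hε0 : 0 < ε) (hεK : ∀ μ ∈ K, √(1 + 2 * μ) < ε) (hε : ε < 1 / 2) :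
    ∃ δ > 0, ∃ V : ℝ × ℝ → X1 ε,
      (∃ O : Set ℝ, IsOpen O ∧ K ⊆ O ∧ ContDiffOn ℝ ∞ V (O ×ˢ Metric.ball (0 : ℝ) δ)) ∧
      (∀ μ ∈ K, V (μ, 0) = 0) ∧
      (∀ μ ∈ K, HasDerivAt (fun β : ℝ => V (μ, β)) 0 0) ∧
      (∀ μ ∈ K, ∀ β ∈ Metric.ball (0 : ℝ) δ,
        IntervalIntegrable (psiInner (familyPhi μ β (V (μ, β)).1)) volume (-1) 1 ∧
        IsSolution (familyTheta μ (V (μ, β)).1) (familyPhi μ β (V (μ, β)).1)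
          (μ - 1 / 4 * psi (familyPhi μ β (V (μ, β)).1) (-1)) ∧
        (β ≠ 0 → ∃ x ∈ Ioo (-1 : ℝ) 1, familyPhi μ β (V (μ, β)).1 x ≠ 0)) ∧
      ∃ δ' > 0, ∀ μ ∈ K, ∀ Uθ Uφ : ℝ → ℝ, ∀ W : X ε,
        (∀ x ∈ Ioc (-1 : ℝ) 1, Uθ x - Ubar μ x = W.fst x ∧ Uφ x = W.snd x) → ‖W‖ < δ' →
        (∃ κ : ℝ, IsSolution Uθ Uφ κ) →
        ∃ β : ℝ, |β| < δ ∧ ∀ x ∈ Ioc (-1 : ℝ) 1,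
          Uθ x = familyTheta μ (V (μ, β)).1 x ∧ Uφ x = familyPhi μ β (V (μ, β)).1 x := by
  have hKc : IsCompact K := hK.elim And.left fun h => h ▸ isCompact_singleton
  obtain ⟨m, hmK, hm⟩ :=
    exists_paramAt (hK.imp_left fun h => h.2.trans Ioo_subset_Ioi_self) hε0 hεK hε
  obtain ⟨δ, hδ, r, hr, V, hO, hV0, hVd, hV⟩ := exists_solution_map hKc hm
  have hadm : ∀ μ ∈ K, Admissible ε √(1 + 2 * μ) ∧ √(1 + 2 * μ) ^ 2 = 1 + 2 * μ := fun μ hμ => by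
    simpa only [hmK μ hμ] using (hm μ hμ).admissible.self_of_nhds
  obtain ⟨δ', hδ', hnear⟩ := exists_familyTheta_familyPhi_of_norm_lt hε0 hδ hr
  simp only [Solves] at hV
  refine ⟨δ, hδ, V, hO, hV0, hVd, fun μ hμ β hβ => ?_, δ', hδ',
    fun μ hμ Uθ Uφ W hW hWδ' ⟨κ, hκ⟩ => ?_⟩
  · obtain ⟨c, hc⟩ := hadm μ hμ
    obtain ⟨κ, hκ⟩ := (hV μ hμ β hβ).1
    rw [hmK μ hμ] at hκ
    exact ⟨c.intervalIntegrable_psiInner_familyPhi rfl β _,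
      c.isSolution_family_of_isSolution rfl hc hκ,
      fun hβ0 => ⟨0, Dom.zero_mem, c.familyPhi_zero_ne_zero rfl hβ0 _⟩⟩
  · obtain ⟨β, v, hβ, hv, hU⟩ := hnear (hadm μ hμ).1 rfl hW hWδ'
    have hsol : IsSolution (familyTheta μ v.1) (familyPhi μ β v.1) κ :=
      hκ.congr (fun x hx => (hU x (Ioo_subset_Ioc_self hx)).1.symm)
        fun x hx => (hU x (Ioo_subset_Ioc_self hx)).2.symm
    have hvV : v = V (μ, β) :=
      (hV μ hμ β (by simpa using hβ)).2 v hv ⟨κ, by rwa [hmK μ hμ]⟩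
    exact ⟨β, hβ, hvV ▸ hU⟩
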